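/- For integers $n\ge 2$ and $d\ge 1$ let $R_{n,d}=\mathbb{Z}[a_w : w\in\mathbb{Z}_{\ge 0}^{n+2},\ |w|=d]$, where $|w|=w_0+\cdots+w_{n+1}$, and let $P=\sum_{|w|=d}a_w x^w$ be the generic homogeneous polynomial of degree $d$ in $x_0,\dots,x_{n+1}$. There exist non-zero polynomials $\Delta_{n,d}\in R_{n,d}$, computable by an algorithm with input $(n,d)$, with the following property. Put $R^{(1)}=(R_{n,d}\otimes_{\mathbb{Z}}\mathbb{Q})[1/\Delta_{n,d}]$ and $T=\operatorname{Spec}R^{(1)}$, let $X\subset\mathbb{P}^{n+1}_T$ be the hypersurface $P=0$, and let $U=\mathbb{P}^{n+1}_T\setminus X$ be its affine complement. Let $\Omega=\sum_{i=0}^{n+1}(-1)^i x_i\,dx_0\wedge\cdots\wedge\widehat{dx_i}\wedge\cdots\wedge dx_{n+1}$. Then the relative algebraic de Rham cohomology $H^{n+1}_{dR}(U/T)$, i.e. the closed $(n+1)$-forms in $\Gamma(U,\Omega^{\bullet}_{U/T})$ modulo the exact ones, is a free $R^{(1)}$-module, with basis the classes of the forms $x^w\Omega/P^k$, where $(w,k)$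 runs over all $w\in\mathbb{Z}_{\ge 0}^{n+2}$, $k\in\mathbb{Z}$ with $0\le w_i<d-1$ for all $i$ and $|w|+n+2=kd$. -/

import Mathlib

open scoped KaehlerDifferential
noncomputable section
namespace AlgDeRham
universe u v
variable (R : Type u) (S : Type v) [CommRing R] [CommRing S] [Algebra R S]

/-- The graded-commutative algebra of Kähler differential forms of `S` over `R`. -/
abbrev Forms : Type v := ExteriorAlgebra S (Ω[S⁄R])

/-- The one-form `da`. -/
def form1 (a : S) : Forms R S := ExteriorAlgebra.ι S (KaehlerDifferential.D R S a)

theorem form1_mul (a b : S) :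
    form1 R S (a * b) = algebraMap S (Forms R S) a * form1 R S b
      + form1 R S a * algebraMap S (Forms R S) b := by
  simp [form1, ← Algebra.smul_def, ← Algebra.commutes]

theorem form1_anti (a b : S) : form1 R S a * form1 R S b + form1 R S b * form1 R S a = 0 :=
  ExteriorAlgebra.ι_add_mul_swap _ _

theorem form1_sq (a : S) : form1 R S a * form1 R S a = 0 :=
  ExteriorAlgebra.ι_sq_zero _

/-! ### The exterior derivative

The exterior derivative `ω ↦ dω` is the upper right entry of the multiplicative map
`ω ↦ !![±ω, dω; 0, ω]`, which the universal property of the exterior algebra provides.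
It is characterised by `extD_algebraMap`, `extD_form1` and `extD_mul` below. -/

def scalarMat : S →+* Matrix (Fin 2) (Fin 2) (Forms R S) where
  toFun a := !![algebraMap S _ a, form1 R S a; 0, algebraMap S _ a]
  map_one' := by
    simp [form1, Matrix.one_fin_two]
  map_zero' := by
    ext i j; fin_cases i <;> fin_cases j <;> simp [form1]
  map_add' a b := by
    ext i j; fin_cases i <;> fin_cases j <;> simp [form1]
  map_mul' a b := by
    rw [Matrix.mul_fin_two, form1_mul]; simp

theorem scalarMat_apply (a : S) :
    scalarMat R S a = !![algebraMap S _ a, form1 R S a; 0, algebraMap S _ a] := rfl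

abbrev MatAlg : Subring (Matrix (Fin 2) (Fin 2) (Forms R S)) :=
  Subring.centralizer (Set.range (scalarMat R S))

def scalarHom : S →+* MatAlg R S :=
  (scalarMat R S).codRestrict (MatAlg R S) (by
    intro a
    rw [Subring.mem_centralizer_iff]
    rintro _ ⟨b, rfl⟩
    rw [← map_mul, ← map_mul, mul_comm])

theorem scalarHom_comm (a : S) (m : MatAlg R S) : scalarHom R S a * m = m * scalarHom R S a :=
  Subtype.ext ((Subring.mem_centralizer_iff.1 m.2) _ ⟨a, rfl⟩)

instance : Algebra S (MatAlg R S) := (scalarHom R S).toAlgebra' (scalarHom_comm R S)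

instance : Algebra R (MatAlg R S) :=
  ((scalarHom R S).comp (algebraMap R S)).toAlgebra' (fun _ m => scalarHom_comm R S _ m)

instance : IsScalarTower R S (MatAlg R S) := IsScalarTower.of_algebraMap_eq' rfl

theorem coe_smul_matAlg (a : S) (m : MatAlg R S) :
    ((a • m : MatAlg R S) : Matrix (Fin 2) (Fin 2) (Forms R S)) = scalarMat R S a * m.1 := by
  rw [Algebra.smul_def]; rfl

def derMatVal (a : S) : MatAlg R S :=
  ⟨!![-form1 R S a, 0; 0, form1 R S a], by
    rw [Subring.mem_centralizer_iff]
    rintro _ ⟨b, rfl⟩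
    rw [scalarMat_apply, Matrix.mul_fin_two, Matrix.mul_fin_two]
    have h := eq_neg_of_add_eq_zero_left (form1_anti R S b a)
    simp [h, Algebra.commutes]⟩

def derMat : Derivation R S (MatAlg R S) :=
  Derivation.mk'
    { toFun := derMatVal R S
      map_add' := fun a b => by
        apply Subtype.ext
        simp only [derMatVal, Subring.coe_add]
        ext i j; fin_cases i <;> fin_cases j <;> simp [form1, add_comm]
      map_smul' := fun r a => by
        apply Subtype.ext
        rw [RingHom.id_apply, ← algebraMap_smul S r (derMatVal R S a), coe_smul_matAlg]
        simp only [derMatVal]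
        rw [scalarMat_apply, Matrix.mul_fin_two, Algebra.smul_def r a, form1_mul]
        simp [form1] }
    (fun a b => by
      apply Subtype.ext
      simp only [Subring.coe_add, coe_smul_matAlg, LinearMap.coe_mk, AddHom.coe_mk]
      simp only [derMatVal, scalarMat_apply, Matrix.mul_fin_two]
      have h := form1_anti R S a b
      ext i j; fin_cases i <;> fin_cases j <;>
        simp [form1_mul, h, Algebra.commutes, add_comm])

def formMat : Ω[S⁄R] →ₗ[S] MatAlg R S := (derMat R S).liftKaehlerDifferential

theorem formMat_D (a : S) : formMat R S (KaehlerDifferential.D R S a) = derMatVal R S a :=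
  (derMat R S).liftKaehlerDifferential_comp_D a

theorem formMat_anti (x y : Ω[S⁄R]) :
    formMat R S x * formMat R S y + formMat R S y * formMat R S x = 0 := by
  have hx : x ∈ Submodule.span S (Set.range (KaehlerDifferential.D R S)) := by
    rw [KaehlerDifferential.span_range_derivation]; trivial
  have hy : y ∈ Submodule.span S (Set.range (KaehlerDifferential.D R S)) := by
    rw [KaehlerDifferential.span_range_derivation]; trivial
  induction hx using Submodule.span_induction with
  | zero => simp
  | add x x' _ _ h h' => rw [map_add, add_mul, mul_add, add_add_add_comm, h, h', add_zero]
  | smul a x _ h => rw [map_smul, smul_mul_assoc, mul_smul_comm, ← smul_add, h, smul_zero]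
  | mem x hx =>
    obtain ⟨a, rfl⟩ := hx
    induction hy using Submodule.span_induction with
    | zero => simp
    | add x x' _ _ h h' => rw [map_add, mul_add, add_mul, add_add_add_comm, h, h', add_zero]
    | smul a x _ h => rw [map_smul, smul_mul_assoc, mul_smul_comm, ← smul_add, h, smul_zero]
    | mem x hx =>
      obtain ⟨b, rfl⟩ := hx
      rw [formMat_D, formMat_D]
      apply Subtype.ext
      have h := form1_anti R S a b
      simp only [derMatVal, Subring.coe_add, Subring.coe_mul, Matrix.mul_fin_two]
      ext i j; fin_cases i <;> fin_cases j <;> simp [h]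

theorem formMat_sq (x : Ω[S⁄R]) : formMat R S x * formMat R S x = 0 := by
  have hx : x ∈ Submodule.span S (Set.range (KaehlerDifferential.D R S)) := by
    rw [KaehlerDifferential.span_range_derivation]; trivial
  induction hx using Submodule.span_induction with
  | zero => simp
  | add x y _ _ h h' =>
    have := formMat_anti R S x y
    rw [map_add, add_mul, mul_add, mul_add, h, h', zero_add, add_zero, this]
  | smul a x _ h => rw [map_smul, smul_mul_assoc, mul_smul_comm, h, smul_zero, smul_zero]
  | mem x hx =>
    obtain ⟨a, rfl⟩ := hx
    rw [formMat_D]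
    apply Subtype.ext
    have h := form1_sq R S a
    simp only [derMatVal, Subring.coe_mul, Matrix.mul_fin_two]
    ext i j; fin_cases i <;> fin_cases j <;> simp [h]

def formsMat : Forms R S →ₐ[S] MatAlg R S :=
  ExteriorAlgebra.lift S ⟨formMat R S, formMat_sq R S⟩

theorem formsMat_smul_base (r : R) (x : Forms R S) (i j : Fin 2) :
    (formsMat R S (r • x)).1 i j = r • (formsMat R S x).1 i j := by
  rw [← algebraMap_smul S r x, map_smul, coe_smul_matAlg, scalarMat_apply,
    ← algebraMap_smul S r ((formsMat R S x).1 i j), Matrix.mul_apply, Fin.sum_univ_two]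
  fin_cases i <;> fin_cases j <;> simp [form1, Algebra.smul_def]

/-- The exterior derivative of differential forms. -/
def extD : Forms R S →ₗ[R] Forms R S where
  toFun x := (formsMat R S x).1 0 1
  map_add' x y := by simp
  map_smul' r x := formsMat_smul_base R S r x 0 1


theorem formsMat_algebraMap (a : S) :
    (formsMat R S (algebraMap S _ a)).1 =
      !![algebraMap S _ a, form1 R S a; 0, algebraMap S _ a] := by
  rw [AlgHom.commutes]; rfl

theorem formsMat_form1 (a : S) :
    (formsMat R S (form1 R S a)).1 = !![-form1 R S a, 0; 0, form1 R S a] := by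
  rw [form1, formsMat, ExteriorAlgebra.lift_ι_apply, formMat_D]; rfl

/-- Every form is built from functions and their differentials by sums and products. -/
theorem forms_induction {C : Forms R S → Prop}
    (h0 : ∀ a, C (algebraMap S _ a)) (h1 : ∀ a, C (form1 R S a))
    (hm : ∀ x y, C x → C y → C (x * y)) (ha : ∀ x y, C x → C y → C (x + y)) (x : Forms R S) :
    C x := by
  induction x using ExteriorAlgebra.induction with
  | algebraMap a => exact h0 a
  | mul x y hx hy => exact hm x y hx hy
  | add x y hx hy => exact ha x y hx hy
  | ι w =>
    have hw : w ∈ Submodule.span S (Set.range (KaehlerDifferential.D R S)) := by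
      rw [KaehlerDifferential.span_range_derivation]; trivial
    induction hw using Submodule.span_induction with
    | zero => simpa using h0 0
    | add x y _ _ hx hy => rw [map_add]; exact ha _ _ hx hy
    | smul a x _ hx => rw [map_smul, Algebra.smul_def]; exact hm _ _ (h0 a) hx
    | mem x hx => obtain ⟨a, rfl⟩ := hx; exact h1 a

/-- The sign involution, `(-1)^i` on forms of degree `i`. -/
abbrev signInv : Forms R S →ₐ[S] Forms R S := CliffordAlgebra.involute

theorem signInv_form1 (a : S) : signInv R S (form1 R S a) = -form1 R S a :=
  CliffordAlgebra.involute_ι _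

theorem formsMat_eq (x : Forms R S) :
    (formsMat R S x).1 = !![signInv R S x, extD R S x; 0, x] := by
  have key : (formsMat R S x).1 1 0 = 0 ∧ (formsMat R S x).1 1 1 = x ∧
      (formsMat R S x).1 0 0 = signInv R S x := by
    induction x using forms_induction with
    | h0 a => rw [formsMat_algebraMap]; simp
    | h1 a => rw [formsMat_form1]; simp [signInv_form1]
    | hm x y hx hy =>
      obtain ⟨h1, h2, h3⟩ := hx
      obtain ⟨k1, k2, k3⟩ := hy
      simp only [map_mul, Subring.coe_mul, Matrix.mul_apply, Fin.sum_univ_two, h1, h2, h3, k1, k2,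
        k3]
      simp
    | ha x y hx hy =>
      obtain ⟨h1, h2, h3⟩ := hx
      obtain ⟨k1, k2, k3⟩ := hy
      simp [h1, h2, h3, k1, k2, k3]
  ext i j
  fin_cases i <;> fin_cases j
  · simpa using key.2.2
  · rfl
  · simpa using key.1
  · simpa using key.2.1

theorem extD_algebraMap (a : S) : extD R S (algebraMap S _ a) = form1 R S a := by
  change (formsMat R S (algebraMap S _ a)).1 0 1 = _
  rw [formsMat_algebraMap]; simp

theorem extD_form1 (a : S) : extD R S (form1 R S a) = 0 := by
  change (formsMat R S (form1 R S a)).1 0 1 = _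
  rw [formsMat_form1]; simp

/-- The graded Leibniz rule. -/
theorem extD_mul (x y : Forms R S) :
    extD R S (x * y) = extD R S x * y + signInv R S x * extD R S y := by
  change (formsMat R S (x * y)).1 0 1 = _
  rw [map_mul, Subring.coe_mul, formsMat_eq, formsMat_eq, Matrix.mul_fin_two]
  simp [add_comm]

theorem extD_signInv (x : Forms R S) :
    extD R S (signInv R S x) = -signInv R S (extD R S x) := by
  induction x using forms_induction with
  | h0 a => rw [AlgHom.commutes, extD_algebraMap, signInv_form1, neg_neg]
  | h1 a => rw [signInv_form1, map_neg, extD_form1]; simp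
  | hm x y hx hy =>
    simp only [map_mul, map_add, extD_mul, hx, hy, neg_add, neg_mul, mul_neg]
  | ha x y hx hy => simp only [map_add, hx, hy, neg_add]

theorem extD_extD (x : Forms R S) : extD R S (extD R S x) = 0 := by
  induction x using forms_induction with
  | h0 a => rw [extD_algebraMap, extD_form1]
  | h1 a => rw [extD_form1, map_zero]
  | hm x y hx hy => simp [extD_mul, hx, hy, extD_signInv]
  | ha x y hx hy => simp [hx, hy]

theorem form1_mem (a : S) : form1 R S a ∈ ⋀[S]^1 Ω[S⁄R] := by
  change _ ∈ LinearMap.range (ExteriorAlgebra.ι S) ^ 1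
  rw [pow_one]; exact ⟨_, rfl⟩

/-- The exterior derivative raises the degree by one. -/
theorem extD_mem (i : ℕ) (x : Forms R S) (hx : x ∈ ⋀[S]^i Ω[S⁄R]) :
    extD R S x ∈ ⋀[S]^(i + 1) Ω[S⁄R] := by
  induction i generalizing x with
  | zero =>
    change _ ∈ LinearMap.range (ExteriorAlgebra.ι S) ^ 0 at hx
    rw [pow_zero, Submodule.mem_one] at hx
    obtain ⟨a, rfl⟩ := hx
    rw [extD_algebraMap]
    exact form1_mem R S a
  | succ i ih =>
    change _ ∈ LinearMap.range (ExteriorAlgebra.ι S) ^ (i + 1) at hx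
    change _ ∈ LinearMap.range (ExteriorAlgebra.ι S) ^ (i + 1 + 1)
    rw [pow_succ'] at hx
    induction hx using Submodule.mul_induction_on' with
    | add x _ y _ hx hy => rw [map_add]; exact add_mem hx hy
    | mem_mul_mem m hm y hy =>
      obtain ⟨w, rfl⟩ := hm
      have hw : w ∈ Submodule.span S (Set.range (KaehlerDifferential.D R S)) := by
        rw [KaehlerDifferential.span_range_derivation]; trivial
      induction hw using Submodule.span_induction generalizing y with
      | zero => simp
      | add x x' _ _ h h' =>
        rw [map_add, add_mul, map_add]; exact add_mem (h y hy) (h' y hy)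
      | smul a x _ h =>
        have := h (a • y) (Submodule.smul_mem _ _ hy)
        rwa [map_smul, smul_mul_assoc, ← mul_smul_comm]
      | mem x hx =>
        obtain ⟨b, rfl⟩ := hx
        change extD R S (form1 R S b * y) ∈ _
        rw [extD_mul, extD_form1, zero_mul, zero_add, signInv_form1, neg_mul, neg_mem_iff,
          pow_succ']
        exact Submodule.mul_mem_mul ⟨_, rfl⟩ (ih y hy)

/-- Differential forms of degree `i`, as an `R`-module. -/
abbrev formsOfDegree (i : ℕ) : Submodule R (Forms R S) :=
  (⋀[S]^i Ω[S⁄R]).restrictScalars R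

/-- Closed forms of degree `i`. -/
def closedForms (i : ℕ) : Submodule R (Forms R S) :=
  formsOfDegree R S i ⊓ LinearMap.ker (extD R S)

/-- Exact forms of degree `i`: the derivatives of the forms of degree `i - 1`. -/
def exactForms : ℕ → Submodule R (Forms R S)
  | 0 => ⊥
  | i + 1 => (formsOfDegree R S i).map (extD R S)

theorem exactForms_le (i : ℕ) : exactForms R S i ≤ closedForms R S i := by
  cases i with
  | zero => exact bot_le
  | succ i =>
    rintro _ ⟨x, hx, rfl⟩
    exact ⟨extD_mem R S i x hx, extD_extD R S x⟩

/-- The `i`-th de Rham cohomology of the affine scheme `Spec S` over `Spec R`: closed `i`-forms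
modulo exact ones. -/
abbrev DeRhamCohomology (i : ℕ) : Type v :=
  closedForms R S i ⧸ (exactForms R S i).submoduleOf (closedForms R S i)

/-- The class of a closed form. -/
def deRhamClass (i : ℕ) : closedForms R S i →ₗ[R] DeRhamCohomology R S i :=
  Submodule.mkQ _


variable (S' : Type*) [CommRing S'] [Algebra R S'] [Algebra S S'] [IsScalarTower R S S']

/-- Pullback of differential forms along `Spec S' → Spec S`. -/
def pullback : Forms R S →ₐ[S] Forms R S' :=
  ExteriorAlgebra.lift S
    ⟨(ExteriorAlgebra.ι S').restrictScalars S ∘ₗ KaehlerDifferential.map R R S S', fun x => by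
      simp⟩

theorem pullback_form1 (a : S) :
    pullback R S S' (form1 R S a) = form1 R S' (algebraMap S S' a) := by
  simp [pullback, form1]

end AlgDeRham

namespace GriffithsDwork
open MvPolynomial AlgDeRham

section Geometry
attribute [local instance] MvPolynomial.gradedAlgebra

variable {A : Type*} [CommRing A] {m : ℕ} (P : MvPolynomial (Fin m) A)

/-- The ring `A[x_0, …, x_{m-1}][1/P]`. -/
abbrev ConeRing : Type _ := Localization.Away P

/-- The degree zero part of `A[x_0, …, x_{m-1}][1/P]`. When `P` is homogeneous of positive degree
this is the coordinate ring of the affine complement `U` of the hypersurface `P = 0` in projective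
space over `A` (see `AlgebraicGeometry.Proj.basicOpenIsoSpec`). -/
def ComplementRing : Type _ :=
  HomogeneousLocalization.Away (homogeneousSubmodule (Fin m) A) P

instance : CommRing (ComplementRing P) :=
  inferInstanceAs
    (CommRing (HomogeneousLocalization.Away (homogeneousSubmodule (Fin m) A) P))

/-- The inclusion of the degree zero part. -/
instance : Algebra (ComplementRing P) (ConeRing P) :=
  inferInstanceAs (Algebra
    (HomogeneousLocalization.Away (homogeneousSubmodule (Fin m) A) P) (Localization.Away P))

instance : Algebra A (ComplementRing P) :=
  ((HomogeneousLocalization.fromZeroRingHom (homogeneousSubmodule (Fin m) A)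
    (Submonoid.powers P)).comp (algebraMap A (homogeneousSubmodule (Fin m) A 0))).toAlgebra

instance : IsScalarTower A (ComplementRing P) (ConeRing P) :=
  IsScalarTower.of_algebraMap_eq' rfl

end Geometry

section PoleForms

variable {A : Type*} [CommRing A] {n : ℕ} (P : MvPolynomial (Fin (n + 2)) A)

/-- The homogeneous coordinate `x_i`. -/
def coord (i : Fin (n + 2)) : ConeRing P :=
  algebraMap (MvPolynomial (Fin (n + 2)) A) (ConeRing P) (X i)

/-- `Ω = ∑ (-1)^i x_i dx_0 ∧ ⋯ ∧ (omit dx_i) ∧ ⋯ ∧ dx_{n+1}`. -/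
def volumeForm : Forms A (ConeRing P) :=
  ∑ i : Fin (n + 2), ((-1) ^ (i : ℕ) * coord P i) •
    ExteriorAlgebra.ιMulti (ConeRing P) (n + 1)
      (fun j : Fin (n + 1) => KaehlerDifferential.D A (ConeRing P) (coord P (i.succAbove j)))

/-- The form `x^w Ω / P^k`, on the cone over `U`. -/
def poleForm (w : Fin (n + 2) → ℕ) (k : ℕ) : Forms A (ConeRing P) :=
  ((∏ i, coord P i ^ w i) * Localization.Away.invSelf P ^ k) • volumeForm P

/-- `ω` is the `(n + 1)`-form `x^w Ω / P^k` on `U`: its pullback to the cone over `U` is given by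
that expression. -/
def IsPoleForm (w : Fin (n + 2) → ℕ) (k : ℕ) (ω : Forms A (ComplementRing P)) : Prop :=
  ω ∈ formsOfDegree A (ComplementRing P) (n + 1) ∧
    pullback A (ComplementRing P) (ConeRing P) ω = poleForm P w k

end PoleForms

section Generic

/-- Exponent vectors of the monomials of degree `d` in `x_0, …, x_{n+1}`. -/
def Exps (n d : ℕ) : Type := {w : Fin (n + 2) → ℕ // ∑ i, w i = d}

instance (n d : ℕ) : Fintype (Exps n d) :=
  Fintype.subtype (Finset.piAntidiag Finset.univ d) (by simp)

/-- The ring `ℤ[a_w : |w| = d]`. -/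
abbrev UnivRing (n d : ℕ) : Type := MvPolynomial (Exps n d) ℤ

/-- The ring `ℚ[a_w : |w| = d][1/Δ]`. -/
abbrev BaseRing (n d : ℕ) (Δ : UnivRing n d) : Type :=
  Localization.Away (MvPolynomial.map (Int.castRingHom ℚ) Δ)

/-- The generic polynomial `∑ a_w x^w`, homogeneous of degree `d` in `x_0, …, x_{n+1}`. -/
def genericPoly (n d : ℕ) (Δ : UnivRing n d) : MvPolynomial (Fin (n + 2)) (BaseRing n d Δ) :=
  ∑ w : Exps n d,
    C (algebraMap (MvPolynomial (Exps n d) ℚ) (BaseRing n d Δ) (X w)) * ∏ i, X i ^ w.1 i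

theorem genericPoly_isHomogeneous (n d : ℕ) (Δ : UnivRing n d) :
    (genericPoly n d Δ).IsHomogeneous d := by
  refine IsHomogeneous.sum _ _ _ fun w _ => ?_
  have h := (isHomogeneous_C (Fin (n + 2))
    (algebraMap (MvPolynomial (Exps n d) ℚ) (BaseRing n d Δ) (X w))).mul
    (IsHomogeneous.prod Finset.univ (fun i => (X i : MvPolynomial _ (BaseRing n d Δ)) ^ w.1 i)
      w.1 fun i _ => isHomogeneous_X_pow i (w.1 i))
  rwa [zero_add, w.2] at h

/-- Pairs `(w, k)` with `0 ≤ w_i < d - 1` for all `i` and `|w| + n + 2 = k d`. -/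
def PoleIndex (n d : ℕ) : Type :=
  {p : (Fin (n + 2) → ℕ) × ℕ // (∀ i, p.1 i + 1 < d) ∧ (∑ i, p.1 i) + n + 2 = p.2 * d}

/-- A finite list of terms: an integer coefficient with the list of the variables (with repetition)
that occur in the monomial, each variable `a_w` being written as its exponent vector `w`. -/
abbrev PolyCode : Type := List (ℤ × List (List ℕ))

/-- The variable `a_w`; zero if `w` is not an exponent vector of a monomial of degree `d`. -/
def decodeVar (n d : ℕ) (w : List ℕ) : UnivRing n d :=
  if h : w.length = n + 2 ∧ ∑ i : Fin (n + 2), w.getD i 0 = d then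
    X ⟨fun i => w.getD i 0, h.2⟩
  else 0

/-- The polynomial that a list of terms describes. -/
def decodePoly (n d : ℕ) (c : PolyCode) : UnivRing n d :=
  (c.map fun t => C t.1 * (t.2.map (decodeVar n d)).prod).sum

end Generic

end GriffithsDwork

end

open AlgDeRham GriffithsDwork

/-! Let `π` be the projection to `U` from its cone, the spectrum of `A[x][1/P]`. With `η = dP/(d P)`
and the Euler field `E`, Euler's identity says `ι_E η = 1`. Hence every homogeneous form of weight
zero and positive form degree on the cone is `π*α + η ∧ π*β` (`exists_smul_dcoords_eq`), and `π*` is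
injective (`pullback_injective`). Through `π*ω = g Ω` the `(n+1)`-forms on `U`, all of them closed,
correspond to the functions `g` of degree `-(n+2)` on the cone, and the exact ones to the
divergences `∑ ∂_i h_i` with `h_i` of degree `-(n+1)` (`exists_basis_of_divergences`). What remains
is that the `x^w/P^k` are a basis modulo divergences.

Spanning is the pole reduction of Griffiths and Dwork (`div_mem_span_sup_divergences`): a numerator
in the Jacobian ideal lowers the pole order modulo divergences. It requires that, in each degree,
the Jacobian ideal and the monomials with exponents below `d - 1` span all polynomials. Degrees up
to `(n+2)d` suffice (`monomial_mem_jacobianSpan_of_le`), and there this follows from the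
invertibility of a square Macaulay matrix. `Δ` is its determinant times a nonzero integer. At the
Fermat polynomial `F = ∑ x_i^d` the matrix is diagonal with entries `d` and `1`, so `Δ ≠ 0` and the
Fermat point lies in `T`.

Independence can be tested on all infinitesimal neighbourhoods of the Fermat point, by Krull's
intersection theorem (`eq_zero_of_jetHom`). There `P` differs from `F` by a nilpotent, so functions
with poles along `P` become functions with poles along `F`, compatibly with the partial derivatives.
Explicit functionals, modelled on `∫ x^u e^{-F} dx`, which is a product of values `Γ((u_i+1)/d)` up
to a constant, kill all partial derivatives and are dual to the `x^w/F^k` up to the factor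
`1/(k-1)!`. Hence the coefficients of a relation lie in every power of a nilpotent ideal
(`map_eq_zero_of_mem_divergences`).

For computability, multiplying the determinant by a Vandermonde determinant turns it into a sum over
all self-maps of the index set. These are numbered by digit expansions, so no enumeration of
permutations is needed (`decodePoly_discCode`). -/

noncomputable section
namespace GriffithsDwork
open MvPolynomial AlgDeRham
open scoped LaurentPolynomial

/-! ### The grading of the cone ring, through a coaction of the multiplicative group -/

section Grading

variable {A : Type*} [CommRing A] {n : ℕ} (P : MvPolynomial (Fin (n + 2)) A)

/-- The image of a polynomial in the cone ring. -/
abbrev toCone : MvPolynomial (Fin (n + 2)) A →ₐ[A] ConeRing P :=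
  IsScalarTower.toAlgHom A (MvPolynomial (Fin (n + 2)) A) (ConeRing P)

/-- The inverse of `P` in the cone ring. -/
abbrev invP : ConeRing P := Localization.Away.invSelf P

theorem toCone_mul_invP : toCone P P * invP P = 1 := by
  change algebraMap _ _ P * Localization.mk 1 ⟨P, _⟩ = 1
  rw [← Localization.mk_one_eq_algebraMap, Localization.mk_mul, Localization.mk_eq_monoidOf_mk']
  simp

theorem isUnit_toCone : IsUnit (toCone P P) := IsUnit.of_mul_eq_one _ (toCone_mul_invP P)

theorem invP_pow_mul (k : ℕ) : toCone P P ^ k * invP P ^ k = 1 := by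
  rw [← mul_pow, toCone_mul_invP, one_pow]

theorem exists_eq_mul_invP (z : ConeRing P) :
    ∃ (Q : MvPolynomial (Fin (n + 2)) A) (k : ℕ), z = toCone P Q * invP P ^ k := by
  obtain ⟨k, Q, h⟩ := IsLocalization.Away.surj P z
  refine ⟨Q, k, ?_⟩
  change z * toCone P P ^ k = toCone P Q at h
  rw [← h, mul_assoc, invP_pow_mul, mul_one]

/-- The coaction of the multiplicative group on polynomials. -/
def polyCoaction : MvPolynomial (Fin (n + 2)) A →ₐ[A] (ConeRing P)[T;T⁻¹] :=
  aeval fun i => LaurentPolynomial.C (coord P i) * LaurentPolynomial.T 1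

theorem polyCoaction_monomial (w : Fin (n + 2) →₀ ℕ) (a : A) :
    polyCoaction P (monomial w a) =
      LaurentPolynomial.C (toCone P (monomial w a)) * LaurentPolynomial.T w.degree := by
  have h : ∀ b : A, algebraMap A (ConeRing P)[T;T⁻¹] b =
      LaurentPolynomial.C (algebraMap A (ConeRing P) b) := fun b => rfl
  rw [polyCoaction, aeval_monomial, monomial_eq, map_mul, map_mul, h]
  have h2 : toCone P (C a) = algebraMap A (ConeRing P) a := (toCone P).commutes a
  rw [h2, mul_assoc]
  congr 1
  simp only [Finsupp.prod, mul_pow, Finset.prod_mul_distrib, LaurentPolynomial.T_pow, map_prod,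
    map_pow]
  congr 1
  rw [Finsupp.degree_apply]
  clear h h2
  push_cast
  simp only [mul_one]
  induction w.support using Finset.induction_on with
  | empty => simp
  | insert i s hi ih => rw [Finset.prod_insert hi, Finset.sum_insert hi, ih,
      LaurentPolynomial.T_add]

theorem polyCoaction_homogeneous {e : ℕ} {Q : MvPolynomial (Fin (n + 2)) A}
    (hQ : Q.IsHomogeneous e) :
    polyCoaction P Q = LaurentPolynomial.C (toCone P Q) * LaurentPolynomial.T e := by
  conv_lhs => rw [Q.as_sum]
  conv_rhs => rw [Q.as_sum]
  rw [map_sum, map_sum, map_sum, Finset.sum_mul]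
  refine Finset.sum_congr rfl fun w hw => ?_
  rw [polyCoaction_monomial]
  have : w.degree = e := by
    have := hQ (mem_support_iff.1 hw)
    rwa [Finsupp.degree_eq_weight_one]
  rw [this]

variable {P} {d : ℕ} (hP : P.IsHomogeneous d)

theorem isUnit_polyCoaction (hP : P.IsHomogeneous d) :
    IsUnit ((polyCoaction P).toRingHom P) := by
  change IsUnit (polyCoaction P P)
  rw [polyCoaction_homogeneous P hP]
  exact ((isUnit_toCone P).map _).mul (LaurentPolynomial.isUnit_T _)

/-- The coaction of the multiplicative group on the cone ring. -/
def coaction : ConeRing P →+* (ConeRing P)[T;T⁻¹] :=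
  IsLocalization.Away.lift P (isUnit_polyCoaction hP)

theorem coaction_toCone (Q : MvPolynomial (Fin (n + 2)) A) :
    coaction hP (toCone P Q) = polyCoaction P Q :=
  IsLocalization.Away.lift_eq P (isUnit_polyCoaction hP) Q

theorem coaction_invP : coaction hP (invP P) =
    LaurentPolynomial.C (invP P) * LaurentPolynomial.T (-d : ℤ) := by
  have h1 : coaction hP (toCone P P) * coaction hP (invP P) = 1 := by
    rw [← map_mul, toCone_mul_invP, map_one]
  have h2 : coaction hP (toCone P P) * (LaurentPolynomial.C (invP P) *
      LaurentPolynomial.T (-d : ℤ)) = 1 := by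
    rw [coaction_toCone, polyCoaction_homogeneous P hP, mul_mul_mul_comm, ← map_mul,
      toCone_mul_invP, ← LaurentPolynomial.T_add]
    simp
  exact (IsUnit.of_mul_eq_one _ h1).mul_left_cancel (h1.trans h2.symm)

theorem coaction_algebraMap (a : A) :
    coaction hP (algebraMap A _ a) = LaurentPolynomial.C (algebraMap A _ a) := by
  have h2 : toCone P (C a) = algebraMap A (ConeRing P) a := (toCone P).commutes a
  rw [← h2, coaction_toCone, polyCoaction_homogeneous P (isHomogeneous_C _ a)]
  simp

/-- The elements of degree `j` of the cone ring. -/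
def coneDeg (j : ℤ) : Submodule A (ConeRing P) where
  carrier := {z | coaction hP z = LaurentPolynomial.C z * LaurentPolynomial.T j}
  add_mem' := by
    intro a b ha hb
    simp only [Set.mem_ofPred_eq] at *
    rw [map_add, ha, hb, map_add, add_mul]
  zero_mem' := by simp
  smul_mem' := by
    intro a z hz
    simp only [Set.mem_ofPred_eq] at *
    rw [Algebra.smul_def, map_mul, hz, coaction_algebraMap, map_mul, mul_assoc]

theorem mem_coneDeg {j : ℤ} {z : ConeRing P} : z ∈ coneDeg hP j ↔
    coaction hP z = LaurentPolynomial.C z * LaurentPolynomial.T j := Iff.rfl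

theorem mul_mem_coneDeg {i j : ℤ} {y z : ConeRing P} (hy : y ∈ coneDeg hP i)
    (hz : z ∈ coneDeg hP j) : y * z ∈ coneDeg hP (i + j) := by
  rw [mem_coneDeg] at *
  rw [map_mul, hy, hz, map_mul, LaurentPolynomial.T_add, mul_mul_mul_comm]

theorem mul_mem_coneDeg' {i j k : ℤ} {y z : ConeRing P} (hy : y ∈ coneDeg hP i)
    (hz : z ∈ coneDeg hP j) (h : i + j = k) : y * z ∈ coneDeg hP k :=
  h ▸ mul_mem_coneDeg hP hy hz

theorem one_mem_coneDeg : (1 : ConeRing P) ∈ coneDeg hP 0 := by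
  rw [mem_coneDeg]; simp

theorem pow_mem_coneDeg {i : ℤ} {y : ConeRing P} (hy : y ∈ coneDeg hP i) (k : ℕ) :
    y ^ k ∈ coneDeg hP (k * i) := by
  induction k with
  | zero => simpa using one_mem_coneDeg hP
  | succ k ih =>
    rw [pow_succ]
    exact mul_mem_coneDeg' hP ih hy (by push_cast; ring)

theorem toCone_mem_coneDeg {e : ℕ} {Q : MvPolynomial (Fin (n + 2)) A}
    (hQ : Q.IsHomogeneous e) : toCone P Q ∈ coneDeg hP e := by
  rw [mem_coneDeg, coaction_toCone, polyCoaction_homogeneous P hQ]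

theorem coord_mem_coneDeg (i : Fin (n + 2)) : coord P i ∈ coneDeg hP 1 :=
  toCone_mem_coneDeg hP (isHomogeneous_X A i)

theorem invP_mem_coneDeg : invP P ∈ coneDeg hP (-d) := coaction_invP hP

theorem algebraMap_mem_coneDeg (a : A) : algebraMap A (ConeRing P) a ∈ coneDeg hP 0 := by
  rw [mem_coneDeg, coaction_algebraMap]; simp

theorem div_mem_coneDeg {e k : ℕ} {j : ℤ} {Q : MvPolynomial (Fin (n + 2)) A}
    (hQ : Q.IsHomogeneous e) (h : (e : ℤ) = j + k * d) :
    toCone P Q * invP P ^ k ∈ coneDeg hP j :=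
  mul_mem_coneDeg' hP (toCone_mem_coneDeg hP hQ)
    (pow_mem_coneDeg hP (invP_mem_coneDeg hP) k) (by rw [h]; ring)

/-- The component of degree `j` of the element `Q / P ^ k`. -/
theorem coaction_coeff (Q : MvPolynomial (Fin (n + 2)) A) (k : ℕ) (j : ℤ) :
    (coaction hP (toCone P Q * invP P ^ k)).coeff j =
      if 0 ≤ j + k * d then toCone P (homogeneousComponent (j + k * d).toNat Q) * invP P ^ k
      else 0 := by
  have hdiv : ∀ (e : ℕ) (Q : MvPolynomial (Fin (n + 2)) A), Q.IsHomogeneous e →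
      coaction hP (toCone P Q * invP P ^ k) = LaurentPolynomial.C (toCone P Q * invP P ^ k) *
        LaurentPolynomial.T (e - k * d) := by
    intro e Q hQ
    exact div_mem_coneDeg hP hQ (by ring)
  conv_lhs => rw [← sum_homogeneousComponent Q]
  rw [map_sum, Finset.sum_mul, map_sum, AddMonoidAlgebra.coeff_sum, Finsupp.finsetSum_apply]
  have : ∀ e ∈ Finset.range (Q.totalDegree + 1),
      (coaction hP (toCone P (homogeneousComponent e Q) * invP P ^ k)).coeff j =
      if (e : ℤ) = j + k * d then toCone P (homogeneousComponent e Q) * invP P ^ k else 0 := by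
    intro e _
    rw [hdiv e _ (homogeneousComponent_isHomogeneous e Q),
      ← LaurentPolynomial.single_eq_C_mul_T, AddMonoidAlgebra.coeff_single, Finsupp.single_apply]
    congr 1
    rw [eq_iff_iff]
    omega
  rw [Finset.sum_congr rfl this]
  split_ifs with h
  · obtain ⟨e, he⟩ := Int.eq_ofNat_of_zero_le h
    simp only [he, Nat.cast_inj, Int.toNat_natCast, Finset.sum_ite_eq', Finset.mem_range]
    split_ifs with h2
    · rfl
    · rw [homogeneousComponent_eq_zero _ _ (by omega), map_zero, zero_mul]
  · refine Finset.sum_eq_zero fun e _ => if_neg ?_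
    omega

theorem coeff_of_mem_coneDeg {j : ℤ} {z : ConeRing P} (hz : z ∈ coneDeg hP j) :
    (coaction hP z).coeff j = z := by
  rw [(mem_coneDeg hP).1 hz, ← LaurentPolynomial.single_eq_C_mul_T, AddMonoidAlgebra.coeff_single,
    Finsupp.single_eq_same]

/-- The coefficient of `T^j` in the coaction replaces the numerator of any fraction for `z` by one
of its homogeneous components. Passing through the coaction avoids any assumption that `P` is a
nonzerodivisor. -/
theorem exists_of_mem_coneDeg (hd : 1 ≤ d) {j : ℤ} {z : ConeRing P} (hz : z ∈ coneDeg hP j) :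
    ∃ (Q : MvPolynomial (Fin (n + 2)) A) (e k : ℕ), Q.IsHomogeneous e ∧ (e : ℤ) = j + k * d ∧
      z = toCone P Q * invP P ^ k := by
  obtain ⟨Q, k, h⟩ := exists_eq_mul_invP P z
  have h1 := coeff_of_mem_coneDeg hP hz
  rw [h, coaction_coeff, ← h] at h1
  split_ifs at h1 with h2
  · exact ⟨_, _, k, homogeneousComponent_isHomogeneous _ Q, by omega, h1.symm⟩
  -- Here `z = 0`, and the power `|j|` of `P` only serves to make the degree of the zero numerator
  -- nonnegative.
  · have h3 : 0 ≤ j + j.natAbs * (d : ℤ) := by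
      have h4 : (1 : ℤ) ≤ d := by exact_mod_cast hd
      nlinarith [Int.natCast_natAbs j, neg_abs_le j, abs_nonneg j]
    exact ⟨0, (j + j.natAbs * (d : ℤ)).toNat, j.natAbs, isHomogeneous_zero _ _ _, by omega,
      by rw [← h1, map_zero, zero_mul]⟩

section Projection
attribute [local instance] MvPolynomial.gradedAlgebra

theorem algebraMap_complementRing_injective :
    Function.Injective (algebraMap (ComplementRing P) (ConeRing P)) :=
  HomogeneousLocalization.val_injective (𝒜 := homogeneousSubmodule (Fin (n + 2)) A)
    (Submonoid.powers P)

theorem mk_eq_mul_invP (Q : MvPolynomial (Fin (n + 2)) A) (k : ℕ) (h : P ^ k ∈ Submonoid.powers P) :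
    (Localization.mk Q ⟨P ^ k, h⟩ : ConeRing P) = toCone P Q * invP P ^ k := by
  have h2 : (Localization.mk Q ⟨P ^ k, h⟩ : ConeRing P) * toCone P P ^ k = toCone P Q := by
    rw [← map_pow]
    change _ * algebraMap _ _ _ = algebraMap _ _ Q
    rw [← Localization.mk_one_eq_algebraMap, ← Localization.mk_one_eq_algebraMap,
      Localization.mk_mul, Localization.mk_eq_mk_iff, Localization.r_iff_exists]
    exact ⟨1, by simp [mul_comm]⟩
  rw [← h2, mul_assoc, invP_pow_mul, mul_one]

theorem exists_algebraMap_eq {Q : MvPolynomial (Fin (n + 2)) A} {k : ℕ}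
    (hP : P.IsHomogeneous d) (hQ : Q.IsHomogeneous (k * d)) :
    ∃ f : ComplementRing P, algebraMap (ComplementRing P) (ConeRing P) f =
      toCone P Q * invP P ^ k := by
  exact ⟨HomogeneousLocalization.Away.mk (homogeneousSubmodule (Fin (n + 2)) A) (d := d) hP k Q
    (by rw [smul_eq_mul]; exact hQ), mk_eq_mul_invP Q k _⟩

theorem algebraMap_mem_coneDeg_zero (f : ComplementRing P) :
    algebraMap (ComplementRing P) (ConeRing P) f ∈ coneDeg hP 0 := by
  have hP' : P ∈ homogeneousSubmodule (Fin (n + 2)) A d := hP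
  obtain ⟨k, Q, hQ, hf⟩ := HomogeneousLocalization.Away.mk_surjective
    (homogeneousSubmodule (Fin (n + 2)) A) hP' f
  rw [smul_eq_mul] at hQ
  subst hf
  have h : algebraMap (ComplementRing P) (ConeRing P) (HomogeneousLocalization.Away.mk
      (homogeneousSubmodule (Fin (n + 2)) A) hP' k Q hQ) = toCone P Q * invP P ^ k :=
    mk_eq_mul_invP Q k _
  rw [h]
  exact div_mem_coneDeg hP hQ (by push_cast; ring)

theorem mem_coneDeg_zero_iff (hd : 1 ≤ d) {z : ConeRing P} : z ∈ coneDeg hP 0 ↔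
    ∃ f : ComplementRing P, algebraMap (ComplementRing P) (ConeRing P) f = z := by
  constructor
  · intro hz
    obtain ⟨Q, e, k, hQ, he, rfl⟩ := exists_of_mem_coneDeg hP hd hz
    obtain rfl : e = k * d := by exact_mod_cast he.trans (zero_add _)
    exact exists_algebraMap_eq hP hQ
  · rintro ⟨f, rfl⟩
    exact algebraMap_mem_coneDeg_zero hP f

theorem exists_algebraMap_eq_coeff (z : ConeRing P) :
    ∃ f : ComplementRing P, algebraMap (ComplementRing P) (ConeRing P) f =
      (coaction hP z).coeff 0 := by
  obtain ⟨Q, k, rfl⟩ := exists_eq_mul_invP P z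
  rw [coaction_coeff, if_pos (by positivity)]
  exact exists_algebraMap_eq hP (by
    convert homogeneousComponent_isHomogeneous _ Q using 1
    rw [zero_add]; exact_mod_cast (Int.toNat_natCast _).symm)

/-- The underlying function of `coneProj`. -/
def coneProjFun (z : ConeRing P) : ComplementRing P := (exists_algebraMap_eq_coeff hP z).choose

theorem algebraMap_coneProjFun (z : ConeRing P) :
    algebraMap (ComplementRing P) (ConeRing P) (coneProjFun hP z) = (coaction hP z).coeff 0 :=
  (exists_algebraMap_eq_coeff hP z).choose_spec

/-- The projection of the cone ring to its degree zero part. -/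
def coneProj : ConeRing P →ₗ[ComplementRing P] ComplementRing P where
  toFun z := coneProjFun hP z
  map_add' y z := by
    apply algebraMap_complementRing_injective
    rw [map_add, algebraMap_coneProjFun, algebraMap_coneProjFun, algebraMap_coneProjFun, map_add]
    rfl
  map_smul' f z := by
    apply algebraMap_complementRing_injective
    rw [RingHom.id_apply, smul_eq_mul, map_mul, algebraMap_coneProjFun, algebraMap_coneProjFun,
      Algebra.smul_def, map_mul,
      (mem_coneDeg hP).1 (algebraMap_mem_coneDeg_zero hP f), LaurentPolynomial.T_zero, mul_one]
    exact AddMonoidAlgebra.coeff_single_zero_mul _ _ _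

theorem algebraMap_coneProj (z : ConeRing P) :
    algebraMap (ComplementRing P) (ConeRing P) (coneProj hP z) = (coaction hP z).coeff 0 :=
  algebraMap_coneProjFun hP z

theorem coneProj_algebraMap (f : ComplementRing P) :
    coneProj hP (algebraMap (ComplementRing P) (ConeRing P) f) = f := by
  apply algebraMap_complementRing_injective
  rw [algebraMap_coneProj, coeff_of_mem_coneDeg hP (algebraMap_mem_coneDeg_zero hP f)]

end Projection

end Grading
end GriffithsDwork
end

noncomputable section
namespace GriffithsDwork
open MvPolynomial AlgDeRham
open scoped KaehlerDifferential TensorProduct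

/-! ### Differentials on the cone, partial derivatives and Euler's identity -/

section Differentials

variable {A : Type*} [CommRing A] {n : ℕ} (P : MvPolynomial (Fin (n + 2)) A)

/-- Formal étaleness of the localization carries the basis `dx_i` from the polynomial ring to the
cone. -/
instance : Algebra.FormallyEtale (MvPolynomial (Fin (n + 2)) A) (ConeRing P) :=
  Algebra.FormallyEtale.of_isLocalization (Submonoid.powers P)

/-- The differentials of the coordinates form a basis of the differentials of the cone. -/
def coneBasis : Module.Basis (Fin (n + 2)) (ConeRing P) Ω[ConeRing P⁄A] :=
  ((KaehlerDifferential.mvPolynomialBasis A (Fin (n + 2))).baseChange (ConeRing P)).map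
    (KaehlerDifferential.tensorKaehlerEquivOfFormallyEtale A (MvPolynomial (Fin (n + 2)) A)
      (ConeRing P))

theorem coneBasis_apply (i : Fin (n + 2)) :
    coneBasis P i = KaehlerDifferential.D A (ConeRing P) (coord P i) := by
  have h : KaehlerDifferential.mvPolynomialBasis A (Fin (n + 2)) i =
      KaehlerDifferential.D A _ (X i) := by
    simp
  rw [coneBasis, Module.Basis.map_apply, Module.Basis.baseChange_apply, h,
    KaehlerDifferential.tensorKaehlerEquivOfFormallyEtale_apply,
    KaehlerDifferential.mapBaseChange_tmul, one_smul, KaehlerDifferential.map_D]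
  rfl

/-- The partial derivatives on the cone ring. -/
def conePartial (i : Fin (n + 2)) : Derivation A (ConeRing P) (ConeRing P) :=
  ((coneBasis P).coord i).compDer (KaehlerDifferential.D A (ConeRing P))

theorem conePartial_coord (i j : Fin (n + 2)) :
    conePartial P i (coord P j) = if j = i then 1 else 0 := by
  change (coneBasis P).coord i (KaehlerDifferential.D A (ConeRing P) (coord P j)) = _
  rw [← coneBasis_apply, Module.Basis.coord_apply, Module.Basis.repr_self, Finsupp.single_apply]

theorem D_eq_sum (z : ConeRing P) : KaehlerDifferential.D A (ConeRing P) z =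
    ∑ i, conePartial P i z • KaehlerDifferential.D A (ConeRing P) (coord P i) := by
  conv_lhs => rw [← (coneBasis P).sum_repr (KaehlerDifferential.D A (ConeRing P) z)]
  refine Finset.sum_congr rfl fun i _ => ?_
  rw [coneBasis_apply]; rfl

theorem conePartial_toCone (i : Fin (n + 2)) (Q : MvPolynomial (Fin (n + 2)) A) :
    conePartial P i (toCone P Q) = toCone P (pderiv i Q) := by
  induction Q using MvPolynomial.induction_on with
  | C a =>
    have h2 : toCone P (C a) = algebraMap A (ConeRing P) a := (toCone P).commutes a
    rw [h2, Derivation.map_algebraMap, pderiv_C, map_zero]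
  | add p q hp hq => simp only [map_add, hp, hq]
  | mul_X p j hp =>
    have hX : toCone P (X j) = coord P j := rfl
    rw [map_mul, Derivation.leibniz, hp, hX, conePartial_coord, pderiv_mul, pderiv_X, map_add,
      map_mul, map_mul, hX, Pi.single_apply]
    simp only [smul_eq_mul]
    split_ifs <;> simp <;> ring

theorem conePartial_invP (i : Fin (n + 2)) :
    conePartial P i (invP P) = -(toCone P (pderiv i P) * invP P ^ 2) := by
  have h := congrArg (conePartial P i) (toCone_mul_invP P)
  rw [Derivation.leibniz, Derivation.map_one_eq_zero, conePartial_toCone, smul_eq_mul,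
    smul_eq_mul] at h
  have h2 := toCone_mul_invP P
  linear_combination invP P * h - conePartial P i (invP P) * h2

theorem conePartial_div (i : Fin (n + 2)) (Q : MvPolynomial (Fin (n + 2)) A) (k : ℕ) :
    conePartial P i (toCone P Q * invP P ^ k) =
      toCone P (pderiv i Q * P - (k : MvPolynomial (Fin (n + 2)) A) * (Q * pderiv i P)) *
        invP P ^ (k + 1) := by
  rw [Derivation.leibniz, Derivation.leibniz_pow, conePartial_toCone, conePartial_invP]
  simp only [smul_eq_mul, map_sub, map_mul, map_natCast, nsmul_eq_mul]
  have h2 := toCone_mul_invP P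
  rcases k with _ | k
  · simp only [pow_zero, Nat.cast_zero, zero_mul, mul_zero, zero_add, one_mul, sub_zero, pow_one]
    linear_combination -(toCone P (pderiv i Q)) * h2
  · rw [Nat.add_sub_cancel]
    linear_combination -(toCone P (pderiv i Q) * invP P ^ (k + 1)) * h2

variable {P} {d : ℕ} (hP : P.IsHomogeneous d)

theorem isHomogeneous_pderiv {e : ℕ} {Q : MvPolynomial (Fin (n + 2)) A} (hQ : Q.IsHomogeneous e)
    (i : Fin (n + 2)) : (pderiv i Q).IsHomogeneous (e - 1) := hQ.pderiv

theorem toCone_pderiv_mem {e : ℕ} {Q : MvPolynomial (Fin (n + 2)) A} (hQ : Q.IsHomogeneous e)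
    (i : Fin (n + 2)) : toCone P (pderiv i Q) ∈ coneDeg hP (e - 1) := by
  rcases e with _ | e
  · obtain ⟨a, rfl⟩ : ∃ a, Q = C a := ⟨_, (totalDegree_eq_zero_iff_eq_C.1
      (Nat.le_zero.1 hQ.totalDegree_le))⟩
    rw [pderiv_C, map_zero]; exact zero_mem _
  · have := toCone_mem_coneDeg hP (isHomogeneous_pderiv hQ i)
    simpa using this

theorem conePartial_mem (hd : 1 ≤ d) {j : ℤ} {z : ConeRing P} (hz : z ∈ coneDeg hP j)
    (i : Fin (n + 2)) : conePartial P i z ∈ coneDeg hP (j - 1) := by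
  obtain ⟨Q, e, k, hQ, he, rfl⟩ := exists_of_mem_coneDeg hP hd hz
  rw [conePartial_div]
  refine mul_mem_coneDeg' hP (i := e - 1 + d) ?_
    (pow_mem_coneDeg hP (invP_mem_coneDeg hP) (k + 1)) (by push_cast; rw [he]; ring)
  simp only [map_sub, map_mul, map_natCast]
  refine sub_mem (mul_mem_coneDeg hP (toCone_pderiv_mem hP hQ i) (toCone_mem_coneDeg hP hP)) ?_
  refine mul_mem_coneDeg' hP (i := 0) ?_ (mul_mem_coneDeg hP (toCone_mem_coneDeg hP hQ)
    (toCone_pderiv_mem hP hP i)) (by ring)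
  rw [← map_natCast (algebraMap A (ConeRing P))]
  exact algebraMap_mem_coneDeg hP _

variable (P) in
/-- Contraction of a differential with the Euler vector field. -/
def euler : Ω[ConeRing P⁄A] →ₗ[ConeRing P] ConeRing P :=
  (coneBasis P).constr (ConeRing P) (coord P)

theorem euler_coord (i : Fin (n + 2)) :
    euler P (KaehlerDifferential.D A (ConeRing P) (coord P i)) = coord P i := by
  rw [← coneBasis_apply, euler, Module.Basis.constr_basis]

theorem euler_toCone {e : ℕ} {Q : MvPolynomial (Fin (n + 2)) A} (hQ : Q.IsHomogeneous e) :
    euler P (KaehlerDifferential.D A (ConeRing P) (toCone P Q)) = e * toCone P Q := by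
  rw [D_eq_sum, map_sum]
  simp only [map_smul, euler_coord, conePartial_toCone]
  have h := congrArg (toCone P) hQ.sum_X_mul_pderiv
  rw [map_sum, map_nsmul, nsmul_eq_mul] at h
  rw [← h]
  refine Finset.sum_congr rfl fun i _ => ?_
  rw [map_mul, smul_eq_mul, mul_comm]; rfl

/-- `z ↦ ι_E dz` is a derivation. Euler's identity gives its values on `P^k` and on `z P^k`, and
`P^k` is a unit. -/
theorem euler_D (hd : 1 ≤ d) {j : ℤ} {z : ConeRing P} (hz : z ∈ coneDeg hP j) :
    euler P (KaehlerDifferential.D A (ConeRing P) z) = j * z := by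
  obtain ⟨Q, e, k, hQ, he, rfl⟩ := exists_of_mem_coneDeg hP hd hz
  set E : Derivation A (ConeRing P) (ConeRing P) :=
    (euler P).compDer (KaehlerDifferential.D A (ConeRing P)) with hE
  have h1 : E (toCone P Q * invP P ^ k * toCone P P ^ k) = e * toCone P Q := by
    rw [mul_assoc, mul_comm (invP P ^ k), invP_pow_mul, mul_one]; exact euler_toCone hQ
  have h3 : E (toCone P P) = d * toCone P P := euler_toCone hP
  have h2 : E (toCone P P ^ k) = (k * d) * toCone P P ^ k := by
    rw [Derivation.leibniz_pow, h3]
    rcases k with _ | k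
    · simp
    · simp only [Nat.add_sub_cancel, smul_eq_mul, nsmul_eq_mul]; ring
  rw [Derivation.leibniz, h2] at h1
  change E (toCone P Q * invP P ^ k) = _
  have h4 : (e : ConeRing P) = j + k * d := by exact_mod_cast congrArg (Int.cast (R := ConeRing P)) he
  simp only [smul_eq_mul] at h1
  have h5 := invP_pow_mul P k
  rw [h4] at h1
  linear_combination invP P ^ k * h1 - (E (toCone P Q * invP P ^ k) +
    (toCone P Q * invP P ^ k) * (k * d)) * h5

variable [Algebra ℚ A]

variable (P) (d) in
/-- The coefficients `∂_i P / (d P)` of the logarithmic form `dP / (d P)`. -/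
def logCoeff (i : Fin (n + 2)) : ConeRing P :=
  algebraMap A (ConeRing P) (algebraMap ℚ A (d : ℚ)⁻¹) * (toCone P (pderiv i P) * invP P)

theorem logCoeff_mem (i : Fin (n + 2)) : logCoeff P d i ∈ coneDeg hP (-1) :=
  mul_mem_coneDeg' hP (algebraMap_mem_coneDeg hP _) (mul_mem_coneDeg hP
    (toCone_pderiv_mem hP hP i) (invP_mem_coneDeg hP)) (by ring)

variable (P) (d) in
theorem invDegree_mul (hd : 1 ≤ d) :
    algebraMap A (ConeRing P) (algebraMap ℚ A (d : ℚ)⁻¹) * d = 1 := by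
  have h : algebraMap ℚ A (d : ℚ)⁻¹ * d = 1 := by
    rw [← map_natCast (algebraMap ℚ A), ← map_mul, inv_mul_cancel₀ (by positivity), map_one]
  rw [← map_natCast (algebraMap A (ConeRing P)), ← map_mul, h, map_one]

/-- Euler's identity divided by `d P`. It writes `1` as a sum of products of elements of degrees
`-1` and `1`, the device by which degrees are shifted in all that follows. -/
theorem sum_logCoeff_mul_coord (hP : P.IsHomogeneous d) (hd : 1 ≤ d) :
    ∑ i, logCoeff P d i * coord P i = 1 := by
  have h := congrArg (toCone P) hP.sum_X_mul_pderiv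
  rw [map_sum, map_nsmul, nsmul_eq_mul] at h
  have h2 : ∑ i, logCoeff P d i * coord P i = algebraMap A (ConeRing P) (algebraMap ℚ A (d : ℚ)⁻¹) *
      (∑ i, toCone P (X i * pderiv i P)) * invP P := by
    rw [Finset.mul_sum, Finset.sum_mul]
    refine Finset.sum_congr rfl fun i _ => ?_
    rw [map_mul, logCoeff]
    change _ * coord P i = _ * (coord P i * _) * _
    ring
  rw [h2, h]
  linear_combination toCone P P * invP P * invDegree_mul P d hd + toCone_mul_invP P

end Differentials
end GriffithsDwork
end

noncomputable section
namespace GriffithsDwork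
open MvPolynomial AlgDeRham
open scoped KaehlerDifferential TensorProduct

/-! ### A retraction from forms on the cone to forms on the complement -/

section PullbackInjective

variable {A : Type*} [CommRing A] {n : ℕ} {P : MvPolynomial (Fin (n + 2)) A} {d : ℕ}
  (hP : P.IsHomogeneous d)

variable (P) in
/-- The differentials of the complement, extended to the cone. -/
abbrev HorizontalForms : Type _ :=
  ConeRing P ⊗[ComplementRing P] Ω[ComplementRing P⁄A]

/-- The inclusion of the horizontal one-forms into the extended algebra of forms. -/
def horizontalIncl (P : MvPolynomial (Fin (n + 2)) A) : HorizontalForms P →ₗ[ConeRing P]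
    ConeRing P ⊗[ComplementRing P] Forms A (ComplementRing P) :=
  (ExteriorAlgebra.ι (ComplementRing P)).baseChange (ConeRing P)

theorem horizontalIncl_anti (x y : HorizontalForms P) :
    horizontalIncl P x * horizontalIncl P y + horizontalIncl P y * horizontalIncl P x = 0 := by
  induction x using TensorProduct.induction_on with
  | zero => simp
  | add x x' h h' => rw [map_add, add_mul, mul_add, add_add_add_comm, h, h', add_zero]
  | tmul a u =>
    induction y using TensorProduct.induction_on with
    | zero => simp
    | add x x' h h' => rw [map_add, add_mul, mul_add, add_add_add_comm, h, h', add_zero]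
    | tmul b v =>
      simp only [horizontalIncl, LinearMap.baseChange_tmul, Algebra.TensorProduct.tmul_mul_tmul]
      rw [mul_comm b a, ← TensorProduct.tmul_add, ExteriorAlgebra.ι_add_mul_swap,
        TensorProduct.tmul_zero]

theorem horizontalIncl_sq (x : HorizontalForms P) :
    horizontalIncl P x * horizontalIncl P x = 0 := by
  induction x using TensorProduct.induction_on with
  | zero => simp
  | add x y h h' =>
    have := horizontalIncl_anti x y
    rw [map_add, add_mul, mul_add, mul_add, h, h', zero_add, add_zero, this]
  | tmul a u =>
    simp only [horizontalIncl, LinearMap.baseChange_tmul, Algebra.TensorProduct.tmul_mul_tmul]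
    rw [ExteriorAlgebra.ι_sq_zero, TensorProduct.tmul_zero]

variable [Algebra ℚ A]

/-- The multiplicative family of connections on the homogeneous parts of the cone ring. -/
def nabla : ℕ → ConeRing P →ₗ[A] HorizontalForms P
  | 0 => ((TensorProduct.mk (ComplementRing P) (ConeRing P) Ω[ComplementRing P⁄A] 1).restrictScalars
      A) ∘ₗ (KaehlerDifferential.D A (ComplementRing P)).toLinearMap ∘ₗ
        ((coneProj hP).restrictScalars A)
  -- With `l_j = ∂_j P/(d P)`, on degree `e` this is `z ↦ ∑ x_{j_1}⋯x_{j_e} ⊗ d(l_{j_1}⋯l_{j_e} z)`: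
  -- the factors `l_j` move `z` to degree zero, where `d` on the complement applies.
  | e + 1 => ∑ j, (Algebra.lsmul A A (HorizontalForms P) (coord P j)) ∘ₗ nabla e ∘ₗ
      LinearMap.mulLeft A (logCoeff P d j)

theorem nabla_zero (z : ConeRing P) :
    nabla hP 0 z = 1 ⊗ₜ KaehlerDifferential.D A (ComplementRing P) (coneProj hP z) := rfl

theorem nabla_succ (e : ℕ) (z : ConeRing P) :
    nabla hP (e + 1) z = ∑ j, coord P j • nabla hP e (logCoeff P d j * z) := by
  rw [nabla, LinearMap.sum_apply]; rfl

theorem nabla_zero_algebraMap (f : ComplementRing P) :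
    nabla hP 0 (algebraMap (ComplementRing P) (ConeRing P) f) =
      1 ⊗ₜ KaehlerDifferential.D A (ComplementRing P) f := by
  rw [nabla_zero, coneProj_algebraMap]

/-- In degree zero this is the Leibniz rule on the complement. Each induction step attaches a factor
`l_j` to one of the two elements, and `∑ l_j x_j = 1` removes it from the term in which that element
is not differentiated. -/
theorem nabla_mul (hd : 1 ≤ d) (e e' : ℕ) {y z : ConeRing P} (hy : y ∈ coneDeg hP e)
    (hz : z ∈ coneDeg hP e') :
    nabla hP (e + e') (y * z) = y • nabla hP e' z + z • nabla hP e y := by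
  induction e generalizing y with
  | zero =>
    induction e' generalizing z with
    | zero =>
      obtain ⟨f, rfl⟩ := (mem_coneDeg_zero_iff hP hd).1 hy
      obtain ⟨g, rfl⟩ := (mem_coneDeg_zero_iff hP hd).1 hz
      rw [add_zero, ← map_mul, nabla_zero_algebraMap, nabla_zero_algebraMap, nabla_zero_algebraMap,
        Derivation.leibniz, TensorProduct.tmul_add, TensorProduct.tmul_smul, TensorProduct.tmul_smul,
        algebraMap_smul, algebraMap_smul]
    | succ e' ih =>
      rw [← add_assoc, nabla_succ, nabla_succ]
      have h : ∀ j, coord P j • nabla hP (0 + e') (logCoeff P d j * (y * z)) =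
          y • coord P j • nabla hP e' (logCoeff P d j * z) +
            (logCoeff P d j * coord P j) • z • nabla hP 0 y := by
        intro j
        rw [mul_left_comm, ih (mul_mem_coneDeg' hP (logCoeff_mem hP j) hz (by push_cast; ring))]
        simp only [smul_add, smul_smul]
        congr 2 <;> ring
      simp only [h]
      rw [Finset.sum_add_distrib, ← Finset.smul_sum, ← Finset.sum_smul,
        sum_logCoeff_mul_coord hP hd, one_smul]
  | succ e ih =>
    rw [add_right_comm, nabla_succ, nabla_succ]
    have h : ∀ j, coord P j • nabla hP (e + e') (logCoeff P d j * (y * z)) =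
        (logCoeff P d j * coord P j) • y • nabla hP e' z +
          z • coord P j • nabla hP e (logCoeff P d j * y) := by
      intro j
      rw [← mul_assoc, ih (mul_mem_coneDeg' hP (logCoeff_mem hP j) hy (by push_cast; ring))]
      simp only [smul_add, smul_smul]
      congr 2 <;> ring
    simp only [h]
    rw [Finset.sum_add_distrib, ← Finset.smul_sum, ← Finset.sum_smul,
      sum_logCoeff_mul_coord hP hd, one_smul]

/-- The correction that makes the connections compatible with the unit `P`. -/
def connectionShift : HorizontalForms P :=
  (algebraMap A (ConeRing P) (algebraMap ℚ A (d : ℚ)⁻¹) * invP P) • nabla hP d (toCone P P)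

/-- The retraction of the differentials of the cone to those of the complement. -/
def horizontalRetraction : Ω[ConeRing P⁄A] →ₗ[ConeRing P] HorizontalForms P :=
  (coneBasis P).constr (ConeRing P) fun i =>
    nabla hP 1 (coord P i) - coord P i • connectionShift hP

/-- The derivation that belongs to `horizontalRetraction`. -/
def horizontalDer : Derivation A (ConeRing P) (HorizontalForms P) :=
  (horizontalRetraction hP).compDer (KaehlerDifferential.D A (ConeRing P))

theorem horizontalDer_coord (i : Fin (n + 2)) : horizontalDer hP (coord P i) =
    nabla hP 1 (coord P i) - coord P i • connectionShift hP := by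
  change horizontalRetraction hP (KaehlerDifferential.D A (ConeRing P) (coord P i)) = _
  rw [← coneBasis_apply, horizontalRetraction, Module.Basis.constr_basis]

/-- Both `nabla` and multiplication by the degree obey the Leibniz rule, so the formula passes to
products. It thus needs checking only on `1` and on coordinates, and on the latter it is the
definition. -/
theorem horizontalDer_mul_of_eq (hd : 1 ≤ d) (e e' : ℕ) {y z : ConeRing P} (hy : y ∈ coneDeg hP e)
    (hz : z ∈ coneDeg hP e')
    (hy' : horizontalDer hP y = nabla hP e y - (e * y) • connectionShift hP)
    (hz' : horizontalDer hP z = nabla hP e' z - (e' * z) • connectionShift hP) :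
    horizontalDer hP (y * z) =
      nabla hP (e + e') (y * z) - (((e + e' : ℕ) : ConeRing P) * (y * z)) • connectionShift hP := by
  rw [Derivation.leibniz, nabla_mul hP hd e e' hy hz, hy', hz']
  have h : ((e + e' : ℕ) : ConeRing P) * (y * z) = y * (e' * z) + z * (e * y) := by
    push_cast; ring
  rw [h, add_smul, mul_smul y, mul_smul z, smul_sub, smul_sub, sub_add_sub_comm]

theorem horizontalDer_monomial (hd : 1 ≤ d) (w : Fin (n + 2) →₀ ℕ) :
    horizontalDer hP (toCone P (monomial w 1)) = nabla hP w.degree (toCone P (monomial w 1)) -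
      (w.degree * toCone P (monomial w 1)) • connectionShift hP := by
  have hone : horizontalDer hP (toCone P (monomial 0 1)) = nabla hP 0 (toCone P (monomial 0 1)) -
      (((0 : ℕ) : ConeRing P) * toCone P (monomial 0 1)) • connectionShift hP := by
    have h1 : toCone P (monomial 0 1) = 1 := map_one _
    have h2 : nabla hP 0 (1 : ConeRing P) = 0 := by
      rw [← map_one (algebraMap (ComplementRing P) (ConeRing P)), nabla_zero_algebraMap,
        Derivation.map_one_eq_zero, TensorProduct.tmul_zero]
    rw [h1, h2, Derivation.map_one_eq_zero]; simp
  have hmem : ∀ w : Fin (n + 2) →₀ ℕ, toCone P (monomial w (1 : A)) ∈ coneDeg hP w.degree :=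
    fun w => toCone_mem_coneDeg hP (isHomogeneous_monomial _ rfl)
  have hmul : ∀ v w : Fin (n + 2) →₀ ℕ, toCone P (monomial (v + w) (1 : A)) =
      toCone P (monomial v 1) * toCone P (monomial w 1) := by
    intro v w
    rw [← map_mul, monomial_mul, one_mul]
  induction w using Finsupp.induction_linear with
  | zero => rw [map_zero]; exact hone
  | add v w hv hw =>
    rw [hmul, map_add]
    exact horizontalDer_mul_of_eq hP hd _ _ (hmem v) (hmem w) hv hw
  | single i k =>
    induction k with
    | zero => rw [Finsupp.single_zero, map_zero]; exact hone
    | succ k ih =>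
      rw [Finsupp.single_add, hmul, map_add]
      refine horizontalDer_mul_of_eq hP hd _ _ (hmem _) (hmem _) ih ?_
      have h1 : toCone P (monomial (Finsupp.single i 1) (1 : A)) = coord P i := rfl
      rw [h1, horizontalDer_coord, Finsupp.degree_single]
      simp

theorem horizontalDer_toCone (hd : 1 ≤ d) {e : ℕ} {Q : MvPolynomial (Fin (n + 2)) A}
    (hQ : Q.IsHomogeneous e) : horizontalDer hP (toCone P Q) =
      nabla hP e (toCone P Q) - (e * toCone P Q) • connectionShift hP := by
  have h : ∀ w ∈ Q.support, toCone P (monomial w (coeff w Q)) =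
      coeff w Q • toCone P (monomial w 1) := by
    intro w _
    rw [← map_smul, smul_monomial, smul_eq_mul, mul_one]
  rw [Q.as_sum, map_sum, Finset.sum_congr rfl h, map_sum, map_sum, Finset.mul_sum,
    Finset.sum_smul, ← Finset.sum_sub_distrib]
  refine Finset.sum_congr rfl fun w hw => ?_
  have he : w.degree = e := by
    have := hQ (mem_support_iff.1 hw)
    rwa [Finsupp.degree_eq_weight_one]
  rw [Derivation.map_smul, horizontalDer_monomial hP hd, he, map_smul, smul_sub, mul_smul_comm,
    smul_assoc]

/-- The shift is `nabla_d P/(d P)`, chosen so that its multiple by `d P` cancels `nabla_d P`. -/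
theorem horizontalDer_self (hd : 1 ≤ d) : horizontalDer hP (toCone P P) = 0 := by
  rw [horizontalDer_toCone hP hd hP, connectionShift, smul_smul]
  have h : (d : ConeRing P) * toCone P P *
      (algebraMap A (ConeRing P) (algebraMap ℚ A (d : ℚ)⁻¹) * invP P) = 1 := by
    linear_combination toCone P P * invP P * invDegree_mul P d hd + toCone_mul_invP P
  rw [h, one_smul, sub_self]

/-- Write `f = Q/P^k`. Since the derivation kills `P`, the formula for homogeneous polynomials,
applied to `Q` and to `P^k`, gives equality after multiplication by the unit `P^k`: the two shift
terms cancel because `f` has degree zero. -/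
theorem horizontalDer_algebraMap (hd : 1 ≤ d) (f : ComplementRing P) :
    horizontalDer hP (algebraMap (ComplementRing P) (ConeRing P) f) =
      1 ⊗ₜ KaehlerDifferential.D A (ComplementRing P) f := by
  rw [← nabla_zero_algebraMap hP]
  have hz := algebraMap_mem_coneDeg_zero hP f
  generalize algebraMap (ComplementRing P) (ConeRing P) f = z at *
  obtain ⟨Q, e, k, hQ, he, hzQ⟩ := exists_of_mem_coneDeg hP hd hz
  obtain rfl : e = k * d := by exact_mod_cast he.trans (zero_add _)
  have hPk : horizontalDer hP (toCone P (P ^ k)) = 0 := by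
    clear hzQ he hQ
    induction k with
    | zero => rw [pow_zero, map_one, Derivation.map_one_eq_zero]
    | succ k ih =>
      rw [pow_succ, map_mul, Derivation.leibniz, ih, horizontalDer_self hP hd, smul_zero, smul_zero,
        add_zero]
  have hQz : z * toCone P (P ^ k) = toCone P Q := by
    rw [hzQ, mul_assoc, map_pow, mul_comm (invP P ^ k), invP_pow_mul, mul_one]
  have h1 := horizontalDer_toCone hP hd hQ
  have hhom : (P ^ k).IsHomogeneous (k * d) := by rw [mul_comm]; exact hP.pow k
  have h2 := horizontalDer_toCone hP hd hhom
  have h3 := nabla_mul hP hd 0 (k * d) hz (toCone_mem_coneDeg hP hhom)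
  rw [hQz, zero_add] at h3
  rw [hPk, eq_comm, sub_eq_zero] at h2
  rw [← hQz, Derivation.leibniz, hPk, hQz, h3, h2] at h1
  have h4 : toCone P (P ^ k) • horizontalDer hP z = toCone P (P ^ k) • nabla hP 0 z := by
    rw [smul_zero, zero_add] at h1
    rw [h1, ← hQz, smul_smul, mul_left_comm z, add_sub_cancel_left]
  have h5 : IsUnit (toCone P (P ^ k)) := by rw [map_pow]; exact (isUnit_toCone P).pow k
  exact h5.smul_left_cancel.1 h4

/-- The retraction of forms on the cone to forms on the complement, extended to the cone. -/
def formsRetraction : Forms A (ConeRing P) →ₐ[ConeRing P]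
    ConeRing P ⊗[ComplementRing P] Forms A (ComplementRing P) :=
  ExteriorAlgebra.lift (ConeRing P)
    ⟨horizontalIncl P ∘ₗ horizontalRetraction hP, fun _ => horizontalIncl_sq _⟩

theorem formsRetraction_pullback (hd : 1 ≤ d) (x : Forms A (ComplementRing P)) :
    formsRetraction hP (pullback A (ComplementRing P) (ConeRing P) x) = 1 ⊗ₜ x := by
  induction x using forms_induction with
  | h0 a =>
    rw [AlgHom.commutes, IsScalarTower.algebraMap_apply (ComplementRing P) (ConeRing P)
      (Forms A (ConeRing P)), AlgHom.commutes, Algebra.TensorProduct.algebraMap_apply,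
      Algebra.algebraMap_self_apply, Algebra.algebraMap_eq_smul_one,
      Algebra.algebraMap_eq_smul_one, TensorProduct.smul_tmul]
  | h1 a =>
    rw [pullback_form1, form1, formsRetraction, ExteriorAlgebra.lift_ι_apply,
      LinearMap.comp_apply]
    have := horizontalDer_algebraMap hP hd a
    change horizontalRetraction hP (KaehlerDifferential.D A (ConeRing P) _) = _ at this
    rw [this, horizontalIncl, LinearMap.baseChange_tmul]; rfl
  | hm x y hx hy => rw [map_mul, map_mul, hx, hy, Algebra.TensorProduct.tmul_mul_tmul, one_mul]
  | ha x y hx hy => rw [map_add, map_add, hx, hy, TensorProduct.tmul_add]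

/-- Pullback of forms from the complement to the cone is injective. -/
theorem pullback_injective (hP : P.IsHomogeneous d) (hd : 1 ≤ d) :
    Function.Injective (pullback A (ComplementRing P) (ConeRing P)) := by
  intro x y hxy
  have h := congrArg (formsRetraction hP) hxy
  rw [formsRetraction_pullback hP hd, formsRetraction_pullback hP hd] at h
  -- The projection of the cone ring to degree zero recovers `x` from `1 ⊗ x`.
  have h2 := congrArg (TensorProduct.lid (ComplementRing P) (Forms A (ComplementRing P)))
    (congrArg (LinearMap.rTensor (Forms A (ComplementRing P)) (coneProj hP)) h)
  have h3 : coneProj hP 1 = 1 := by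
    rw [← map_one (algebraMap (ComplementRing P) (ConeRing P)), coneProj_algebraMap]
  simpa [h3] using h2

end PullbackInjective
end GriffithsDwork
end

noncomputable section
-- Forms of fixed degree, and pullback commuting with the exterior derivative
namespace AlgDeRham
open scoped KaehlerDifferential

theorem formsOfDegree_induction {R S : Type*} [CommRing R] [CommRing S] [Algebra R S]
    {C : ℕ → Forms R S → Prop} (h0 : ∀ a, C 0 (algebraMap S _ a))
    (hs : ∀ i a b y, C i y → C (i + 1) (algebraMap S _ a * form1 R S b * y))
    (ha : ∀ i x y, C i x → C i y → C i (x + y)) (i : ℕ) (x : Forms R S)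
    (hx : x ∈ formsOfDegree R S i) : C i x := by
  -- `C` is not assumed stable under functions, so all multiples of `x` are treated at once.
  suffices h : ∀ a : S, C i (a • x) by simpa using h 1
  induction i generalizing x with
  | zero =>
    change _ ∈ LinearMap.range (ExteriorAlgebra.ι S) ^ 0 at hx
    rw [pow_zero, Submodule.mem_one] at hx
    obtain ⟨b, rfl⟩ := hx
    intro a
    rw [Algebra.smul_def, ← map_mul]
    exact h0 _
  | succ i ih =>
    change _ ∈ LinearMap.range (ExteriorAlgebra.ι S) ^ (i + 1) at hx
    rw [pow_succ'] at hx
    induction hx using Submodule.mul_induction_on' with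
    | add x _ y _ hx hy => intro a; rw [smul_add]; exact ha _ _ _ (hx a) (hy a)
    | mem_mul_mem m hm y hy =>
      have hy' : C i y := by simpa using ih y hy 1
      obtain ⟨w, rfl⟩ := hm
      have hw : w ∈ Submodule.span S (Set.range (KaehlerDifferential.D R S)) := by
        rw [KaehlerDifferential.span_range_derivation]; trivial
      induction hw using Submodule.span_induction with
      | zero => intro a; simpa using hs i 0 0 y hy'
      | add x x' _ _ h h' =>
        intro a
        rw [map_add, add_mul, smul_add]; exact ha _ _ _ (h a) (h' a)
      | smul b x _ h =>
        intro a
        rw [map_smul, smul_mul_assoc, smul_smul]; exact h _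
      | mem x hx =>
        obtain ⟨b, rfl⟩ := hx
        intro a
        have := hs i a b y hy'
        rwa [mul_assoc, ← Algebra.smul_def] at this

theorem formsOfDegree_mul {R S : Type*} [CommRing R] [CommRing S] [Algebra R S] {i j : ℕ}
    {x y : Forms R S} (hx : x ∈ formsOfDegree R S i) (hy : y ∈ formsOfDegree R S j) :
    x * y ∈ formsOfDegree R S (i + j) := by
  change _ ∈ LinearMap.range (ExteriorAlgebra.ι S) ^ _
  rw [pow_add]
  exact Submodule.mul_mem_mul hx hy

theorem formsOfDegree_mul' {R S : Type*} [CommRing R] [CommRing S] [Algebra R S] {i j k : ℕ}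
    {x y : Forms R S} (hx : x ∈ formsOfDegree R S i) (hy : y ∈ formsOfDegree R S j)
    (h : i + j = k) : x * y ∈ formsOfDegree R S k := h ▸ formsOfDegree_mul hx hy

theorem ι_mem_formsOfDegree {R S : Type*} [CommRing R] [CommRing S] [Algebra R S] (u : Ω[S⁄R]) :
    ExteriorAlgebra.ι S u ∈ formsOfDegree R S 1 := by
  change _ ∈ LinearMap.range (ExteriorAlgebra.ι S) ^ 1
  rw [pow_one]; exact ⟨_, rfl⟩

theorem smul_mem_formsOfDegree {R S : Type*} [CommRing R] [CommRing S] [Algebra R S] {i : ℕ}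
    (a : S) {x : Forms R S} (hx : x ∈ formsOfDegree R S i) : a • x ∈ formsOfDegree R S i :=
  Submodule.smul_mem (⋀[S]^i Ω[S⁄R]) a hx

theorem algebraMap_mem_formsOfDegree {R S : Type*} [CommRing R] [CommRing S] [Algebra R S]
    (a : S) : algebraMap S (Forms R S) a ∈ formsOfDegree R S 0 := by
  change _ ∈ LinearMap.range (ExteriorAlgebra.ι S) ^ 0
  rw [pow_zero]; exact Submodule.algebraMap_mem a

theorem pullback_ι {R S S' : Type*} [CommRing R] [CommRing S] [Algebra R S] [CommRing S']
    [Algebra R S'] [Algebra S S'] [IsScalarTower R S S'] (u : Ω[S⁄R]) :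
    pullback R S S' (ExteriorAlgebra.ι S u) =
      ExteriorAlgebra.ι S' (KaehlerDifferential.map R R S S' u) := by
  rw [pullback, ExteriorAlgebra.lift_ι_apply]; rfl

theorem pullback_algebraMap {R S S' : Type*} [CommRing R] [CommRing S] [Algebra R S] [CommRing S']
    [Algebra R S'] [Algebra S S'] [IsScalarTower R S S'] (a : S) :
    pullback R S S' (algebraMap S _ a) = algebraMap S' _ (algebraMap S S' a) := by
  rw [AlgHom.commutes, IsScalarTower.algebraMap_apply S S' (Forms R S')]

theorem pullback_smul_base {R S S' : Type*} [CommRing R] [CommRing S] [Algebra R S] [CommRing S']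
    [Algebra R S'] [Algebra S S'] [IsScalarTower R S S'] (a : R) (x : Forms R S) :
    pullback R S S' (a • x) = a • pullback R S S' x := by
  rw [← algebraMap_smul S a x, map_smul, algebraMap_smul]

theorem extD_form1_mul {R S : Type*} [CommRing R] [CommRing S] [Algebra R S] (a : S)
    (x : Forms R S) : extD R S (form1 R S a * x) = -(form1 R S a * extD R S x) := by
  rw [extD_mul, extD_form1, zero_mul, zero_add, signInv_form1, neg_mul]

theorem extD_algebraMap_mul {R S : Type*} [CommRing R] [CommRing S] [Algebra R S] (a : S)
    (x : Forms R S) : extD R S (algebraMap S _ a * x) =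
      form1 R S a * x + algebraMap S _ a * extD R S x := by
  rw [extD_mul, extD_algebraMap, AlgHom.commutes]

theorem pullback_extD {R S S' : Type*} [CommRing R] [CommRing S] [Algebra R S] [CommRing S']
    [Algebra R S'] [Algebra S S'] [IsScalarTower R S S'] (x : Forms R S) :
    pullback R S S' (extD R S x) = extD R S' (pullback R S S' x) := by
  have key : pullback R S S' (extD R S x) = extD R S' (pullback R S S' x) ∧
      pullback R S S' (signInv R S x) = signInv R S' (pullback R S S' x) := by
    induction x using forms_induction with
    | h0 a =>
      rw [extD_algebraMap, pullback_algebraMap, extD_algebraMap, pullback_form1,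
        AlgHom.commutes, pullback_algebraMap, AlgHom.commutes]
      exact ⟨rfl, rfl⟩
    | h1 a =>
      rw [extD_form1, pullback_form1, extD_form1, map_zero, signInv_form1, signInv_form1, map_neg,
        pullback_form1]
      exact ⟨rfl, rfl⟩
    | hm x y hx hy =>
      simp only [extD_mul, map_add, map_mul, hx, hy, and_self]
    | ha x y hx hy => simp only [map_add, hx, hy, and_self]
  exact key.1

end AlgDeRham
namespace GriffithsDwork
open MvPolynomial AlgDeRham
open scoped KaehlerDifferential TensorProduct

/-! ### Splitting forms of weight zero on the cone into horizontal and logarithmic parts -/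

section ConeForms

variable {A : Type*} [CommRing A] {n : ℕ} (P : MvPolynomial (Fin (n + 2)) A)

/-- The differentials of the coordinates. -/
abbrev dcoord (i : Fin (n + 2)) : Forms A (ConeRing P) := form1 A (ConeRing P) (coord P i)

/-- Products of differentials of coordinates. -/
def dcoords (I : List (Fin (n + 2))) : Forms A (ConeRing P) := (I.map (dcoord P)).prod

theorem dcoords_cons (i : Fin (n + 2)) (I : List (Fin (n + 2))) :
    dcoords P (i :: I) = dcoord P i * dcoords P I := by
  rw [dcoords, List.map_cons, List.prod_cons]; rfl

theorem dcoords_append (I J : List (Fin (n + 2))) :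
    dcoords P (I ++ J) = dcoords P I * dcoords P J := by
  rw [dcoords, List.map_append, List.prod_append]; rfl

theorem extD_dcoords (I : List (Fin (n + 2))) :
    extD A (ConeRing P) (dcoords P I) = 0 := by
  induction I with
  | nil =>
    have h : dcoords P [] = algebraMap (ConeRing P) _ 1 := by rw [map_one]; rfl
    rw [h, extD_algebraMap, form1, Derivation.map_one_eq_zero, map_zero]
  | cons i I ih => rw [dcoords_cons, extD_form1_mul, ih, mul_zero, neg_zero]

theorem form1_eq_sum (z : ConeRing P) :
    form1 A (ConeRing P) z = ∑ i, conePartial P i z • dcoord P i := by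
  rw [form1, D_eq_sum, map_sum]
  simp only [map_smul, form1]

variable {P} {d : ℕ} (hP : P.IsHomogeneous d)

/-- The forms of degree `p` on the cone that are homogeneous of degree zero. -/
def coneForms (p : ℕ) : Submodule A (Forms A (ConeRing P)) :=
  Submodule.span A {ω | ∃ z ∈ coneDeg hP (-p), ∃ I : List (Fin (n + 2)), I.length = p ∧
    ω = z • dcoords P I}

theorem smul_dcoords_mem {p : ℕ} {z : ConeRing P} (hz : z ∈ coneDeg hP (-p))
    {I : List (Fin (n + 2))} (hI : I.length = p) : z • dcoords P I ∈ coneForms hP p :=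
  Submodule.subset_span ⟨z, hz, I, hI, rfl⟩

theorem coneForms_mul {p q : ℕ} {x y : Forms A (ConeRing P)} (hx : x ∈ coneForms hP p)
    (hy : y ∈ coneForms hP q) : x * y ∈ coneForms hP (p + q) := by
  induction hx using Submodule.span_induction with
  | zero => rw [zero_mul]; exact zero_mem _
  | add x x' _ _ h h' => rw [add_mul]; exact add_mem h h'
  | smul a x _ h => rw [smul_mul_assoc]; exact Submodule.smul_mem _ _ h
  | mem x hx =>
    obtain ⟨z, hz, I, hI, rfl⟩ := hx
    induction hy using Submodule.span_induction with
    | zero => rw [mul_zero]; exact zero_mem _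
    | add x x' _ _ h h' => rw [mul_add]; exact add_mem h h'
    | smul a x _ h => rw [mul_smul_comm]; exact Submodule.smul_mem _ _ h
    | mem x hx =>
      obtain ⟨z', hz', J, hJ, rfl⟩ := hx
      rw [smul_mul_smul_comm, ← dcoords_append]
      exact smul_dcoords_mem hP (mul_mem_coneDeg' hP hz hz' (by push_cast; ring))
        (by rw [List.length_append, hI, hJ])

theorem coneForms_mul' {p q r : ℕ} {x y : Forms A (ConeRing P)} (hx : x ∈ coneForms hP p)
    (hy : y ∈ coneForms hP q) (h : p + q = r) : x * y ∈ coneForms hP r :=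
  h ▸ coneForms_mul hP hx hy

theorem smul_dcoord_mem {z : ConeRing P} (hz : z ∈ coneDeg hP (-1)) (i : Fin (n + 2)) :
    z • dcoord P i ∈ coneForms hP 1 := by
  have h : dcoord P i = dcoords P [i] := (mul_one _).symm
  rw [h]
  exact smul_dcoords_mem hP (by exact_mod_cast hz) rfl

theorem algebraMap_mem_coneForms {z : ConeRing P} (hz : z ∈ coneDeg hP 0) :
    algebraMap (ConeRing P) _ z ∈ coneForms hP 0 := by
  rw [Algebra.algebraMap_eq_smul_one]
  exact smul_dcoords_mem hP (I := []) (by simpa using hz) rfl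

theorem form1_mem_coneForms (hd : 1 ≤ d) {z : ConeRing P} (hz : z ∈ coneDeg hP 0) :
    form1 A (ConeRing P) z ∈ coneForms hP 1 := by
  rw [form1_eq_sum]
  exact sum_mem fun i _ => smul_dcoord_mem hP (by simpa using conePartial_mem hP hd hz i) i

theorem pullback_mem_coneForms (hd : 1 ≤ d) (p : ℕ) {x : Forms A (ComplementRing P)}
    (hx : x ∈ formsOfDegree A (ComplementRing P) p) :
    pullback A (ComplementRing P) (ConeRing P) x ∈ coneForms hP p := by
  refine formsOfDegree_induction (C := fun p x =>
    pullback A (ComplementRing P) (ConeRing P) x ∈ coneForms hP p) ?_ ?_ ?_ p x hx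
  · intro a
    rw [pullback_algebraMap]
    exact algebraMap_mem_coneForms hP (algebraMap_mem_coneDeg_zero hP a)
  · intro i a b y hy
    rw [map_mul, map_mul, pullback_algebraMap, pullback_form1, mul_assoc, ← Algebra.smul_def,
      ← smul_mul_assoc, add_comm i]
    refine coneForms_mul hP ?_ hy
    rw [Algebra.smul_def, ← zero_add 1]
    exact coneForms_mul hP (algebraMap_mem_coneForms hP (algebraMap_mem_coneDeg_zero hP a))
      (form1_mem_coneForms hP hd (algebraMap_mem_coneDeg_zero hP b))
  · intro i x y hx hy
    rw [map_add]; exact add_mem hx hy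

variable [Algebra ℚ A]

variable (P) (d) in
/-- The differential `dP / (d P)`. -/
def logDiff : Ω[ConeRing P⁄A] :=
  ∑ i, logCoeff P d i • KaehlerDifferential.D A (ConeRing P) (coord P i)

variable (P) (d) in
/-- The logarithmic form `dP / (d P)`. -/
def logForm : Forms A (ConeRing P) := ExteriorAlgebra.ι _ (logDiff P d)

variable (P) (d) in
theorem logForm_eq_sum : logForm P d = ∑ i, logCoeff P d i • dcoord P i := by
  rw [logForm, logDiff, map_sum]
  simp only [map_smul, form1]

theorem logForm_mem : logForm P d ∈ coneForms hP 1 := by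
  rw [logForm_eq_sum]
  exact sum_mem fun i _ => smul_dcoord_mem hP (logCoeff_mem hP i) i

theorem euler_logDiff (hP : P.IsHomogeneous d) (hd : 1 ≤ d) : euler P (logDiff P d) = 1 := by
  rw [logDiff, map_sum, ← sum_logCoeff_mul_coord hP hd]
  simp only [map_smul, euler_coord, smul_eq_mul]

theorem logForm_mul_self : logForm P d * logForm P d = 0 := ExteriorAlgebra.ι_sq_zero _

theorem signInv_logForm : signInv A (ConeRing P) (logForm P d) = -logForm P d :=
  CliffordAlgebra.involute_ι _

theorem logForm_eq : logForm P d = (algebraMap A (ConeRing P) (algebraMap ℚ A (d : ℚ)⁻¹)) •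
    (invP P • form1 A (ConeRing P) (toCone P P)) := by
  rw [logForm_eq_sum, form1_eq_sum, Finset.smul_sum, Finset.smul_sum]
  refine Finset.sum_congr rfl fun i _ => ?_
  rw [smul_smul, smul_smul, conePartial_toCone, logCoeff]
  congr 1
  ring

/-- `d(P⁻¹)` is a multiple of `dP`, and `dP ∧ dP = 0`. -/
theorem extD_logForm : extD A (ConeRing P) (logForm P d) = 0 := by
  have h : form1 A (ConeRing P) (invP P) =
      -(invP P ^ 2) • form1 A (ConeRing P) (toCone P P) := by
    rw [form1_eq_sum, form1_eq_sum, Finset.smul_sum]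
    refine Finset.sum_congr rfl fun i _ => ?_
    rw [conePartial_toCone, conePartial_invP, smul_smul]
    congr 1
    ring
  rw [logForm_eq, algebraMap_smul, map_smul, Algebra.smul_def (invP P), extD_algebraMap_mul,
    extD_form1, mul_zero, add_zero, h, smul_mul_assoc, form1_sq, smul_zero, smul_zero]

theorem extD_logForm_mul (x : Forms A (ConeRing P)) :
    extD A (ConeRing P) (logForm P d * x) = -(logForm P d * extD A (ConeRing P) x) := by
  rw [extD_mul, extD_logForm, zero_mul, zero_add, signInv_logForm, neg_mul]

/-- One-forms on the cone of degree zero split into a horizontal and a logarithmic part. -/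
theorem exists_smul_dcoord_eq (hd : 1 ≤ d) {z : ConeRing P} (hz : z ∈ coneDeg hP (-1))
    (i : Fin (n + 2)) : ∃ (u : Ω[ComplementRing P⁄A]) (f : ComplementRing P),
      z • dcoord P i = pullback A (ComplementRing P) (ConeRing P) (ExteriorAlgebra.ι _ u) +
        algebraMap (ComplementRing P) (ConeRing P) f • logForm P d := by
  have h0 : ∀ {y : ConeRing P}, y ∈ coneDeg hP (-1) → ∀ j, ∃ f : ComplementRing P,
      algebraMap (ComplementRing P) (ConeRing P) f = y * coord P j := fun hy j =>
    (mem_coneDeg_zero_iff hP hd).1 (mul_mem_coneDeg' hP hy (coord_mem_coneDeg hP j) (by ring))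
  choose a ha using fun j => h0 hz j
  choose b hb using fun k j => h0 (logCoeff_mem hP k) j
  -- With `a_k = z x_k` and `b_{ki} = l_k x_i`, all of degree zero, the terms in `dl_k` cancel in
  -- `a_k db_{ki} - a_i db_{kk} = l_k x_k z dx_i - z x_i l_k dx_k`. Summing over `k` leaves `z dx_i
  -- - z x_i η`.
  refine ⟨∑ k, (a k • KaehlerDifferential.D A _ (b k i) - a i • KaehlerDifferential.D A _ (b k k)),
    a i, ?_⟩
  have key : ∀ k, pullback A (ComplementRing P) (ConeRing P) (ExteriorAlgebra.ι (ComplementRing P)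
      (a k • KaehlerDifferential.D A _ (b k i) - a i • KaehlerDifferential.D A _ (b k k))) =
      (logCoeff P d k * coord P k) • z • dcoord P i -
        (z * coord P i) • logCoeff P d k • dcoord P k := by
    intro k
    rw [pullback_ι, map_sub, map_smul, map_smul, KaehlerDifferential.map_D,
      KaehlerDifferential.map_D, map_sub, ← algebraMap_smul (ConeRing P) (a k),
      ← algebraMap_smul (ConeRing P) (a i), map_smul, map_smul, hb, hb, ha, ha,
      Derivation.leibniz, Derivation.leibniz]
    simp only [map_add, map_smul, form1, smul_add, smul_smul]
    rw [mul_right_comm z (coord P k) (coord P i), add_sub_add_right_eq_sub,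
      show z * coord P k * logCoeff P d k = logCoeff P d k * coord P k * z by ring]
  rw [map_sum, map_sum, Finset.sum_congr rfl fun k _ => key k, Finset.sum_sub_distrib,
    ← Finset.sum_smul, ← Finset.smul_sum, sum_logCoeff_mul_coord hP hd, one_smul, ha,
    ← logForm_eq_sum, sub_add_cancel]

/-- Inserting `1 = ∑ l_k x_k` distributes the degree as `(l_k dx_i) ∧ (x_k z dx_J)`, a product of
forms of weight zero. Each factor splits, and `η ∧ η = 0` keeps the product in the required shape.
-/
theorem exists_smul_dcoords_eq (hd : 1 ≤ d) (p : ℕ) {z : ConeRing P}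
    (hz : z ∈ coneDeg hP (-(p + 1))) {I : List (Fin (n + 2))} (hI : I.length = p + 1) :
    ∃ α ∈ formsOfDegree A (ComplementRing P) (p + 1), ∃ β ∈ formsOfDegree A (ComplementRing P) p,
      z • dcoords P I = pullback A (ComplementRing P) (ConeRing P) α +
        logForm P d * pullback A (ComplementRing P) (ConeRing P) β := by
  induction p generalizing z I with
  | zero =>
    obtain ⟨i, rfl⟩ := List.length_eq_one_iff.1 hI
    obtain ⟨u, f, h⟩ := exists_smul_dcoord_eq hP hd (z := z) (by simpa using hz) i
    refine ⟨_, ι_mem_formsOfDegree u, _, algebraMap_mem_formsOfDegree f, ?_⟩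
    have h1 : dcoords P [i] = dcoord P i := mul_one _
    rw [h1, h, pullback_algebraMap, ← Algebra.commutes, ← Algebra.smul_def]
  | succ p ih =>
    obtain ⟨i, J, rfl⟩ := List.exists_cons_of_length_eq_add_one hI
    have hJ : J.length = p + 1 := by simpa using hI
    have hk : ∀ k, ∃ α ∈ formsOfDegree A (ComplementRing P) (p + 1 + 1),
        ∃ β ∈ formsOfDegree A (ComplementRing P) (p + 1),
        (logCoeff P d k • dcoord P i) * ((coord P k * z) • dcoords P J) =
          pullback A (ComplementRing P) (ConeRing P) α +
          logForm P d * pullback A (ComplementRing P) (ConeRing P) β := by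
      intro k
      obtain ⟨u, f, h⟩ := exists_smul_dcoord_eq hP hd (logCoeff_mem hP k) i
      obtain ⟨α, hα, β, hβ, h'⟩ := ih (z := coord P k * z) (mul_mem_coneDeg' hP
        (coord_mem_coneDeg hP k) hz (by push_cast; ring)) hJ
      refine ⟨ExteriorAlgebra.ι _ u * α, ?_, f • α - ExteriorAlgebra.ι _ u * β, ?_, ?_⟩
      · rw [add_comm (p + 1)]
        exact formsOfDegree_mul (ι_mem_formsOfDegree u) hα
      · refine sub_mem (smul_mem_formsOfDegree f hα) ?_
        rw [add_comm p]
        exact formsOfDegree_mul (ι_mem_formsOfDegree u) hβ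
      · rw [h, h']
        have hs : pullback A (ComplementRing P) (ConeRing P) (ExteriorAlgebra.ι _ u) *
            logForm P d = -(logForm P d *
              pullback A (ComplementRing P) (ConeRing P) (ExteriorAlgebra.ι _ u)) := by
          rw [pullback_ι, logForm]
          exact eq_neg_of_add_eq_zero_left (ExteriorAlgebra.ι_add_mul_swap _ _)
        simp only [map_mul, map_sub, map_smul, add_mul, mul_add, mul_sub, smul_mul_assoc,
          mul_smul_comm, ← mul_assoc, hs, logForm_mul_self, smul_zero, add_zero,
          neg_mul, algebraMap_smul]
        abel
    choose α hα β hβ h using hk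
    refine ⟨∑ k, α k, sum_mem fun k _ => hα k, ∑ k, β k, sum_mem fun k _ => hβ k, ?_⟩
    rw [map_sum, map_sum, Finset.mul_sum, ← Finset.sum_add_distrib,
      ← Finset.sum_congr rfl fun k _ => h k]
    have h2 : ∀ k, (logCoeff P d k • dcoord P i) * ((coord P k * z) • dcoords P J) =
        (logCoeff P d k * coord P k) • z • dcoords P (i :: J) := by
      intro k
      rw [smul_mul_smul_comm, ← dcoords_cons, smul_smul, mul_assoc]
    rw [Finset.sum_congr rfl fun k _ => h2 k, ← Finset.sum_smul, sum_logCoeff_mul_coord hP hd,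
      one_smul]

end ConeForms
end GriffithsDwork
end

noncomputable section
namespace GriffithsDwork
open MvPolynomial AlgDeRham
open scoped KaehlerDifferential TensorProduct

/-! ### Contraction of a product of one-forms -/

section Contraction

theorem contractLeft_ιMulti {R M : Type*} [CommRing R] [AddCommGroup M] [Module R M]
    (f : Module.Dual R M) (k : ℕ) (v : Fin (k + 1) → M) :
    CliffordAlgebra.contractLeft f (ExteriorAlgebra.ιMulti R (k + 1) v) =
      ∑ i : Fin (k + 1), ((-1) ^ (i : ℕ) * f (v i)) •
        ExteriorAlgebra.ιMulti R k (fun j => v (i.succAbove j)) := by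
  induction k with
  | zero =>
    rw [ExteriorAlgebra.ιMulti_succ_apply]
    simp [ExteriorAlgebra.ι, Algebra.algebraMap_eq_smul_one]
  | succ k ih =>
    rw [ExteriorAlgebra.ιMulti_succ_apply]
    have h := CliffordAlgebra.contractLeft_ι_mul (Q := (0 : QuadraticForm R M)) f (v 0)
      (ExteriorAlgebra.ιMulti R (k + 1) (Matrix.vecTail v))
    refine h.trans ?_
    rw [Fin.sum_univ_succ (n := k + 1), ih, Finset.mul_sum, sub_eq_add_neg, ← Finset.sum_neg_distrib]
    congr 1
    · simp [Matrix.vecTail, Function.comp_def]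
    · refine Finset.sum_congr rfl fun i _ => ?_
      rw [ExteriorAlgebra.ιMulti_succ_apply, mul_smul_comm, ← neg_smul]
      congr 1
      · simp [Matrix.vecTail, pow_succ]
      · have h1 : (fun j => Matrix.vecTail v (i.succAbove j)) =
            Matrix.vecTail fun j => v (i.succ.succAbove j) := by
          ext j; simp [Matrix.vecTail]
        rw [h1, Fin.succ_succAbove_zero]

end Contraction

/-! ### Top forms as functions of degree -(n+2), exact forms as divergences -/

section TopForms

variable {A : Type*} [CommRing A] {n : ℕ} (P : MvPolynomial (Fin (n + 2)) A)

/-- The form `dx_0 ∧ ⋯ ∧ dx_{n+1}`. -/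
def topForm : Forms A (ConeRing P) := ExteriorAlgebra.ιMulti (ConeRing P) (n + 2) (coneBasis P)

/-- The coefficient of `dx_0 ∧ ⋯ ∧ dx_{n+1}` in a form. -/
def topCoeff : Forms A (ConeRing P) →ₗ[ConeRing P] ConeRing P :=
  ExteriorAlgebra.liftAlternating (Pi.single (n + 2) (coneBasis P).det)

theorem topCoeff_ιMulti (v : Fin (n + 2) → Ω[ConeRing P⁄A]) :
    topCoeff P (ExteriorAlgebra.ιMulti (ConeRing P) (n + 2) v) = (coneBasis P).det v := by
  rw [topCoeff, ExteriorAlgebra.liftAlternating_apply_ιMulti, Pi.single_eq_same]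

theorem topCoeff_topForm : topCoeff P (topForm P) = 1 := by
  rw [topForm, topCoeff_ιMulti, Module.Basis.det_self]

theorem ιMulti_eq_det_smul (v : Fin (n + 2) → Ω[ConeRing P⁄A]) :
    ExteriorAlgebra.ιMulti (ConeRing P) (n + 2) v = (coneBasis P).det v • topForm P := by
  have h : ExteriorAlgebra.ιMulti (ConeRing P) (n + 2) =
      (LinearMap.toSpanSingleton (ConeRing P) (Forms A (ConeRing P)) (topForm P)).compAlternatingMap
        (coneBasis P).det := by
    refine Module.Basis.ext_alternating (coneBasis P) fun v hv => ?_
    obtain ⟨σ, rfl⟩ : ∃ σ : Equiv.Perm (Fin (n + 2)), ⇑σ = v :=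
      ⟨Equiv.ofBijective v (Finite.injective_iff_bijective.1 hv), rfl⟩
    change ExteriorAlgebra.ιMulti (ConeRing P) (n + 2) (coneBasis P ∘ σ) =
      (coneBasis P).det (coneBasis P ∘ σ) • topForm P
    rw [AlternatingMap.map_perm, AlternatingMap.map_perm, Module.Basis.det_self, topForm,
      smul_assoc, one_smul]
  rw [h]; rfl

theorem eq_topCoeff_smul {x : Forms A (ConeRing P)}
    (hx : x ∈ formsOfDegree A (ConeRing P) (n + 2)) : x = topCoeff P x • topForm P := by
  have hx' : x ∈ ⋀[ConeRing P]^(n + 2) Ω[ConeRing P⁄A] := hx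
  rw [← ExteriorAlgebra.ιMulti_span_fixedDegree] at hx'
  clear hx
  induction hx' using Submodule.span_induction with
  | zero => simp
  | add x y _ _ h h' => rw [map_add, add_smul, ← h, ← h']
  | smul a x _ h => rw [map_smul, smul_assoc, ← h]
  | mem x hx =>
    obtain ⟨v, rfl⟩ := hx
    rw [topCoeff_ιMulti, ιMulti_eq_det_smul]

theorem dcoords_ofFn {k : ℕ} (v : Fin k → Fin (n + 2)) : dcoords P (List.ofFn v) =
    ExteriorAlgebra.ιMulti (ConeRing P) k (coneBasis P ∘ v) := by
  rw [dcoords, ExteriorAlgebra.ιMulti_apply, List.map_ofFn]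
  simp only [Function.comp_def, coneBasis_apply, form1]

theorem topCoeff_dcoords_of_injective {v : Fin (n + 2) → Fin (n + 2)} (hv : Function.Injective v) :
    ∃ u : ℤˣ, topCoeff P (dcoords P (List.ofFn v)) = ((u : ℤ) : ConeRing P) := by
  obtain ⟨σ, rfl⟩ : ∃ σ : Equiv.Perm (Fin (n + 2)), ⇑σ = v :=
    ⟨Equiv.ofBijective v (Finite.injective_iff_bijective.1 hv), rfl⟩
  refine ⟨Equiv.Perm.sign σ, ?_⟩
  rw [dcoords_ofFn, topCoeff_ιMulti, AlternatingMap.map_perm, Module.Basis.det_self,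
    Units.smul_def, zsmul_eq_mul, mul_one]

theorem dcoords_of_not_injective {k : ℕ} {v : Fin k → Fin (n + 2)} (hv : ¬ Function.Injective v) :
    dcoords P (List.ofFn v) = 0 := by
  rw [dcoords_ofFn]
  exact AlternatingMap.map_eq_zero_of_not_injective _ _ fun h => hv h.of_comp

theorem exists_topCoeff_dcoords {I : List (Fin (n + 2))} (hI : I.length = n + 2) :
    ∃ c : ℤ, topCoeff P (dcoords P I) = c := by
  obtain ⟨v, rfl⟩ : ∃ v : Fin (n + 2) → Fin (n + 2), I = List.ofFn v := by
    exact ⟨_, (List.ofFn_get I).symm.trans (List.ofFn_congr hI _)⟩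
  by_cases hv : Function.Injective v
  · obtain ⟨u, hu⟩ := topCoeff_dcoords_of_injective P hv
    exact ⟨u, hu⟩
  · exact ⟨0, by rw [dcoords_of_not_injective P hv, map_zero, Int.cast_zero]⟩

/-- Contraction of forms on the cone with the Euler vector field. -/
def eulerContract : Forms A (ConeRing P) →ₗ[ConeRing P] Forms A (ConeRing P) :=
  CliffordAlgebra.contractLeft (euler P)

theorem eulerContract_ι_mul (u : Ω[ConeRing P⁄A]) (x : Forms A (ConeRing P)) :
    eulerContract P (ExteriorAlgebra.ι _ u * x) =
      euler P u • x - ExteriorAlgebra.ι _ u * eulerContract P x :=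
  CliffordAlgebra.contractLeft_ι_mul _ _ _

/-- This is the origin of `Ω`: its signs are those of the expansion of a contraction. -/
theorem eulerContract_topForm : eulerContract P (topForm P) = volumeForm P := by
  rw [topForm, volumeForm]
  refine (contractLeft_ιMulti _ _ _).trans ?_
  simp only [coneBasis_apply, euler_coord]

variable {P} {d : ℕ} (hP : P.IsHomogeneous d)

/-- `ι_E df = 0` because functions on the complement have degree zero. -/
theorem eulerContract_pullback (hP : P.IsHomogeneous d) (hd : 1 ≤ d) (p : ℕ)
    {x : Forms A (ComplementRing P)} (hx : x ∈ formsOfDegree A (ComplementRing P) p) :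
    eulerContract P (pullback A (ComplementRing P) (ConeRing P) x) = 0 := by
  refine formsOfDegree_induction (C := fun p x =>
    eulerContract P (pullback A (ComplementRing P) (ConeRing P) x) = 0) ?_ ?_ ?_ p x hx
  · intro a
    rw [pullback_algebraMap]
    exact CliffordAlgebra.contractLeft_algebraMap
      (Q := (0 : QuadraticForm (ConeRing P) Ω[ConeRing P⁄A])) (euler P) _
  · intro i a b y hy
    rw [map_mul, map_mul (pullback A (ComplementRing P) (ConeRing P)) (algebraMap _ _ a),
      pullback_algebraMap, pullback_form1, mul_assoc, ← Algebra.smul_def, map_smul, form1, eulerContract_ι_mul, hy, mul_zero, sub_zero,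
      euler_D hP hd (algebraMap_mem_coneDeg_zero hP b), Int.cast_zero, zero_mul, zero_smul,
      smul_zero]
  · intro i x y hx hy
    rw [map_add, map_add, hx, hy, add_zero]

theorem pullback_mem_formsOfDegree (p : ℕ) {x : Forms A (ComplementRing P)}
    (hx : x ∈ formsOfDegree A (ComplementRing P) p) :
    pullback A (ComplementRing P) (ConeRing P) x ∈ formsOfDegree A (ConeRing P) p := by
  refine formsOfDegree_induction (C := fun p x =>
    pullback A (ComplementRing P) (ConeRing P) x ∈ formsOfDegree A (ConeRing P) p) ?_ ?_ ?_ p x hx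
  · intro a
    rw [pullback_algebraMap]
    exact algebraMap_mem_formsOfDegree _
  · intro i a b y hy
    rw [map_mul, map_mul, pullback_algebraMap, pullback_form1, mul_assoc, ← Algebra.smul_def]
    exact smul_mem_formsOfDegree _ (formsOfDegree_mul' (ι_mem_formsOfDegree _) hy (add_comm 1 i))
  · intro i x y hx hy
    rw [map_add]; exact add_mem hx hy

theorem topCoeff_mem {x : Forms A (ConeRing P)} (hx : x ∈ coneForms hP (n + 2)) :
    topCoeff P x ∈ coneDeg hP (-(n + 2)) := by
  induction hx using Submodule.span_induction with
  | zero => rw [map_zero]; exact zero_mem _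
  | add x y _ _ hx hy => rw [map_add]; exact add_mem hx hy
  | smul a x _ hx => rw [LinearMap.map_smul_of_tower]; exact Submodule.smul_mem _ _ hx
  | mem x hx =>
    obtain ⟨z, hz, I, hI, rfl⟩ := hx
    obtain ⟨c, hc⟩ := exists_topCoeff_dcoords P hI
    rw [map_smul, hc, smul_eq_mul, mul_comm, ← zsmul_eq_mul]
    exact zsmul_mem (by exact_mod_cast hz) c

/-- The divergences of homogeneous vector fields on the cone. -/
def divergences : Submodule A (ConeRing P) :=
  ⨆ i, (coneDeg hP (-(n + 1))).map (conePartial P i).toLinearMap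

theorem conePartial_mem_divergences {z : ConeRing P} (hz : z ∈ coneDeg hP (-(n + 1)))
    (i : Fin (n + 2)) : conePartial P i z ∈ divergences hP :=
  Submodule.mem_iSup_of_mem i ⟨z, hz, rfl⟩

theorem extD_smul_dcoords (z : ConeRing P) (I : List (Fin (n + 2))) :
    extD A (ConeRing P) (z • dcoords P I) = ∑ i, conePartial P i z • dcoords P (i :: I) := by
  rw [Algebra.smul_def, extD_algebraMap_mul, extD_dcoords, mul_zero, add_zero, form1_eq_sum,
    Finset.sum_mul]
  simp only [dcoords_cons, smul_mul_assoc]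

/-- Each term `∂_i z dx_i ∧ dx_I` of `d(z dx_I)` contributes an integer multiple of `∂_i z`. -/
theorem topCoeff_extD_mem {x : Forms A (ConeRing P)} (hx : x ∈ coneForms hP (n + 1)) :
    topCoeff P (extD A (ConeRing P) x) ∈ divergences hP := by
  induction hx using Submodule.span_induction with
  | zero => rw [map_zero, map_zero]; exact zero_mem _
  | add x y _ _ hx hy => rw [map_add, map_add]; exact add_mem hx hy
  | smul a x _ hx => rw [map_smul, LinearMap.map_smul_of_tower]; exact Submodule.smul_mem _ _ hx
  | mem x hx =>
    obtain ⟨z, hz, I, hI, rfl⟩ := hx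
    rw [extD_smul_dcoords, map_sum]
    refine sum_mem fun i _ => ?_
    obtain ⟨c, hc⟩ := exists_topCoeff_dcoords P (I := i :: I) (by simp [hI])
    rw [map_smul, hc, smul_eq_mul, mul_comm, ← zsmul_eq_mul]
    exact zsmul_mem (conePartial_mem_divergences hP (by exact_mod_cast hz) i) c

variable [Algebra ℚ A]

theorem logForm_mul_topForm : logForm P d * topForm P = 0 := by
  have h : topForm P = dcoords P (List.ofFn id) := (dcoords_ofFn P id).symm
  rw [logForm_eq_sum, Finset.sum_mul]
  refine Finset.sum_eq_zero fun i _ => ?_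
  have h2 : i :: List.ofFn id = List.ofFn (Fin.cons i id : Fin (n + 3) → Fin (n + 2)) := by
    rw [List.ofFn_succ]; simp
  rw [smul_mul_assoc, h, ← dcoords_cons, h2, dcoords_of_not_injective, smul_zero]
  intro hinj
  have : (0 : Fin (n + 3)) = i.succ := hinj (by simp)
  exact (Fin.succ_ne_zero i) this.symm

/-- Contract `η ∧ dx_0 ∧ ⋯ ∧ dx_{n+1} = 0` with `E` and use `ι_E η = 1`. -/
theorem logForm_mul_volumeForm (hP : P.IsHomogeneous d) (hd : 1 ≤ d) :
    logForm P d * volumeForm P = topForm P := by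
  have h := eulerContract_ι_mul P (logDiff P d) (topForm P)
  change eulerContract P (logForm P d * topForm P) = _ - logForm P d * _ at h
  rw [logForm_mul_topForm, map_zero, euler_logDiff hP hd, one_smul, eulerContract_topForm] at h
  exact (sub_eq_zero.1 h.symm).symm

/-- The function `g` such that a given form of top degree on the complement is `g Ω`. -/
def formCoeff (P : MvPolynomial (Fin (n + 2)) A) (d : ℕ) :
    Forms A (ComplementRing P) →ₗ[A] ConeRing P where
  toFun ω := topCoeff P (logForm P d * pullback A (ComplementRing P) (ConeRing P) ω)
  map_add' x y := by rw [map_add, mul_add, map_add]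
  map_smul' a x := by
    rw [pullback_smul_base, mul_smul_comm, LinearMap.map_smul_of_tower, RingHom.id_apply]

theorem formCoeff_apply (ω : Forms A (ComplementRing P)) : formCoeff P d ω =
    topCoeff P (logForm P d * pullback A (ComplementRing P) (ConeRing P) ω) := rfl

/-- Contract `η ∧ π*ω = g dx_0 ∧ ⋯ ∧ dx_{n+1}` with `E`: the left side becomes `π*ω`, as pullbacks
are killed, and the right side becomes `g Ω`. -/
theorem pullback_eq_formCoeff_smul (hP : P.IsHomogeneous d) (hd : 1 ≤ d)
    {ω : Forms A (ComplementRing P)} (hω : ω ∈ formsOfDegree A (ComplementRing P) (n + 1)) :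
    pullback A (ComplementRing P) (ConeRing P) ω = formCoeff P d ω • volumeForm P := by
  have h1 : logForm P d * pullback A (ComplementRing P) (ConeRing P) ω =
      formCoeff P d ω • topForm P := by
    exact eq_topCoeff_smul P (formsOfDegree_mul' (ι_mem_formsOfDegree _)
      (pullback_mem_formsOfDegree _ hω) (by ring))
  have h2 := eulerContract_ι_mul P (logDiff P d) (pullback A (ComplementRing P) (ConeRing P) ω)
  change eulerContract P (logForm P d * _) = _ at h2
  rw [h1, eulerContract_pullback hP hd _ hω, mul_zero, sub_zero, euler_logDiff hP hd, one_smul,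
    map_smul, eulerContract_topForm] at h2
  exact h2.symm

theorem formCoeff_eq_of_pullback (hP : P.IsHomogeneous d) (hd : 1 ≤ d)
    {ω : Forms A (ComplementRing P)} {z : ConeRing P}
    (h : pullback A (ComplementRing P) (ConeRing P) ω = z • volumeForm P) :
    formCoeff P d ω = z := by
  rw [formCoeff_apply, h, mul_smul_comm, logForm_mul_volumeForm hP hd, map_smul, topCoeff_topForm,
    smul_eq_mul, mul_one]

theorem eq_of_formCoeff_eq (hP : P.IsHomogeneous d) (hd : 1 ≤ d)
    {ω η : Forms A (ComplementRing P)} (hω : ω ∈ formsOfDegree A (ComplementRing P) (n + 1))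
    (hη : η ∈ formsOfDegree A (ComplementRing P) (n + 1))
    (h : formCoeff P d ω = formCoeff P d η) : ω = η := by
  apply pullback_injective hP hd
  rw [pullback_eq_formCoeff_smul hP hd hω, pullback_eq_formCoeff_smul hP hd hη, h]

/-- Forms on the complement of degree larger than the relative dimension vanish. -/
theorem eq_zero_of_degree (hP : P.IsHomogeneous d) (hd : 1 ≤ d)
    {ω : Forms A (ComplementRing P)} (hω : ω ∈ formsOfDegree A (ComplementRing P) (n + 2)) :
    ω = 0 := by
  apply pullback_injective hP hd
  have h1 := eq_topCoeff_smul P (pullback_mem_formsOfDegree _ hω)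
  have h2 := eulerContract_pullback hP hd _ hω
  rw [h1, map_smul, eulerContract_topForm] at h2
  -- Wedging `c Ω = 0` with `η` gives `c dx_0 ∧ ⋯ ∧ dx_{n+1} = 0`, hence `c = 0`.
  have h3 := congrArg (fun x => topCoeff P (logForm P d * x)) h2
  simp only [mul_smul_comm, logForm_mul_volumeForm hP hd, map_smul, topCoeff_topForm, mul_zero,
    map_zero, smul_eq_mul, mul_one] at h3
  rw [h1, h3, zero_smul, map_zero]

theorem formCoeff_mem (hd : 1 ≤ d) {ω : Forms A (ComplementRing P)}
    (hω : ω ∈ formsOfDegree A (ComplementRing P) (n + 1)) :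
    formCoeff P d ω ∈ coneDeg hP (-(n + 2)) := by
  exact topCoeff_mem hP (coneForms_mul' hP (logForm_mem hP) (pullback_mem_coneForms hP hd _ hω)
    (by ring))

/-- Split `z dx_0 ∧ ⋯ ∧ dx_{n+1} = π*α + η ∧ π*β`. Here `α = 0` for degree reasons, so `β` is the
form sought. -/
theorem exists_formCoeff_eq (hd : 1 ≤ d) {z : ConeRing P} (hz : z ∈ coneDeg hP (-(n + 2))) :
    ∃ ω ∈ formsOfDegree A (ComplementRing P) (n + 1), formCoeff P d ω = z := by
  obtain ⟨α, hα, β, hβ, h⟩ := exists_smul_dcoords_eq hP hd (n + 1) (z := z)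
    (by push_cast; rwa [show -((n : ℤ) + 1 + 1) = -(n + 2) by ring]) (I := List.ofFn id) (by simp)
  refine ⟨β, hβ, ?_⟩
  rw [eq_zero_of_degree hP hd hα, map_zero, zero_add, dcoords_ofFn] at h
  rw [formCoeff_apply, ← h, map_smul]
  change z • topCoeff P (topForm P) = z
  rw [topCoeff_topForm, smul_eq_mul, mul_one]

/-- As the logarithmic form is closed, its product with `π*dη` is minus the derivative of its
product with `π*η`. -/
theorem formCoeff_extD_mem (hd : 1 ≤ d) {η : Forms A (ComplementRing P)}
    (hη : η ∈ formsOfDegree A (ComplementRing P) n) :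
    formCoeff P d (extD A _ η) ∈ divergences hP := by
  have h := extD_logForm_mul (d := d) (pullback A (ComplementRing P) (ConeRing P) η)
  rw [formCoeff_apply, pullback_extD, ← neg_neg (logForm P d * _), ← h, map_neg]
  exact neg_mem (topCoeff_extD_mem hP (coneForms_mul' hP (logForm_mem hP)
    (pullback_mem_coneForms hP hd _ hη) (add_comm 1 n)))

/-- For `∂_i y`, split `y` times the product of all `dx_j` with `j ≠ i`. The horizontal part has top
degree on the complement, hence is closed, and differentiation leaves `± ∂_i y` against the
logarithmic part. -/
theorem exists_formCoeff_extD_eq (hd : 1 ≤ d) {z : ConeRing P} (hz : z ∈ divergences hP) :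
    ∃ η ∈ formsOfDegree A (ComplementRing P) n, formCoeff P d (extD A _ η) = z := by
  suffices h : divergences hP ≤ (formsOfDegree A (ComplementRing P) n).map
      (formCoeff P d ∘ₗ extD A (ComplementRing P)) from h hz
  refine iSup_le fun i => ?_
  rintro _ ⟨y, hy, rfl⟩
  obtain ⟨α, hα, β, hβ, h⟩ := exists_smul_dcoords_eq hP hd n (z := y) hy
    (I := List.ofFn i.succAbove) (by simp)
  have hcons : ∀ k, k :: List.ofFn i.succAbove =
      List.ofFn (Fin.cons k i.succAbove : Fin (n + 2) → Fin (n + 2)) := by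
    intro k
    rw [List.ofFn_succ]; simp
  have h1 := congrArg (fun x => topCoeff P (extD A _ x)) h
  simp only [map_add, extD_logForm_mul, ← pullback_extD] at h1
  rw [eq_zero_of_degree hP hd (extD_mem A _ _ _ hα), map_zero, map_zero, zero_add, map_neg,
    extD_smul_dcoords, map_sum, Finset.sum_eq_single i, map_smul, hcons] at h1
  · obtain ⟨u, hu⟩ := topCoeff_dcoords_of_injective P
      (Fin.cons_injective_iff.2 ⟨by simp, Fin.succAbove_right_injective⟩ :
        Function.Injective (Fin.cons i i.succAbove : Fin (n + 2) → Fin (n + 2)))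
    rw [hu] at h1
    -- The sign `u` of the reordering is its own inverse. The minus sign comes from moving `d` past
    -- the logarithmic form.
    refine ⟨-((((u : ℤ) : A)) • β), neg_mem (Submodule.smul_mem _ _ hβ), ?_⟩
    rw [map_neg, map_smul, LinearMap.comp_apply, formCoeff_apply, Algebra.smul_def, ← mul_neg, ← h1,
      smul_eq_mul, map_intCast, mul_left_comm, ← Int.cast_mul]
    simp
  · intro k _ hk
    rw [map_smul, hcons, dcoords_of_not_injective, map_zero, smul_zero]
    intro hinj
    obtain ⟨j, hj⟩ := Fin.exists_succAbove_eq hk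
    exact (Fin.cons_injective_iff.1 hinj).1 ⟨j, hj⟩
  · intro hi
    exact absurd (Finset.mem_univ i) hi

/-- A basis of the functions of degree `-(n + 2)` on the cone modulo divergences gives a basis of
the de Rham cohomology of the complement. -/
theorem exists_basis_of_divergences (hd : 1 ≤ d) {ι : Type*} (w : ι → Fin (n + 2) → ℕ) (k : ι → ℕ)
    (hmem : ∀ i, (∏ j, coord P j ^ w i j) * invP P ^ k i ∈ coneDeg hP (-(n + 2)))
    (hspan : ∀ z ∈ coneDeg hP (-(n + 2)), ∃ c : ι →₀ A,
      z - Finsupp.linearCombination A (fun i => (∏ j, coord P j ^ w i j) * invP P ^ k i) c ∈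
        divergences hP)
    (hindep : ∀ c : ι →₀ A, 
      Finsupp.linearCombination A (fun i => (∏ j, coord P j ^ w i j) * invP P ^ k i) c ∈
        divergences hP → c = 0) :
    ∃ b : ι → closedForms A (ComplementRing P) (n + 1),
      (∀ (i : ι) (ω : Forms A (ComplementRing P)), IsPoleForm P (w i) (k i) ω ↔ ω = b i) ∧
      ∃ B : Module.Basis ι A (DeRhamCohomology A (ComplementRing P) (n + 1)),
        ∀ i, B i = deRhamClass A (ComplementRing P) (n + 1) (b i) := by
  choose ω hω hωc using fun i => exists_formCoeff_eq hP hd (hmem i)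
  have hclosed : ∀ {x : Forms A (ComplementRing P)},
      x ∈ formsOfDegree A (ComplementRing P) (n + 1) → x ∈ closedForms A (ComplementRing P) (n + 1) :=
    fun hx => ⟨hx, LinearMap.mem_ker.2 (eq_zero_of_degree hP hd (extD_mem A _ _ _ hx))⟩
  let b : ι → closedForms A (ComplementRing P) (n + 1) := fun i => ⟨ω i, hclosed (hω i)⟩
  -- `formCoeff` is injective on top forms and maps the exact ones onto the divergences, so
  -- cohomology can be computed with functions on the cone.
  have hexact : ∀ x : closedForms A (ComplementRing P) (n + 1),
      deRhamClass A (ComplementRing P) (n + 1) x = 0 ↔ formCoeff P d x.1 ∈ divergences hP := by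
    intro x
    rw [deRhamClass, Submodule.mkQ_apply, Submodule.Quotient.mk_eq_zero]
    change x.1 ∈ exactForms A (ComplementRing P) (n + 1) ↔ _
    constructor
    · rintro ⟨η, hη, h⟩
      rw [← h]
      exact formCoeff_extD_mem hP hd hη
    · intro h
      obtain ⟨η, hη, h⟩ := exists_formCoeff_extD_eq hP hd h
      exact ⟨η, hη, eq_of_formCoeff_eq hP hd (extD_mem A _ _ _ hη) x.2.1 h⟩
  have hcomb : ∀ c : ι →₀ A, formCoeff P d (Finsupp.linearCombination A b c).1 =
      Finsupp.linearCombination A (fun i => (∏ j, coord P j ^ w i j) * invP P ^ k i) c := by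
    intro c
    rw [Finsupp.linearCombination_apply, Finsupp.linearCombination_apply, Finsupp.sum, Finsupp.sum,
      AddSubmonoidClass.coe_finsetSum, map_sum]
    refine Finset.sum_congr rfl fun i _ => ?_
    rw [Submodule.coe_smul, map_smul, hωc]
  have hlin : LinearIndependent A fun i => deRhamClass A (ComplementRing P) (n + 1) (b i) := by
    rw [linearIndependent_iff]
    intro c hc
    apply hindep
    rw [← hcomb, ← hexact, ← hc, Finsupp.apply_linearCombination]
    rfl
  have hsp : ⊤ ≤ Submodule.span A
      (Set.range fun i => deRhamClass A (ComplementRing P) (n + 1) (b i)) := by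
    rintro y -
    obtain ⟨x, rfl⟩ := Submodule.mkQ_surjective _ y
    obtain ⟨c, hc⟩ := hspan _ (formCoeff_mem hP hd x.2.1)
    rw [← Finsupp.range_linearCombination]
    refine ⟨c, ?_⟩
    have : deRhamClass A (ComplementRing P) (n + 1) (x - Finsupp.linearCombination A b c) = 0 := by
      rw [hexact, AddSubgroupClass.coe_sub, map_sub, hcomb]
      exact hc
    rw [map_sub, sub_eq_zero, Finsupp.apply_linearCombination] at this
    exact this.symm
  refine ⟨b, fun i η => ⟨fun h => ?_, ?_⟩, Module.Basis.mk hlin hsp, fun i => ?_⟩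
  · refine eq_of_formCoeff_eq hP hd h.1 (hω i) ?_
    rw [hωc]
    exact formCoeff_eq_of_pullback hP hd h.2
  · rintro rfl
    refine ⟨hω i, ?_⟩
    rw [pullback_eq_formCoeff_smul hP hd (hω i), hωc]
    rfl
  · rw [Module.Basis.mk_apply]

end TopForms
end GriffithsDwork
end

noncomputable section
namespace GriffithsDwork
open MvPolynomial AlgDeRham

/-! ### Spanning: reduction of the pole order through the Jacobian ideal -/

section PoleReduction

variable {A : Type*} [CommRing A] {n : ℕ} (P : MvPolynomial (Fin (n + 2)) A) (d : ℕ)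

/-- The span of the monomials of degree `e` with all exponents less than `d - 1`, and of the
part of degree `e` of the Jacobian ideal of a polynomial of degree `d`. -/
def jacobianSpan (e : ℕ) : Submodule A (MvPolynomial (Fin (n + 2)) A) :=
  Submodule.span A ({x | ∃ v : Fin (n + 2) →₀ ℕ, v.degree = e ∧ (∀ i, v i + 1 < d) ∧
      x = monomial v 1} ∪
    {x | ∃ (i : Fin (n + 2)) (u : Fin (n + 2) →₀ ℕ), u.degree + (d - 1) = e ∧
      x = pderiv i P * monomial u 1})

variable {P d}

/-- From degree `(n+2)d` on, no monomial has all exponents below `d - 1`. The span then consists of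
multiples of the `∂_i P` only, and multiplication by a variable preserves these. -/
theorem monomial_mem_jacobianSpan_of_le (hd : 1 ≤ d)
    (h : ∀ v : Fin (n + 2) →₀ ℕ, v.degree ≤ (n + 2) * d →
      monomial v 1 ∈ jacobianSpan P d v.degree) (v : Fin (n + 2) →₀ ℕ) :
    monomial v 1 ∈ jacobianSpan P d v.degree := by
  obtain ⟨e, he⟩ : ∃ e, v.degree ≤ (n + 2) * d + e := ⟨v.degree, by omega⟩
  induction e generalizing v with
  | zero => exact h v he
  | succ e ih =>
    rcases Nat.lt_or_ge ((n + 2) * d + e) v.degree with hlt | hge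
    swap
    · exact ih v hge
    have hdeg : v.degree = (n + 2) * d + e + 1 := by omega
    obtain ⟨j, hj⟩ : ∃ j, v j ≠ 0 := by
      by_contra! hv
      have : v = 0 := Finsupp.ext hv
      rw [this, map_zero] at hdeg
      omega
    obtain ⟨u, rfl⟩ : ∃ u, v = u + Finsupp.single j 1 :=
      ⟨v - Finsupp.single j 1, (tsub_add_cancel_of_le (by
        rw [Finsupp.single_le_iff]; omega)).symm⟩
    rw [map_add, Finsupp.degree_single] at hdeg ⊢
    have hu := ih u (by omega)
    have hmul : monomial (u + Finsupp.single j 1) (1 : A) = monomial u 1 * X j := by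
      rw [X, monomial_mul, one_mul]
    rw [hmul]
    have hlarge : (n + 2) * d ≤ u.degree := by omega
    clear hmul hdeg hj he hlt
    generalize u.degree = e' at hlarge hu
    generalize monomial u (1 : A) = x at hu
    induction hu using Submodule.span_induction with
    | zero => rw [zero_mul]; exact zero_mem _
    | add x y _ _ hx hy => rw [add_mul]; exact add_mem hx hy
    | smul a x _ hx => rw [smul_mul_assoc]; exact Submodule.smul_mem _ _ hx
    | mem x hx =>
      rcases hx with ⟨v, hv, hvs, rfl⟩ | ⟨i, u, hu, rfl⟩
      · exfalso
        have : v.degree ≤ ∑ _i : Fin (n + 2), (d - 1) := by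
          rw [Finsupp.degree_eq_sum]
          exact Finset.sum_le_sum fun i _ => by have := hvs i; omega
        simp only [Finset.sum_const, Finset.card_univ, Fintype.card_fin, smul_eq_mul] at this
        have h2 : (n + 2) * (d - 1) < (n + 2) * d := by
          apply Nat.mul_lt_mul_of_pos_left <;> omega
        omega
      · refine Submodule.subset_span (Or.inr ⟨i, u + Finsupp.single j 1, ?_, ?_⟩)
        · rw [map_add, Finsupp.degree_single]; omega
        · rw [mul_assoc, X, monomial_mul, one_mul]

theorem toCone_monomial (w : Fin (n + 2) →₀ ℕ) :
    toCone P (monomial w 1) = ∏ j, coord P j ^ w j := by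
  rw [monomial_eq, C_1, one_mul, Finsupp.prod_fintype _ _ (by simp), map_prod]
  simp only [map_pow]; rfl

variable [Algebra ℚ A] (hP : P.IsHomogeneous d)

/-- Induction on the pole order. A small monomial is already a basis element. Otherwise `k x^u ∂_i
P/P^{k+1} = ∂_i(x^u)/P^k - ∂_i(x^u/P^k)`, where the first term has a lower pole and the second is a
divergence. -/
theorem div_mem_span_sup_divergences (hd : 1 ≤ d)
    (hJ : ∀ v : Fin (n + 2) →₀ ℕ, monomial v 1 ∈ jacobianSpan P d v.degree) (k : ℕ)
    (w : Fin (n + 2) →₀ ℕ) (hw : w.degree + (n + 2) = k * d) :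
    toCone P (monomial w 1) * invP P ^ k ∈
      Submodule.span A (Set.range fun i : PoleIndex n d =>
        (∏ j, coord P j ^ i.1.1 j) * invP P ^ i.1.2) ⊔ divergences hP := by
  induction k generalizing w with
  | zero => omega
  | succ k ih =>
    have hJw := hJ w
    generalize monomial w (1 : A) = x at hJw
    generalize w.degree = e at hw hJw
    induction hJw using Submodule.span_induction with
    | zero => rw [map_zero, zero_mul]; exact zero_mem _
    | add x y _ _ hx hy => rw [map_add, add_mul]; exact add_mem hx hy
    | smul a x _ hx => rw [map_smul, smul_mul_assoc]; exact Submodule.smul_mem _ _ hx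
    | mem x hx =>
      rcases hx with ⟨v, hv, hvs, rfl⟩ | ⟨i, u, hu, rfl⟩
      · refine Submodule.mem_sup_left (Submodule.subset_span ⟨⟨⟨v, k + 1⟩, hvs, ?_⟩, ?_⟩)
        · rw [Finsupp.degree_eq_sum] at hv
          change ∑ i, v i + n + 2 = (k + 1) * d
          omega
        · rw [toCone_monomial]
      -- A multiple of `∂_i P` has degree at least `d - 1`, too large for a simple pole. So the
      -- division by `k` below is legitimate.
      · have hk : k ≠ 0 := by rintro rfl; omega
        have hdiv : toCone P (monomial u 1) * invP P ^ k ∈ coneDeg hP (-(n + 1)) := by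
          refine div_mem_coneDeg hP (isHomogeneous_monomial _ rfl) ?_
          have h1 : u.degree + (d - 1) + (n + 2) = (k + 1) * d := by rw [hu, hw]
          zify [hd] at h1
          linarith
        have h1 := conePartial_mem_divergences hP hdiv i
        rw [conePartial_div] at h1
        have h2 : toCone P (pderiv i (monomial u 1)) * invP P ^ k ∈
            Submodule.span A (Set.range fun i : PoleIndex n d =>
              (∏ j, coord P j ^ i.1.1 j) * invP P ^ i.1.2) ⊔ divergences hP := by
          rw [pderiv_monomial]
          rcases Nat.eq_zero_or_pos (u i) with h0 | h0
          · rw [h0, Nat.cast_zero, mul_zero, map_zero, map_zero, zero_mul]; exact zero_mem _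
          · have h3 : monomial (u - Finsupp.single i 1) (1 * (u i : A)) =
                (u i : A) • monomial (u - Finsupp.single i 1) 1 := by
              rw [smul_monomial, smul_eq_mul, mul_comm]
            rw [h3, map_smul, smul_mul_assoc]
            refine Submodule.smul_mem _ _ (ih _ ?_)
            have h4 : (u - Finsupp.single i 1).degree + 1 = u.degree := by
              conv_rhs => rw [← tsub_add_cancel_of_le (Finsupp.single_le_iff.2 h0 :
                Finsupp.single i 1 ≤ u), map_add, Finsupp.degree_single]
            rw [add_mul, one_mul] at hw
            omega
        have h5 : toCone P (pderiv i P * monomial u 1) * invP P ^ (k + 1) =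
            algebraMap A (ConeRing P) (algebraMap ℚ A (k : ℚ)⁻¹) *
              (toCone P (pderiv i (monomial u 1)) * invP P ^ k -
              toCone P (pderiv i (monomial u 1) * P - (k : MvPolynomial (Fin (n + 2)) A) *
                (monomial u 1 * pderiv i P)) * invP P ^ (k + 1)) := by
          have h6 := invDegree_mul P k (Nat.one_le_iff_ne_zero.2 hk)
          have h7 := toCone_mul_invP P
          simp only [map_sub, map_mul, map_natCast]
          linear_combination -(toCone P (pderiv i P) * toCone P (monomial u 1) * invP P ^ (k + 1)) *
            h6 + algebraMap A (ConeRing P) (algebraMap ℚ A (k : ℚ)⁻¹) *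
              toCone P (pderiv i (monomial u 1)) * invP P ^ k * h7
        rw [h5, ← Algebra.smul_def]
        exact Submodule.smul_mem _ _ (sub_mem h2 (Submodule.mem_sup_right h1))

theorem exists_sub_mem_divergences (hd : 1 ≤ d)
    (hJ : ∀ v : Fin (n + 2) →₀ ℕ, monomial v 1 ∈ jacobianSpan P d v.degree) {z : ConeRing P}
    (hz : z ∈ coneDeg hP (-(n + 2))) : ∃ c : PoleIndex n d →₀ A,
      z - Finsupp.linearCombination A (fun i : PoleIndex n d =>
        (∏ j, coord P j ^ i.1.1 j) * invP P ^ i.1.2) c ∈ divergences hP := by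
  obtain ⟨Q, e, k, hQ, he, rfl⟩ := exists_of_mem_coneDeg hP hd hz
  have he' : e + (n + 2) = k * d := by zify; linarith
  have h : toCone P Q * invP P ^ k ∈
      Submodule.span A (Set.range fun i : PoleIndex n d =>
        (∏ j, coord P j ^ i.1.1 j) * invP P ^ i.1.2) ⊔ divergences hP := by
    rw [Q.as_sum, map_sum, Finset.sum_mul]
    refine sum_mem fun w hw => ?_
    have h3 : monomial w (coeff w Q) = coeff w Q • monomial w 1 := by
      rw [smul_monomial, smul_eq_mul, mul_one]
    rw [h3, map_smul, smul_mul_assoc]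
    refine Submodule.smul_mem _ _ (div_mem_span_sup_divergences hP hd hJ k w ?_)
    have h4 := hQ (mem_support_iff.1 hw)
    have h5 : w.degree = e := by rwa [Finsupp.degree_eq_weight_one]
    omega
  obtain ⟨y, hy, t, ht, hyt⟩ := Submodule.mem_sup.1 h
  obtain ⟨c, rfl⟩ := (Finsupp.mem_span_range_iff_exists_finsupp).1 hy
  exact ⟨c, by rw [← hyt, Finsupp.linearCombination_apply]; simpa using ht⟩

end PoleReduction
end GriffithsDwork
end

noncomputable section
namespace GriffithsDwork
open MvPolynomial AlgDeRham

/-! ### Algebraic period functionals of the Fermat hypersurface -/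

section FermatFunctional

/-- The Gamma-like factors of the period functionals of the Fermat hypersurface. -/
def fermatFactor (d r u : ℕ) : ℚ :=
  -- For `u ≡ r` modulo `d` this is `Γ((u+1)/d)/Γ((r+1)/d)`. The congruence selects one character of
  -- the diagonal symmetries.
  if u % d = r then ∏ j ∈ Finset.range (u / d), (((r : ℚ) + 1) / d + j) else 0

theorem fermatFactor_add (d r u : ℕ) (hd : 1 ≤ d) :
    fermatFactor d r (u + d) = ((u : ℚ) + 1) / d * fermatFactor d r u := by
  rw [fermatFactor, fermatFactor, Nat.add_mod_right, Nat.add_div_right _ hd]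
  split_ifs with h
  · have h1 : (u : ℚ) = d * (u / d : ℕ) + r := by
      rw [← h]; exact_mod_cast (Nat.div_add_mod u d).symm
    have h2 : (d : ℚ) ≠ 0 := by positivity
    rw [Finset.prod_range_succ, mul_comm]
    congr 1
    rw [h1]
    field_simp
    ring
  · rw [mul_zero]

/-- This is where the bound on the exponents enters: the residue `d - 1` is that of `∂_i F`, and it
must not contribute. -/
theorem fermatFactor_pred (d r : ℕ) (hr : r + 1 < d) : fermatFactor d r (d - 1) = 0 := by
  rw [fermatFactor, if_neg]
  rw [Nat.mod_eq_of_lt (by omega)]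
  omega

theorem fermatFactor_of_lt (d r u : ℕ) (hu : u < d) :
    fermatFactor d r u = if u = r then 1 else 0 := by
  rw [fermatFactor, Nat.mod_eq_of_lt hu, Nat.div_eq_of_lt hu, Finset.prod_range_zero]

variable {n : ℕ}

/-- The value of the period functional on `x ^ u / F ^ k`. -/
def fermatPeriod (d : ℕ) (w : Fin (n + 2) → ℕ) (k : ℕ) (u : Fin (n + 2) →₀ ℕ) : ℚ :=
  -- The factorial is `Γ(k)`, from `F^{-k} Γ(k) = ∫ t^{k-1} e^{-tF} dt`.
  if u.degree + (n + 2) = k * d then (∏ i, fermatFactor d (w i) (u i)) / (k - 1).factorial else 0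

theorem fermatPeriod_add (d : ℕ) (hd : 1 ≤ d) (w : Fin (n + 2) → ℕ) (k : ℕ)
    (u : Fin (n + 2) →₀ ℕ) (i : Fin (n + 2)) :
    fermatPeriod d w (k + 1) (u + Finsupp.single i d) =
      ((u i : ℚ) + 1) / (k * d) * fermatPeriod d w k u := by
  rw [fermatPeriod, fermatPeriod, map_add, Finsupp.degree_single]
  have h : u.degree + d + (n + 2) = (k + 1) * d ↔ u.degree + (n + 2) = k * d := by
    rw [add_mul]; omega
  simp only [h]
  split_ifs with h1
  · rcases k with _ | k
    · omega
    have h2 : ∏ j, fermatFactor d (w j) ((u + Finsupp.single i d) j) =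
        ((u i : ℚ) + 1) / d * ∏ j, fermatFactor d (w j) (u j) := by
      rw [← Finset.mul_prod_erase _ _ (Finset.mem_univ i),
        ← Finset.mul_prod_erase Finset.univ (fun j => fermatFactor d (w j) (u j))
          (Finset.mem_univ i)]
      rw [Finsupp.add_apply, Finsupp.single_eq_same, fermatFactor_add d _ _ hd, mul_assoc]
      congr 2
      refine Finset.prod_congr rfl fun j hj => ?_
      rw [Finsupp.add_apply, Finsupp.single_eq_of_ne (Finset.ne_of_mem_erase hj), add_zero]
    rw [h2, Nat.add_sub_cancel, Nat.add_sub_cancel, Nat.factorial_succ]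
    have h3 : (d : ℚ) ≠ 0 := by positivity
    have h4 : ((k.factorial : ℕ) : ℚ) ≠ 0 := by positivity
    push_cast
    field_simp
  · rw [mul_zero]

theorem fermatPeriod_self (d : ℕ) (w u : Fin (n + 2) → ℕ) (k : ℕ) (hu : ∀ i, u i < d)
    (hk : ∑ i, u i + n + 2 = k * d) :
    fermatPeriod d w k (Finsupp.equivFunOnFinite.symm u) =
      if u = w then ((k - 1).factorial : ℚ)⁻¹ else 0 := by
  have h1 : (Finsupp.equivFunOnFinite.symm u).degree + (n + 2) = k * d := by
    rw [Finsupp.degree_eq_sum]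
    change ∑ i, u i + (n + 2) = _
    omega
  rw [fermatPeriod, if_pos h1]
  change (∏ i, fermatFactor d (w i) (u i)) / _ = _
  simp only [fermatFactor_of_lt d _ _ (hu _)]
  split_ifs with h
  · simp [h]
  · obtain ⟨i, hi⟩ := Function.ne_iff.1 h
    rw [Finset.prod_eq_zero (Finset.mem_univ i) (if_neg hi), zero_div]

variable (B : Type*) [CommRing B]

/-- The Fermat polynomial. -/
def fermatPoly (n d : ℕ) : MvPolynomial (Fin (n + 2)) B := ∑ i, X i ^ d

theorem monomial_mul_X_pow (u : Fin (n + 2) →₀ ℕ) (b : B) (i : Fin (n + 2)) (e : ℕ) :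
    X i ^ e * monomial u b = monomial (u + Finsupp.single i e) b := by
  rw [X_pow_eq_monomial, monomial_mul, one_mul, add_comm u]

variable [Algebra ℚ B] (d : ℕ) (w : Fin (n + 2) → ℕ)

/-- The period functional on forms with a pole of order at most `k`. -/
def fermatPeriodPoly (k : ℕ) : MvPolynomial (Fin (n + 2)) B →ₗ[B] B :=
  (basisMonomials (Fin (n + 2)) B).constr B fun u => algebraMap ℚ B (fermatPeriod d w k u)

theorem fermatPeriodPoly_monomial (k : ℕ) (u : Fin (n + 2) →₀ ℕ) (b : B) :
    fermatPeriodPoly B d w k (monomial u b) = b * algebraMap ℚ B (fermatPeriod d w k u) := by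
  have h : monomial u b = b • basisMonomials (Fin (n + 2)) B u := by
    rw [coe_basisMonomials, smul_monomial, smul_eq_mul, mul_one]
  rw [h, map_smul, fermatPeriodPoly, Module.Basis.constr_basis, smul_eq_mul]

/-- On a monomial of the right degree, multiplication by `F` produces the factors `(u_i + 1)/(k d)`,
whose sum is `1`. In other degrees both sides vanish. -/
theorem fermatPeriodPoly_mul (hd : 1 ≤ d) (k : ℕ) (Q : MvPolynomial (Fin (n + 2)) B) :
    fermatPeriodPoly B d w (k + 1) (fermatPoly B n d * Q) = fermatPeriodPoly B d w k Q := by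
  induction Q using MvPolynomial.induction_on' with
  | add p q hp hq => rw [mul_add, map_add, map_add, hp, hq]
  | monomial u b =>
    rw [fermatPoly, Finset.sum_mul, map_sum]
    simp only [monomial_mul_X_pow, fermatPeriodPoly_monomial, fermatPeriod_add d hd]
    rw [← Finset.mul_sum, ← map_sum, ← Finset.sum_mul]
    congr 2
    rw [← Finset.sum_div, Finset.sum_add_distrib]
    by_cases h : u.degree + (n + 2) = k * d
    · have h1 : ((∑ i, (u i : ℚ)) + ∑ _i : Fin (n + 2), (1 : ℚ)) = k * d := by
        rw [Finsupp.degree_eq_sum] at h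
        simp only [Finset.sum_const, Finset.card_univ, Fintype.card_fin]
        simp only [nsmul_eq_mul, mul_one]
        exact_mod_cast h
      have h2 : (k * d : ℚ) ≠ 0 := by
        have : 0 < k * d := by omega
        exact_mod_cast this.ne'
      rw [h1, div_self h2, one_mul]
    · rw [fermatPeriod, if_neg h, mul_zero]

theorem fermatPeriodPoly_pow_mul (hd : 1 ≤ d) (k l : ℕ) (Q : MvPolynomial (Fin (n + 2)) B) :
    fermatPeriodPoly B d w (k + l) (fermatPoly B n d ^ l * Q) = fermatPeriodPoly B d w k Q := by
  induction l with
  | zero => simp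
  | succ l ih => rw [← add_assoc, pow_succ', mul_assoc, fermatPeriodPoly_mul B d w hd, ih]

variable {B d}

/-- Equal fractions have equal numerators after multiplication by suitable powers of `F`, which the
functionals do not see. -/
theorem fermatPeriodPoly_eq (hd : 1 ≤ d) {k l : ℕ} {Q R : MvPolynomial (Fin (n + 2)) B}
    (h : toCone (fermatPoly B n d) Q * invP (fermatPoly B n d) ^ k =
      toCone (fermatPoly B n d) R * invP (fermatPoly B n d) ^ l) :
    fermatPeriodPoly B d w k Q = fermatPeriodPoly B d w l R := by
  set F := fermatPoly B n d with hF
  have h1 : toCone F (F ^ l * Q) = toCone F (F ^ k * R) := by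
    rw [map_mul, map_mul, map_pow, map_pow]
    have hk := invP_pow_mul F k
    have hl := invP_pow_mul F l
    linear_combination toCone F F ^ k * toCone F F ^ l * h - toCone F F ^ l * toCone F Q * hk +
      toCone F F ^ k * toCone F R * hl
  obtain ⟨⟨_, c, rfl⟩, hc⟩ := (IsLocalization.eq_iff_exists (Submonoid.powers F) (ConeRing F)).1 h1
  change F ^ c * (F ^ l * Q) = F ^ c * (F ^ k * R) at hc
  have h2 := fermatPeriodPoly_pow_mul B d w hd k (c + l) Q
  have h3 := fermatPeriodPoly_pow_mul B d w hd l (c + k) R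
  rw [← h2, ← h3, ← hF, pow_add, pow_add, mul_assoc, mul_assoc, hc]
  congr 2
  omega

/-- The period functional on the cone ring of the Fermat hypersurface. -/
def fermatFunctional (hd : 1 ≤ d) : ConeRing (fermatPoly B n d) →ₗ[B] B :=
  have key : ∀ z, ∃ b, ∀ (Q : MvPolynomial (Fin (n + 2)) B) (k : ℕ),
      z = toCone (fermatPoly B n d) Q * invP (fermatPoly B n d) ^ k →
        fermatPeriodPoly B d w k Q = b := by
    intro z
    obtain ⟨R, l, h⟩ := exists_eq_mul_invP (fermatPoly B n d) z
    exact ⟨_, fun Q k h' => fermatPeriodPoly_eq w hd (h'.symm.trans h)⟩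
  { toFun := fun z => (key z).choose
    map_add' := by
      intro y z
      obtain ⟨R, l, h⟩ := exists_eq_mul_invP (fermatPoly B n d) y
      obtain ⟨Q, k, h'⟩ := exists_eq_mul_invP (fermatPoly B n d) z
      have hy := (key y).choose_spec R l h
      have hz := (key z).choose_spec Q k h'
      have hyz := (key (y + z)).choose_spec
        (fermatPoly B n d ^ k * R + fermatPoly B n d ^ l * Q) (k + l) (by
          rw [h, h', map_add, map_mul, map_mul, map_pow, map_pow]
          have hk := invP_pow_mul (fermatPoly B n d) k
          have hl := invP_pow_mul (fermatPoly B n d) l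
          rw [pow_add]
          linear_combination -(toCone (fermatPoly B n d) R * invP (fermatPoly B n d) ^ l) * hk -
            toCone (fermatPoly B n d) Q * invP (fermatPoly B n d) ^ k * hl)
      rw [← hy, ← hz, ← hyz, map_add, fermatPeriodPoly_pow_mul B d w hd, add_comm k l,
        fermatPeriodPoly_pow_mul B d w hd]
    map_smul' := by
      intro b z
      obtain ⟨Q, k, h'⟩ := exists_eq_mul_invP (fermatPoly B n d) z
      have hz := (key z).choose_spec Q k h'
      have hbz := (key (b • z)).choose_spec (b • Q) k (by rw [h', map_smul, smul_mul_assoc])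
      rw [← hz, ← hbz, map_smul, RingHom.id_apply] }

theorem fermatFunctional_div (hd : 1 ≤ d) (Q : MvPolynomial (Fin (n + 2)) B) (k : ℕ) :
    fermatFunctional w hd (toCone (fermatPoly B n d) Q * invP (fermatPoly B n d) ^ k) =
      fermatPeriodPoly B d w k Q := by
  have key : ∀ z, ∃ b, ∀ (Q : MvPolynomial (Fin (n + 2)) B) (k : ℕ),
      z = toCone (fermatPoly B n d) Q * invP (fermatPoly B n d) ^ k →
        fermatPeriodPoly B d w k Q = b := by
    intro z
    obtain ⟨R, l, h⟩ := exists_eq_mul_invP (fermatPoly B n d) z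
    exact ⟨_, fun Q k h' => fermatPeriodPoly_eq w hd (h'.symm.trans h)⟩
  exact ((key _).choose_spec Q k rfl).symm

/-- Integration by parts: on `∂_i(x^u/F^k)` the two terms are values at the exponents `u_i - 1` and
`u_i + d - 1`, related by the functional equation of the Gamma-like factors. -/
theorem fermatFunctional_conePartial (hd : 1 ≤ d) (hw : ∀ i, w i + 1 < d) (i : Fin (n + 2))
    (z : ConeRing (fermatPoly B n d)) :
    fermatFunctional w hd (conePartial (fermatPoly B n d) i z) = 0 := by
  obtain ⟨Q, k, rfl⟩ := exists_eq_mul_invP (fermatPoly B n d) z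
  have hF : pderiv i (fermatPoly B n d) = (d : MvPolynomial (Fin (n + 2)) B) * X i ^ (d - 1) := by
    rw [fermatPoly, map_sum, Finset.sum_eq_single i]
    · rw [pderiv_pow, pderiv_X_self, mul_one]
    · intro j _ hj
      rw [pderiv_pow, pderiv_X_of_ne hj, mul_zero]
    · intro h; exact absurd (Finset.mem_univ i) h
  rw [conePartial_div, fermatFunctional_div, hF, map_sub, mul_comm (pderiv i Q),
    fermatPeriodPoly_mul B d w hd, sub_eq_zero]
  have hnat : ∀ (c l : ℕ) (R : MvPolynomial (Fin (n + 2)) B),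
      fermatPeriodPoly B d w l ((c : MvPolynomial (Fin (n + 2)) B) * R) =
        c * fermatPeriodPoly B d w l R := by
    intro c l R
    rw [← nsmul_eq_mul, map_nsmul, nsmul_eq_mul]
  rw [hnat, mul_left_comm, hnat, mul_comm Q]
  induction Q using MvPolynomial.induction_on' with
  | add p q hp hq => simp only [map_add, mul_add, hp, hq]
  | monomial u b =>
    rw [pderiv_monomial, monomial_mul_X_pow, fermatPeriodPoly_monomial, fermatPeriodPoly_monomial]
    have key : (u i : ℚ) * fermatPeriod d w k (u - Finsupp.single i 1) =
        k * d * fermatPeriod d w (k + 1) (u + Finsupp.single i (d - 1)) := by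
      rcases Nat.eq_zero_or_pos (u i) with h0 | h0
      -- The exponent of `x_i` on the right is `d - 1`, where the factor is zero.
      · rw [h0, Nat.cast_zero, zero_mul, fermatPeriod]
        split_ifs with h
        · rw [Finset.prod_eq_zero (Finset.mem_univ i), zero_div, mul_zero]
          rw [Finsupp.add_apply, h0, Finsupp.single_eq_same, zero_add, fermatFactor_pred d _ (hw i)]
        · rw [mul_zero]
      · have h1 : u + Finsupp.single i (d - 1) =
            (u - Finsupp.single i 1) + Finsupp.single i d := by
          conv_lhs => rw [← tsub_add_cancel_of_le (Finsupp.single_le_iff.2 h0 :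
                Finsupp.single i 1 ≤ u), add_assoc, ← Finsupp.single_add]
          rw [Nat.add_sub_cancel' hd]
        rw [h1, fermatPeriod_add d hd]
        rcases Nat.eq_zero_or_pos k with hk | hk
        · rw [hk, fermatPeriod, if_neg (by omega)]; simp
        · have h2 : ((u - Finsupp.single i 1 : Fin (n + 2) →₀ ℕ) i : ℚ) + 1 = u i := by
            rw [Finsupp.tsub_apply, Finsupp.single_eq_same]
            exact_mod_cast Nat.sub_add_cancel h0
          rw [h2]
          field_simp
    have h3 := congrArg (algebraMap ℚ B) key
    simp only [map_mul, map_natCast] at h3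
    linear_combination b * h3

end FermatFunctional

/-! ### Independence on infinitesimal neighbourhoods of the Fermat hypersurface -/

section Independence

variable {A B : Type*} [CommRing A] [CommRing B] {n d : ℕ}
  {P : MvPolynomial (Fin (n + 2)) A} (ψ : A →+* B) (𝔪 : Ideal B)

theorem toCone_mem_map_of_coeff_mem {F G : MvPolynomial (Fin (n + 2)) B} (h : ∀ u, coeff u G ∈ 𝔪) :
    toCone F G ∈ 𝔪.map (algebraMap B (ConeRing F)) := by
  rw [G.as_sum, map_sum]
  refine sum_mem fun u _ => ?_
  rw [← mul_one (coeff u G), ← smul_eq_mul, ← smul_monomial, map_smul, Algebra.smul_def]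
  exact Ideal.mul_mem_right _ _ (Ideal.mem_map_of_mem _ (h u))

variable {𝔪} in
-- A unit plus a nilpotent is a unit.
theorem isUnit_toCone_map {N : ℕ} (hN : 𝔪 ^ N = ⊥)
    (hP : ∀ u, coeff u (map ψ P - fermatPoly B n d) ∈ 𝔪) :
    IsUnit (toCone (fermatPoly B n d) (map ψ P)) := by
  have h1 := toCone_mem_map_of_coeff_mem 𝔪 (F := fermatPoly B n d) hP
  have h2 : IsNilpotent (toCone (fermatPoly B n d) (map ψ P - fermatPoly B n d)) := by
    refine ⟨N, ?_⟩
    have := Ideal.pow_mem_pow h1 N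
    rwa [← Ideal.map_pow, hN, Ideal.map_bot, Ideal.mem_bot] at this
  have h3 := h2.isUnit_add_left_of_commute (isUnit_toCone (fermatPoly B n d)) (Commute.all _ _)
  rwa [map_sub, add_sub_cancel] at h3

variable {ψ 𝔪} in
/-- Specialization of the cone ring to an infinitesimal neighbourhood of the Fermat hypersurface. -/
def coneSpecialize (hu : IsUnit (toCone (fermatPoly B n d) (map ψ P))) :
    ConeRing P →+* ConeRing (fermatPoly B n d) :=
  IsLocalization.Away.lift P (g := (toCone (fermatPoly B n d)).toRingHom.comp (map ψ)) hu

variable {ψ}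

theorem coneSpecialize_toCone (hu : IsUnit (toCone (fermatPoly B n d) (map ψ P)))
    (Q : MvPolynomial (Fin (n + 2)) A) :
    coneSpecialize hu (toCone P Q) = toCone (fermatPoly B n d) (map ψ Q) :=
  IsLocalization.Away.lift_eq P (g := (toCone (fermatPoly B n d)).toRingHom.comp (map ψ)) hu Q

/-- True on polynomials, hence on fractions by the Leibniz rule. It makes divergences for `P` into
sums of partial derivatives for the Fermat polynomial, so no connection is needed to compare the
two. -/
theorem coneSpecialize_conePartial (hu : IsUnit (toCone (fermatPoly B n d) (map ψ P)))
    (i : Fin (n + 2)) (z : ConeRing P) :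
    coneSpecialize hu (conePartial P i z) =
      conePartial (fermatPoly B n d) i (coneSpecialize hu z) := by
  obtain ⟨Q, k, h⟩ := exists_eq_mul_invP P z
  have h1 : z * toCone P (P ^ k) = toCone P Q := by
    rw [h, mul_assoc, map_pow, mul_comm (invP P ^ k), invP_pow_mul, mul_one]
  have hpoly : ∀ R : MvPolynomial (Fin (n + 2)) A, coneSpecialize hu (conePartial P i (toCone P R)) =
      conePartial (fermatPoly B n d) i (coneSpecialize hu (toCone P R)) := by
    intro R
    rw [conePartial_toCone, coneSpecialize_toCone, coneSpecialize_toCone, conePartial_toCone,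
      pderiv_map]
  have h2 := congrArg (fun y => coneSpecialize hu (conePartial P i y)) h1
  have h3 := congrArg (fun y => conePartial (fermatPoly B n d) i (coneSpecialize hu y)) h1
  simp only [Derivation.leibniz, map_add, map_mul, smul_eq_mul, hpoly] at h2 h3
  have h4 : IsUnit (coneSpecialize hu (toCone P (P ^ k))) := by
    rw [coneSpecialize_toCone, map_pow, map_pow]; exact hu.pow k
  refine h4.mul_left_cancel ?_
  linear_combination h2 - h3

theorem fermatFunctional_mem [Algebra ℚ B] (hd : 1 ≤ d) (w : Fin (n + 2) → ℕ) {z : ConeRing (fermatPoly B n d)}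
    (hz : z ∈ 𝔪.map (algebraMap B (ConeRing (fermatPoly B n d)))) :
    fermatFunctional w hd z ∈ 𝔪 := by
  -- The functional is linear only over `B`, so multiples by elements of the cone ring are carried
  -- through the induction.
  suffices h : ∀ y, fermatFunctional w hd (y * z) ∈ 𝔪 by simpa using h 1
  induction hz using Submodule.span_induction with
  | zero => intro y; simp
  | add x x' _ _ h h' => intro y; rw [mul_add, map_add]; exact add_mem (h y) (h' y)
  | smul a x _ h => intro y; rw [smul_eq_mul, ← mul_assoc]; exact h _
  | mem x hx =>
    intro y
    obtain ⟨b, hb, rfl⟩ := hx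
    rw [mul_comm, ← Algebra.smul_def, map_smul, smul_eq_mul]
    exact Ideal.mul_mem_right _ _ hb

theorem coneSpecialize_div_sub_mem (hu : IsUnit (toCone (fermatPoly B n d) (map ψ P)))
    (hP : ∀ u, coeff u (map ψ P - fermatPoly B n d) ∈ 𝔪) (w : Fin (n + 2) →₀ ℕ) (k : ℕ) :
    coneSpecialize hu (toCone P (monomial w 1) * invP P ^ k) -
      toCone (fermatPoly B n d) (monomial w 1) * invP (fermatPoly B n d) ^ k ∈
        𝔪.map (algebraMap B (ConeRing (fermatPoly B n d))) := by
  set F := fermatPoly B n d with hF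
  have h1 := toCone_mem_map_of_coeff_mem 𝔪 (F := F) hP
  have h2 : coneSpecialize hu (invP P) - invP F ∈ 𝔪.map (algebraMap B (ConeRing F)) := by
    have h3 : coneSpecialize hu (toCone P P) * coneSpecialize hu (invP P) = 1 := by
      rw [← map_mul, toCone_mul_invP, map_one]
    rw [coneSpecialize_toCone] at h3
    have h4 := toCone_mul_invP F
    have h5 : coneSpecialize hu (invP P) - invP F =
        -(coneSpecialize hu (invP P) * invP F) * toCone F (map ψ P - F) := by
      rw [map_sub]
      linear_combination invP F * h3 - coneSpecialize hu (invP P) * h4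
    rw [h5]
    exact Ideal.mul_mem_left _ _ h1
  rw [← Ideal.Quotient.eq] at h2 ⊢
  rw [map_mul, map_mul, map_mul, coneSpecialize_toCone, map_monomial, map_one, map_pow, map_pow, h2,
    map_pow]

/-- Modulo `𝔪` the polynomial `P` becomes the Fermat polynomial, and there the pairing with
monomials of exponents below `d` is diagonal. -/
theorem fermatFunctional_coneSpecialize_sub_mem [Algebra ℚ B] (hd : 1 ≤ d)
    (hu : IsUnit (toCone (fermatPoly B n d) (map ψ P)))
    (hPψ : ∀ u, coeff u (map ψ P - fermatPoly B n d) ∈ 𝔪) (w u : Fin (n + 2) → ℕ) (l : ℕ)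
    (hlt : ∀ i, u i < d) (hl : ∑ i, u i + n + 2 = l * d) :
    fermatFunctional w hd (coneSpecialize hu ((∏ j, coord P j ^ u j) * invP P ^ l)) -
      algebraMap ℚ B (if u = w then ((l - 1).factorial : ℚ)⁻¹ else 0) ∈ 𝔪 := by
  have hval := fermatFunctional_div w hd
    (monomial (Finsupp.equivFunOnFinite.symm u) (1 : B)) l
  rw [fermatPeriodPoly_monomial, one_mul, fermatPeriod_self d w u l hlt hl] at hval
  have hmon : toCone P (monomial (Finsupp.equivFunOnFinite.symm u) 1) =
    ∏ j, coord P j ^ u j := toCone_monomial _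
  have h1 := coneSpecialize_div_sub_mem 𝔪 hu hPψ (Finsupp.equivFunOnFinite.symm u) l
  rw [hmon] at h1
  have h3 := fermatFunctional_mem 𝔪 hd w h1
  rw [map_sub, hval] at h3
  exact h3

open scoped Classical in
/-- The functions `x ^ w / P ^ k` are independent modulo divergences on every infinitesimal
neighbourhood of the Fermat hypersurface. -/
theorem map_eq_zero_of_mem_divergences [Algebra ℚ B] (hd : 1 ≤ d) {N : ℕ} (hN : 𝔪 ^ N = ⊥)
    (hPψ : ∀ u, coeff u (map ψ P - fermatPoly B n d) ∈ 𝔪) (hP : P.IsHomogeneous d)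
    (c : PoleIndex n d →₀ A)
    (hc : Finsupp.linearCombination A (fun i : PoleIndex n d =>
        (∏ j, coord P j ^ i.1.1 j) * invP P ^ i.1.2) c ∈ divergences hP) (i : PoleIndex n d) :
    ψ (c i) = 0 := by
  have hu := isUnit_toCone_map ψ hN hPψ
  have hvanish : ∀ (w : Fin (n + 2) → ℕ), (∀ i, w i + 1 < d) → ∀ z ∈ divergences hP,
      fermatFunctional w hd (coneSpecialize hu z) = 0 := by
    intro w hw z hz
    induction hz using Submodule.iSup_induction' with
    | zero => simp
    | add x y _ _ hx hy => rw [map_add, map_add, hx, hy, add_zero]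
    | mem i x hx =>
      obtain ⟨y, _, rfl⟩ := hx
      change fermatFunctional w hd (coneSpecialize hu (conePartial P i y)) = 0
      rw [coneSpecialize_conePartial, fermatFunctional_conePartial w hd hw]
  have hsmul : ∀ (a : A) (z : ConeRing P),
      coneSpecialize hu (a • z) = ψ a • coneSpecialize hu z := by
    intro a z
    have h2 : toCone P (C a) = algebraMap A (ConeRing P) a := (toCone P).commutes a
    have h3 : toCone (fermatPoly B n d) (C (ψ a)) = algebraMap B _ (ψ a) :=
      (toCone (fermatPoly B n d)).commutes _
    rw [Algebra.smul_def, map_mul, ← h2, coneSpecialize_toCone, map_C, h3, ← Algebra.smul_def]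
  -- The pairing matrix is diagonal with unit entries modulo `𝔪`. So if all coefficients lie in
  -- `𝔪^r`, applying the functional of `i` to the relation puts the coefficient of `i` into
  -- `𝔪^(r+1)`.
  have hmain : ∀ r : ℕ, ∀ i, ψ (c i) ∈ 𝔪 ^ r := by
    intro r
    induction r with
    | zero => intro i; simp
    | succ r ih =>
      intro i
      have h1 := hvanish i.1.1 i.2.1 _ hc
      rw [Finsupp.linearCombination_apply, Finsupp.sum, map_sum, map_sum] at h1
      have h2 : ∀ j ∈ c.support, fermatFunctional i.1.1 hd (coneSpecialize hu (c j •
          ((∏ l, coord P l ^ j.1.1 l) * invP P ^ j.1.2))) - (if j = i then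
            ψ (c i) * algebraMap ℚ B ((i.1.2 - 1).factorial : ℚ)⁻¹ else 0) ∈ 𝔪 ^ (r + 1) := by
        intro j _
        have hjlt : ∀ l, j.1.1 l < d := fun l => (Nat.lt_succ_self _).trans (j.2.1 l)
        have h5 := Ideal.mul_mem_mul (ih j)
          (fermatFunctional_coneSpecialize_sub_mem 𝔪 hd hu hPψ i.1.1 j.1.1 j.1.2 hjlt j.2.2)
        rw [← pow_succ, mul_sub, ← smul_eq_mul, ← map_smul, ← hsmul] at h5
        have h6 : (if j = i then ψ (c i) * algebraMap ℚ B ((i.1.2 - 1).factorial : ℚ)⁻¹ else 0) =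
            ψ (c j) * algebraMap ℚ B (if j.1.1 = i.1.1 then ((j.1.2 - 1).factorial : ℚ)⁻¹ else 0) := by
          by_cases h : j = i
          · rw [h, if_pos rfl, if_pos rfl]
          · rw [if_neg h, if_neg, map_zero, mul_zero]
            intro h7
            -- The exponents determine the pole order.
            have h8 : j.1.2 * d = i.1.2 * d := by rw [← j.2.2, ← i.2.2, h7]
            exact h (Subtype.ext (Prod.ext h7 (Nat.eq_of_mul_eq_mul_right hd h8)))
        rw [h6]
        exact h5
      have h3 := sum_mem h2
      rw [Finset.sum_sub_distrib, h1, zero_sub, neg_mem_iff, Finset.sum_ite_eq'] at h3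
      have h4 : ψ (c i) * algebraMap ℚ B ((i.1.2 - 1).factorial : ℚ)⁻¹ ∈ 𝔪 ^ (r + 1) := by
        split_ifs at h3 with h
        · exact h3
        · rw [Finsupp.notMem_support_iff.1 h, map_zero, zero_mul]; exact zero_mem _
      have h5 := Ideal.mul_mem_right (algebraMap ℚ B ((i.1.2 - 1).factorial : ℚ)) _ h4
      rwa [mul_assoc, ← map_mul, inv_mul_cancel₀ (by positivity), map_one, mul_one] at h5
  have := hmain N i
  rwa [hN, Ideal.mem_bot] at this

end Independence
end GriffithsDwork
end

noncomputable section
namespace GriffithsDwork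
open MvPolynomial AlgDeRham

/-! ### A list of terms for the discriminant-like polynomial -/

section Code

/-- The `i`-th digit of `t` in base `b`. -/
def digit (b t i : ℕ) : ℕ := t / b ^ i % b

/-- The exponents of the monomials in the box are the numbers below this bound. -/
def boxSide (n d : ℕ) : ℕ := (n + 2) * d + 1

/-- The number of monomials in the box. -/
def boxCard (n d : ℕ) : ℕ := boxSide n d ^ (n + 2)

/-- The first variable whose exponent in the `a`-th monomial is at least `d - 1`, and `n + 2` if
there is none. -/
def pivot (n d a : ℕ) : ℕ :=
  (List.range (n + 2)).findIdx fun l => decide (d ≤ digit (boxSide n d) a l + 1)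

/-- The exponent of `x_l` in the quotient of the `c`-th monomial, multiplied by the `d`-th power of
the pivot variable, by the `a`-th monomial; too large if there is no quotient. -/
def quotExp (n d a c l : ℕ) : ℕ :=
  if digit (boxSide n d) a l ≤ digit (boxSide n d) c l + (if l = pivot n d a then d else 0) then
    digit (boxSide n d) c l + (if l = pivot n d a then d else 0) - digit (boxSide n d) a l
  else d + 1

/-- The integer factor of an entry of the Macaulay matrix. -/
def entryCoef (n d a c : ℕ) : ℕ :=
  if pivot n d a = n + 2 then (if a = c then 1 else 0) else quotExp n d a c (pivot n d a)

/-- The variables that occur in an entry of the Macaulay matrix. -/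
def entryVars (n d a c : ℕ) : List (List ℕ) :=
  if pivot n d a = n + 2 then [] else [(List.range (n + 2)).map (quotExp n d a c)]

/-- The number of pairs in the wrong order among the first `k` digits of `t`. -/
def inversions (b t k : ℕ) : ℕ :=
  ∑ i ∈ Finset.range k, ∑ j ∈ Finset.range k,
    if i < j ∧ digit b t j < digit b t i then 1 else 0

/-- The absolute value of the Vandermonde determinant of the first `k` digits of `t`. -/
def absVandermonde (b t k : ℕ) : ℕ :=
  ∏ i ∈ Finset.range k, ∏ j ∈ Finset.range k,
    if i < j then (digit b t j - digit b t i) + (digit b t i - digit b t j) else 1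

/-- The integer coefficient of the `t`-th term of the discriminant. -/
def termCoef (n d t : ℕ) : ℤ :=
  if inversions (boxCard n d) t (boxCard n d) % 2 = 1 then
    -((absVandermonde (boxCard n d) t (boxCard n d) *
      ∏ a ∈ Finset.range (boxCard n d), entryCoef n d a (digit (boxCard n d) t a) : ℕ) : ℤ)
  else
    ((absVandermonde (boxCard n d) t (boxCard n d) *
      ∏ a ∈ Finset.range (boxCard n d), entryCoef n d a (digit (boxCard n d) t a) : ℕ) : ℤ)

/-- The list of terms of the discriminant. -/
def discCode (n d : ℕ) : PolyCode :=
  (List.range (boxCard n d ^ boxCard n d)).map fun t =>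
    (termCoef n d t, (List.range (boxCard n d)).flatMap fun a =>
      entryVars n d a (digit (boxCard n d) t a))

/-- An entry of the Macaulay matrix of the generic polynomial. -/
def univEntry (n d a c : ℕ) : UnivRing n d :=
  C (entryCoef n d a c : ℤ) * ((entryVars n d a c).map (decodeVar n d)).prod

/-- The Macaulay matrix of the generic polynomial. -/
def univMatrix (n d : ℕ) : Matrix (Fin (boxCard n d)) (Fin (boxCard n d)) (UnivRing n d) :=
  Matrix.of fun a c => univEntry n d a c

/-- The sum of the two truncated differences is the absolute difference. The negative factors are
counted by the inversions. -/
theorem vandermonde_digits (b t k : ℕ) :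
    (-1) ^ inversions b t k * (absVandermonde b t k : ℤ) =
      (Matrix.vandermonde fun a : Fin k => (digit b t a : ℤ)).det := by
  rw [Matrix.det_vandermonde, inversions, absVandermonde, Finset.sum_range, Finset.prod_range,
    ← Finset.prod_pow_eq_pow_sum, Nat.cast_prod, ← Finset.prod_mul_distrib]
  refine Finset.prod_congr rfl fun i _ => ?_
  rw [Finset.sum_range, Finset.prod_range, ← Finset.prod_pow_eq_pow_sum, Nat.cast_prod,
    ← Finset.prod_mul_distrib, ← Finset.filter_lt_eq_Ioi, Finset.prod_filter]
  refine Finset.prod_congr rfl fun j _ => ?_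
  by_cases hij : i < j
  · have hij' : (i : ℕ) < j := hij
    by_cases h : digit b t j < digit b t i
    · simp only [hij, hij', h, and_self, if_true, pow_one]
      push_cast [h.le, Nat.sub_eq_zero_of_le h.le]
      ring
    · simp only [hij, hij', h, and_false, if_false, if_true, pow_zero]
      push_cast [not_lt.1 h, Nat.sub_eq_zero_of_le (not_lt.1 h)]
      ring
  · have hij' : ¬ (i : ℕ) < j := hij
    simp [hij, hij']

theorem termCoef_eq (n d t : ℕ) : termCoef n d t =
    (∏ a : Fin (boxCard n d), (entryCoef n d a (digit (boxCard n d) t a) : ℤ)) *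
      (Matrix.vandermonde fun a : Fin (boxCard n d) => (digit (boxCard n d) t a : ℤ)).det := by
  rw [← vandermonde_digits, termCoef, Finset.prod_range]
  split_ifs with h
  · rw [(Nat.odd_iff.2 h).neg_one_pow]; push_cast; ring
  · rw [(Nat.even_iff.2 (by omega)).neg_one_pow]; push_cast; ring

theorem prod_map_flatMap {α β M : Type*} [Monoid M] (l : List α) (g : α → List β) (h : β → M) :
    ((l.flatMap g).map h).prod = (l.map fun a => ((g a).map h).prod).prod := by
  induction l with
  | nil => simp
  | cons a l ih => simp [List.flatMap_cons, ih]

theorem prod_map_range {M : Type*} [CommMonoid M] (k : ℕ) (f : ℕ → M) :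
    ((List.range k).map f).prod = ∏ i : Fin k, f i := by
  rw [← Finset.prod_range]; rfl

/-- Multilinear expansion along the rows. The Vandermonde factor supplies the sign of `f` and
vanishes unless the values `v (f a)` are distinct, so the sum may run over all maps. -/
theorem det_mul_vandermonde {R : Type*} [CommRing R] {k : ℕ} (M : Matrix (Fin k) (Fin k) R)
    (v : Fin k → R) : (M * Matrix.vandermonde v).det =
      ∑ f : Fin k → Fin k, (∏ a, M a (f a)) * (Matrix.vandermonde fun a => v (f a)).det := by
  have h : (M * Matrix.vandermonde v) =
      Matrix.of (fun a => ∑ c, M a c • Matrix.vandermonde v c) := by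
    ext a e; simp [Matrix.mul_apply, Finset.sum_apply]
  rw [h]
  change Matrix.detRowAlternating.toMultilinearMap (fun a => ∑ c, M a c • Matrix.vandermonde v c)
    = _
  rw [MultilinearMap.map_sum]
  refine Finset.sum_congr rfl fun f _ => ?_
  rw [MultilinearMap.map_smul_univ]
  rfl

/-- The base `N` digits of `t < N^N` are the values of a self-map of the `N` indices, so the list
enumerates the sum in `det_mul_vandermonde`. -/
theorem decodePoly_discCode (n d : ℕ) : decodePoly n d (discCode n d) =
    (univMatrix n d).det *
      C (Matrix.vandermonde fun a : Fin (boxCard n d) => ((a : ℕ) : ℤ)).det := by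
  have hV : (C (Matrix.vandermonde fun a : Fin (boxCard n d) => ((a : ℕ) : ℤ)).det :
      UnivRing n d) =
      (Matrix.vandermonde fun a : Fin (boxCard n d) => (C ((a : ℕ) : ℤ) : UnivRing n d)).det := by
    rw [RingHom.map_det]
    congr 1
    ext i j
    simp [Matrix.vandermonde]
  rw [hV, ← Matrix.det_mul, det_mul_vandermonde, decodePoly, discCode, List.map_map]
  change ∑ t ∈ Finset.range _, _ = _
  rw [Finset.sum_range, ← Equiv.sum_comp finFunctionFinEquiv]
  refine Finset.sum_congr rfl fun f _ => ?_
  have hf : ∀ a : Fin (boxCard n d),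
      digit (boxCard n d) (finFunctionFinEquiv f : Fin _) a = f a := fun a => by
    rw [digit, ← finFunctionFinEquiv_symm_apply_val, Equiv.symm_apply_apply]
  have hV' : (C (Matrix.vandermonde fun a : Fin (boxCard n d) => ((f a : ℕ) : ℤ)).det :
      UnivRing n d) = (Matrix.vandermonde fun a : Fin (boxCard n d) =>
        (C ((f a : ℕ) : ℤ) : UnivRing n d)).det := by
    rw [RingHom.map_det]
    congr 1
    ext i j
    simp [Matrix.vandermonde]
  simp only [Function.comp_apply]
  rw [prod_map_flatMap, prod_map_range, termCoef_eq]
  simp only [hf]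
  rw [← hV', map_mul, map_prod]
  simp only [univMatrix, univEntry, Matrix.of_apply, Finset.prod_mul_distrib]
  ring

theorem vandermonde_det_ne_zero (k : ℕ) :
    (Matrix.vandermonde fun a : Fin k => ((a : ℕ) : ℤ)).det ≠ 0 := by
  rw [Matrix.det_vandermonde_ne_zero_iff]
  intro a b h
  exact Fin.ext (by simpa using h)

end Code

end GriffithsDwork
end

noncomputable section
namespace GriffithsDwork
open MvPolynomial AlgDeRham

/-! ### The Macaulay matrix and the spanning of polynomials by the Jacobian ideal -/

section Macaulay

variable {A : Type*} [CommRing A] {n d : ℕ}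

/-- The exponent vector of the `c`-th monomial. -/
def boxExp (n d c : ℕ) : Fin (n + 2) →₀ ℕ :=
  Finsupp.equivFunOnFinite.symm fun i => digit (boxSide n d) c i

theorem boxExp_apply (c : ℕ) (i : Fin (n + 2)) : boxExp n d c i = digit (boxSide n d) c i := rfl

theorem boxExp_injective :
    Function.Injective fun c : Fin (boxCard n d) => boxExp n d c := by
  intro a b h
  apply finFunctionFinEquiv.symm.injective
  ext i
  exact ((finFunctionFinEquiv_symm_apply_val (m := boxSide n d) a i).trans
    (DFunLike.congr_fun h i)).trans
    (finFunctionFinEquiv_symm_apply_val (m := boxSide n d) b i).symm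

theorem exists_boxExp_eq (v : Fin (n + 2) →₀ ℕ) (hv : v.degree ≤ (n + 2) * d) :
    ∃ c : Fin (boxCard n d), boxExp n d c = v := by
  have h : ∀ i, v i < boxSide n d := fun i => by
    have := Finsupp.le_degree i v
    rw [boxSide]; omega
  refine ⟨finFunctionFinEquiv fun i => ⟨v i, h i⟩, ?_⟩
  ext i
  rw [boxExp_apply, digit, ← finFunctionFinEquiv_symm_apply_val, Equiv.symm_apply_apply]

theorem pivot_le (a : ℕ) : pivot n d a ≤ n + 2 := by
  have := List.findIdx_le_length (xs := List.range (n + 2))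
    (p := fun l => decide (d ≤ digit (boxSide n d) a l + 1))
  rwa [List.length_range] at this

theorem boxExp_of_pivot_eq {a : ℕ} (h : pivot n d a = n + 2) (i : Fin (n + 2)) :
    boxExp n d a i + 1 < d := by
  have h1 : pivot n d a = (List.range (n + 2)).length := by rw [h, List.length_range]
  rw [pivot, List.findIdx_eq_length] at h1
  have := h1 i (List.mem_range.2 i.2)
  rw [boxExp_apply]
  simpa using this

theorem boxExp_pivot {a : ℕ} (h : pivot n d a < n + 2) :
    d ≤ boxExp n d a ⟨pivot n d a, h⟩ + 1 := by
  have := List.findIdx_getElem (xs := List.range (n + 2))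
    (p := fun l => decide (d ≤ digit (boxSide n d) a l + 1)) (w := by
      rw [List.length_range]; exact h)
  rw [List.getElem_range] at this
  exact of_decide_eq_true this

variable (ρ : UnivRing n d →+* A)

/-- The specialization of the generic polynomial. -/
def specPoly : MvPolynomial (Fin (n + 2)) A :=
  ∑ w : Exps n d, C (ρ (X w)) * ∏ i, X i ^ w.1 i

theorem C_mul_prod_X_pow (a : A) (w : Fin (n + 2) → ℕ) :
    C a * ∏ i, X i ^ w i = monomial (Finsupp.equivFunOnFinite.symm w) a := by
  rw [monomial_eq, Finsupp.prod_fintype _ _ (fun i => pow_zero _)]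
  rfl

theorem specPoly_isHomogeneous : (specPoly ρ).IsHomogeneous d := by
  refine IsHomogeneous.sum _ _ _ fun w _ => ?_
  rw [C_mul_prod_X_pow]
  refine isHomogeneous_monomial _ ?_
  rw [Finsupp.degree_eq_sum]
  exact w.2

theorem coeff_specPoly (w : Exps n d) :
    coeff (Finsupp.equivFunOnFinite.symm w.1) (specPoly ρ) = ρ (X w) := by
  rw [specPoly, coeff_sum, Finset.sum_eq_single w]
  · rw [C_mul_prod_X_pow, coeff_monomial, if_pos rfl]
  · intro v _ hv
    rw [C_mul_prod_X_pow, coeff_monomial, if_neg]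
    intro h
    exact hv (Subtype.ext (Finsupp.equivFunOnFinite.symm.injective h))
  · intro h; exact absurd (Finset.mem_univ w) h

theorem specPoly_eq {F : MvPolynomial (Fin (n + 2)) A} (hF : F.IsHomogeneous d)
    (h : ∀ w : Exps n d, ρ (X w) = coeff (Finsupp.equivFunOnFinite.symm w.1) F) :
    specPoly ρ = F := by
  ext u
  by_cases hu : u.degree = d
  · have h1 : coeff (Finsupp.equivFunOnFinite.symm ⇑u) (specPoly ρ) =
        coeff (Finsupp.equivFunOnFinite.symm ⇑u) F :=
      (coeff_specPoly ρ ⟨u, by rw [← hu, Finsupp.degree_eq_sum]⟩).trans (h _)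
    rwa [Finsupp.equivFunOnFinite_symm_coe] at h1
  · rw [(specPoly_isHomogeneous ρ).coeff_eq_zero hu, hF.coeff_eq_zero hu]

/-- No restriction on the degree of `u` is needed: outside degree `d` the decoded variable and the
coefficient are both zero. -/
theorem map_decodeVar_eq {f : ℕ → ℕ} {u : Fin (n + 2) →₀ ℕ} (h : ∀ i : Fin (n + 2), f i = u i) :
    ρ (decodeVar n d ((List.range (n + 2)).map f)) = coeff u (specPoly ρ) := by
  have h1 : ∀ i : Fin (n + 2), ((List.range (n + 2)).map f).getD i 0 = u i := fun i => by
    rw [← h i]; simp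
  by_cases hu : u.degree = d
  · rw [decodeVar, dif_pos ⟨by simp, by rw [← hu, Finsupp.degree_eq_sum]; simp only [h1]⟩]
    refine (coeff_specPoly ρ _).symm.trans ?_
    congr 1
    ext i
    exact h1 i
  · rw [decodeVar, dif_neg, map_zero, (specPoly_isHomogeneous ρ).coeff_eq_zero hu]
    rintro ⟨-, h2⟩
    apply hu
    rw [← h2, Finsupp.degree_eq_sum]; simp only [h1]

/-- The value `d + 1` marks a missing quotient: it alone pushes the degree beyond `d`. -/
theorem map_decodeVar_eq_zero {f : ℕ → ℕ} {l : ℕ} (hl : l < n + 2) (h : f l = d + 1) :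
    ρ (decodeVar n d ((List.range (n + 2)).map f)) = 0 := by
  rw [decodeVar, dif_neg, map_zero]
  rintro ⟨-, h2⟩
  have := Finset.single_le_sum (f := fun i : Fin (n + 2) =>
    ((List.range (n + 2)).map f).getD i 0) (fun i _ => Nat.zero_le _) (Finset.mem_univ ⟨l, hl⟩)
  rw [h2] at this
  simp [hl, h] at this

/-- The row polynomial of the Macaulay matrix of a polynomial. -/
def rowPoly (d : ℕ) (P : MvPolynomial (Fin (n + 2)) A) (a : ℕ) : MvPolynomial (Fin (n + 2)) A :=
  if h : pivot n d a < n + 2 then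
    pderiv ⟨pivot n d a, h⟩ P *
      monomial (boxExp n d a - Finsupp.single ⟨pivot n d a, h⟩ (d - 1)) 1
  else monomial (boxExp n d a) 1

theorem degree_sub_single {v : Fin (n + 2) →₀ ℕ} {i : Fin (n + 2)} {e : ℕ} (h : e ≤ v i) :
    (v - Finsupp.single i e).degree + e = v.degree := by
  conv_rhs => rw [← tsub_add_cancel_of_le (Finsupp.single_le_iff.2 h)]
  simp

theorem rowPoly_mem_jacobianSpan (P : MvPolynomial (Fin (n + 2)) A) (a : ℕ) :
    rowPoly d P a ∈ jacobianSpan P d (boxExp n d a).degree := by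
  rw [rowPoly]
  apply Submodule.subset_span
  split_ifs with h
  · exact Or.inr ⟨_, _, degree_sub_single (by have := boxExp_pivot h; omega), rfl⟩
  · exact Or.inl ⟨_, rfl, boxExp_of_pivot_eq (le_antisymm (pivot_le a) (not_lt.1 h)), rfl⟩

theorem rowPoly_isHomogeneous {P : MvPolynomial (Fin (n + 2)) A} (hP : P.IsHomogeneous d) (a : ℕ) :
    (rowPoly d P a).IsHomogeneous (boxExp n d a).degree := by
  rw [rowPoly]
  split_ifs with h
  · have h1 := (hP.pderiv (i := ⟨pivot n d a, h⟩)).mul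
      (isHomogeneous_monomial (1 : A) (d := boxExp n d a -
        Finsupp.single ⟨pivot n d a, h⟩ (d - 1)) rfl)
    rwa [add_comm (d - 1), degree_sub_single (by have := boxExp_pivot h; omega)] at h1
  · exact isHomogeneous_monomial _ rfl

/-- Write `a`, `c` for the two exponent vectors and `i` for the pivot. The coefficient of `x^c` in
`x^{a-(d-1)e_i} ∂_i P` is `u_i` times that of `x^u` in `P`, with `u = c - a + d e_i`.
Differentiation accounts for the shift by `d` instead of `d - 1`, and for the integer factor. -/
theorem map_univEntry (hd : 1 ≤ d) (a c : Fin (boxCard n d)) :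
    ρ (univEntry n d a c) = coeff (boxExp n d c) (rowPoly d (specPoly ρ) a) := by
  rw [univEntry, rowPoly, entryCoef, entryVars]
  by_cases h : pivot n d a < n + 2
  · rw [dif_pos h, if_neg h.ne, if_neg h.ne, List.map_singleton, List.prod_singleton, map_mul]
    set i : Fin (n + 2) := ⟨pivot n d a, h⟩ with hi
    have hpiv : ∀ l : Fin (n + 2), (l : ℕ) = pivot n d a ↔ l = i := fun l => by
      rw [hi, Fin.ext_iff]
    have hq : ∀ l : Fin (n + 2), quotExp n d a c l =
        if boxExp n d a l ≤ boxExp n d c l + (if l = i then d else 0) then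
          boxExp n d c l + (if l = i then d else 0) - boxExp n d a l else d + 1 := fun l => by
      simp only [quotExp, hpiv, boxExp_apply]
      congr
    have hqi := hq i
    rw [if_pos rfl] at hqi
    have hai : d ≤ boxExp n d a i + 1 := boxExp_pivot h
    rw [coeff_mul_monomial', mul_one]
    by_cases hle : boxExp n d a - Finsupp.single i (d - 1) ≤ boxExp n d c
    · rw [if_pos hle, coeff_pderiv]
      have hle' : ∀ l, boxExp n d a l ≤ boxExp n d c l + (if l = i then d - 1 else 0) := fun l => by
        have := hle l
        rw [Finsupp.tsub_apply, Finsupp.single_apply] at this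
        simp only [eq_comm (a := i)] at this
        omega
      have hle'' : ∀ l, boxExp n d a l ≤ boxExp n d c l + (if l = i then d else 0) := fun l => by
        have := hle' l
        split_ifs at this ⊢ <;> omega
      have hu : ∀ l : Fin (n + 2), quotExp n d a c l = (boxExp n d c -
          (boxExp n d a - Finsupp.single i (d - 1)) + Finsupp.single i 1 :
            Fin (n + 2) →₀ ℕ) l := fun l => by
        rw [hq, if_pos (hle'' l), Finsupp.add_apply, Finsupp.tsub_apply, Finsupp.tsub_apply,
          Finsupp.single_apply, Finsupp.single_apply]
        simp only [eq_comm (a := i)]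
        have := hle' l
        split_ifs at this ⊢ with h1
        · subst h1; omega
        · omega
      rw [map_decodeVar_eq ρ hu, mul_comm]
      congr 1
      have := hu i
      rw [Finsupp.add_apply, Finsupp.single_eq_same] at this
      change quotExp n d a c (pivot n d a) = _ at this
      rw [this]
      simp
    · rw [if_neg hle]
      obtain ⟨l, hl⟩ : ∃ l, ¬ boxExp n d a l ≤
          boxExp n d c l + (if l = i then d - 1 else 0) := by
        by_contra! hcon
        refine hle fun l => ?_
        have := hcon l
        rw [Finsupp.tsub_apply, Finsupp.single_apply]
        simp only [eq_comm (a := i)]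
        omega
      by_cases hli : l = i
      · subst hli
        rw [if_pos rfl] at hl
        -- In the borderline case `a_i = c_i + d` the variable may be genuine, but its integer
        -- factor is zero.
        by_cases h0 : boxExp n d a i ≤ boxExp n d c i + d
        · have h1 : quotExp n d a c (pivot n d a) = 0 := by
            change quotExp n d a c i = 0
            rw [hqi, if_pos h0]; omega
          rw [h1]; simp
        · rw [map_decodeVar_eq_zero ρ i.2 (by rw [hqi, if_neg h0]), mul_zero]
      · rw [if_neg hli] at hl
        rw [map_decodeVar_eq_zero ρ l.2 (by rw [hq, if_neg hli, if_neg hl]), mul_zero]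
  · rw [dif_neg h, if_pos (le_antisymm (pivot_le _) (not_lt.1 h)),
      if_pos (le_antisymm (pivot_le _) (not_lt.1 h)), coeff_monomial]
    have : boxExp n d a = boxExp n d c ↔ (a : ℕ) = c :=
      ⟨fun h => congrArg Fin.val (boxExp_injective h), fun h => by rw [h]⟩
    simp [this]

/-- The box contains every monomial of degree at most `(n+2)d`, so in these degrees the matrix
records the row polynomials completely. A row of the inverse matrix then expresses the monomial
through them. -/
theorem monomial_mem_jacobianSpan_of_isUnit (hd : 1 ≤ d)
    (hM : IsUnit (ρ (univMatrix n d).det)) (v : Fin (n + 2) →₀ ℕ) :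
    monomial v 1 ∈ jacobianSpan (specPoly ρ) d v.degree := by
  refine monomial_mem_jacobianSpan_of_le hd (fun v hv => ?_) v
  obtain ⟨b, hb⟩ := exists_boxExp_eq v hv
  set M : Matrix (Fin (boxCard n d)) (Fin (boxCard n d)) A := ρ.mapMatrix (univMatrix n d) with hMdef
  have hdet : IsUnit M.det := by rwa [hMdef, ← RingHom.map_det]
  have hMac : ∀ a c, M a c = coeff (boxExp n d c) (rowPoly d (specPoly ρ) a) := fun a c => by
    rw [← map_univEntry ρ hd]; rfl
  have hrow := rowPoly_isHomogeneous (specPoly_isHomogeneous ρ)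
  -- Rows of other degrees can be dropped, since they have no coefficients in the degree of `v`.
  -- This also disposes of row polynomials that reach outside the box.
  have key : (monomial v 1 : MvPolynomial (Fin (n + 2)) A) =
      ∑ a : Fin (boxCard n d), if (boxExp n d a).degree = v.degree then
        M⁻¹ b a • rowPoly d (specPoly ρ) a else 0 := by
    ext u
    by_cases hu : u.degree = v.degree
    · obtain ⟨c, hc⟩ := exists_boxExp_eq u (hu.trans_le hv)
      have h1 : ∑ a, M⁻¹ b a * M a c = if b = c then 1 else 0 := by
        rw [← Matrix.mul_apply, Matrix.nonsing_inv_mul _ hdet, Matrix.one_apply]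
      rw [coeff_sum, coeff_monomial, ← hb, ← hc]
      have h2 : boxExp n d b = boxExp n d c ↔ b = c := boxExp_injective.eq_iff
      rw [if_congr h2 rfl rfl, ← h1]
      refine Finset.sum_congr rfl fun a _ => ?_
      split_ifs with h3
      · rw [coeff_smul, hMac, smul_eq_mul]
      · rw [hMac, (hrow a).coeff_eq_zero, mul_zero, coeff_zero]
        rw [hc, hu, ← hb]; exact fun h => h3 h.symm
    · rw [coeff_monomial, if_neg (fun h => hu (by rw [h])), coeff_sum]
      symm
      refine Finset.sum_eq_zero fun a _ => ?_
      split_ifs with h3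
      · rw [coeff_smul, (hrow a).coeff_eq_zero (by rw [h3]; exact hu), smul_zero]
      · rw [coeff_zero]
  rw [key]
  refine Submodule.sum_mem _ fun a _ => ?_
  split_ifs with h
  · rw [← h]
    exact Submodule.smul_mem _ _ (rowPoly_mem_jacobianSpan _ _)
  · exact Submodule.zero_mem _

theorem fermatPoly_isHomogeneous : (fermatPoly A n d).IsHomogeneous d :=
  IsHomogeneous.sum _ _ _ fun i _ => isHomogeneous_X_pow i d

/-- As `∂_i F = d x_i^{d-1}`, dividing by `x_i^{d-1}` and multiplying by `∂_i F` only rescales the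
monomial. Hence the matrix is diagonal at the Fermat point. -/
theorem rowPoly_fermatPoly (a : ℕ) : rowPoly d (fermatPoly A n d) a =
    monomial (boxExp n d a) (if pivot n d a < n + 2 then (d : A) else 1) := by
  rw [rowPoly]
  split_ifs with h
  · set i : Fin (n + 2) := ⟨pivot n d a, h⟩
    have h1 : pderiv i (fermatPoly A n d) = monomial (Finsupp.single i (d - 1)) (d : A) := by
      rw [fermatPoly, map_sum, Finset.sum_eq_single i]
      · rw [X_pow_eq_monomial, pderiv_monomial]
        simp [← Finsupp.single_tsub]
      · intro j _ hj
        rw [pderiv_pow, pderiv_X_of_ne hj, mul_zero]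
      · intro h; exact absurd (Finset.mem_univ i) h
    have hai : d ≤ boxExp n d a i + 1 := boxExp_pivot h
    rw [h1, monomial_mul, mul_one,
      add_tsub_cancel_of_le (Finsupp.single_le_iff.2 (by omega : d - 1 ≤ boxExp n d a i))]
  · rfl

theorem det_univMatrix_fermat (hd : 1 ≤ d) (h : specPoly ρ = fermatPoly A n d) :
    ρ (univMatrix n d).det =
      ∏ a : Fin (boxCard n d), if pivot n d a < n + 2 then (d : A) else 1 := by
  rw [RingHom.map_det, ← Matrix.det_diagonal]
  congr 1
  ext a c
  change ρ (univEntry n d a c) = _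
  rw [map_univEntry ρ hd, h, rowPoly_fermatPoly, coeff_monomial, Matrix.diagonal_apply]
  exact if_congr boxExp_injective.eq_iff rfl rfl

end Macaulay

end GriffithsDwork
end

noncomputable section
namespace GriffithsDwork
open MvPolynomial AlgDeRham

/-! ### The Fermat point and its infinitesimal neighbourhoods -/

section Discriminant

variable (n d : ℕ)

/-- The discriminant-like polynomial outside of which the pole forms are a basis. -/
def disc : UnivRing n d := decodePoly n d (discCode n d)

theorem disc_eq : disc n d = (univMatrix n d).det *
    C (Matrix.vandermonde fun a : Fin (boxCard n d) => ((a : ℕ) : ℤ)).det :=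
  decodePoly_discCode n d

variable {A : Type*} [CommRing A]

/-- Evaluation of the coefficients of the generic polynomial at those of the Fermat polynomial. -/
def fermatEval : MvPolynomial (Exps n d) ℚ →+* ℚ :=
  eval fun w => coeff (Finsupp.equivFunOnFinite.symm w.1) (fermatPoly ℚ n d)

theorem fermatEval_disc_ne_zero (hd : 1 ≤ d) :
    fermatEval n d (map (Int.castRingHom ℚ) (disc n d)) ≠ 0 := by
  set ρ : UnivRing n d →+* ℚ := (fermatEval n d).comp (map (Int.castRingHom ℚ)) with hρ
  have h : specPoly ρ = fermatPoly ℚ n d := specPoly_eq ρ fermatPoly_isHomogeneous fun w => by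
    simp [hρ, fermatEval]
  change ρ (disc n d) ≠ 0
  rw [disc_eq, map_mul, det_univMatrix_fermat ρ hd h]
  refine mul_ne_zero (Finset.prod_ne_zero_iff.2 fun a _ => ?_) ?_
  · have : (d : ℚ) ≠ 0 := by positivity
    split_ifs <;> simp [this]
  · simpa [hρ, fermatEval] using vandermonde_det_ne_zero (boxCard n d)

theorem disc_ne_zero (hd : 1 ≤ d) : disc n d ≠ 0 := fun h =>
  fermatEval_disc_ne_zero n d hd (by rw [h, map_zero, map_zero])

/-- The ideal of the point that is given by the Fermat polynomial. -/
def fermatIdeal : Ideal (MvPolynomial (Exps n d) ℚ) := RingHom.ker (fermatEval n d)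

/-- Krull's intersection theorem for a proper ideal in a Noetherian domain. -/
theorem iInf_fermatIdeal_pow : ⨅ N, fermatIdeal n d ^ N = ⊥ :=
  Ideal.iInf_pow_eq_bot_of_isDomain _ (RingHom.ker_ne_top _)

/-- An infinitesimal neighbourhood of the point that is given by the Fermat polynomial. -/
abbrev FermatJet (N : ℕ) : Type := MvPolynomial (Exps n d) ℚ ⧸ fermatIdeal n d ^ N

/-- The maximal ideal of the infinitesimal neighbourhood. -/
def jetIdeal (N : ℕ) : Ideal (FermatJet n d N) :=
  (fermatIdeal n d).map (Ideal.Quotient.mk (fermatIdeal n d ^ N))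

theorem jetIdeal_pow (N : ℕ) : jetIdeal n d N ^ N = ⊥ := by
  rw [jetIdeal, ← Ideal.map_pow, Ideal.map_quotient_self]

theorem sub_C_mem_fermatIdeal (p : MvPolynomial (Exps n d) ℚ) :
    p - C (fermatEval n d p) ∈ fermatIdeal n d := by
  rw [fermatIdeal, RingHom.mem_ker, map_sub, sub_eq_zero]
  simp [fermatEval]

/-- The image is a nonzero rational number, the value at the Fermat point, plus a nilpotent. -/
theorem isUnit_jet (hd : 1 ≤ d) (N : ℕ) :
    IsUnit (Ideal.Quotient.mk (fermatIdeal n d ^ N)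
      (map (Int.castRingHom ℚ) (disc n d))) := by
  set p := map (Int.castRingHom ℚ) (disc n d)
  rw [← sub_add_cancel p (C (fermatEval n d p)), map_add, add_comm]
  refine IsNilpotent.isUnit_add_left_of_commute ⟨N, ?_⟩ ?_ (Commute.all _ _)
  · rw [← map_pow, Ideal.Quotient.eq_zero_iff_mem]
    exact Ideal.pow_mem_pow (sub_C_mem_fermatIdeal n d p) N
  · exact ((IsUnit.mk0 _ (fermatEval_disc_ne_zero n d hd)).map C).map _

/-- The specialization to an infinitesimal neighbourhood of the Fermat polynomial. -/
def jetHom (hd : 1 ≤ d) (N : ℕ) : BaseRing n d (disc n d) →+* FermatJet n d N :=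
  IsLocalization.Away.lift (map (Int.castRingHom ℚ) (disc n d)) (isUnit_jet n d hd N)

theorem jetHom_algebraMap (hd : 1 ≤ d) (N : ℕ) (p : MvPolynomial (Exps n d) ℚ) :
    jetHom n d hd N (algebraMap _ _ p) = Ideal.Quotient.mk _ p :=
  IsLocalization.Away.lift_eq _ _ _

/-- After clearing denominators, the numerator lies in every power of the Fermat ideal. -/
theorem eq_zero_of_jetHom (hd : 1 ≤ d) {c : BaseRing n d (disc n d)}
    (h : ∀ N, jetHom n d hd N c = 0) : c = 0 := by
  obtain ⟨k, p, hp⟩ := IsLocalization.Away.surj (map (Int.castRingHom ℚ) (disc n d)) c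
  have h0 : p = 0 := by
    rw [← Ideal.mem_bot, ← iInf_fermatIdeal_pow, Submodule.mem_iInf]
    intro N
    rw [← Ideal.Quotient.eq_zero_iff_mem, ← jetHom_algebraMap n d hd, ← hp, map_mul, h, zero_mul]
  rw [h0, map_zero] at hp
  exact (((IsLocalization.Away.algebraMap_isUnit
    (map (Int.castRingHom ℚ) (disc n d))).pow k).mul_left_eq_zero).1 hp

/-- The structure map of the base ring. -/
def baseHom : UnivRing n d →+* BaseRing n d (disc n d) :=
  (algebraMap (MvPolynomial (Exps n d) ℚ) (BaseRing n d (disc n d))).comp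
    (map (Int.castRingHom ℚ))

theorem genericPoly_eq : genericPoly n d (disc n d) = specPoly (baseHom n d) := by
  simp [genericPoly, specPoly, baseHom]

theorem isUnit_baseHom_det : IsUnit (baseHom n d (univMatrix n d).det) := by
  have h : IsUnit (baseHom n d (disc n d)) :=
    IsLocalization.Away.algebraMap_isUnit (map (Int.castRingHom ℚ) (disc n d))
  have h1 := congrArg (baseHom n d) (disc_eq n d)
  rw [h1, map_mul] at h
  exact isUnit_of_mul_isUnit_left h

theorem coeff_map_jetHom_sub_mem (hd : 1 ≤ d) (N : ℕ) (u : Fin (n + 2) →₀ ℕ) :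
    coeff u (map (jetHom n d hd N) (genericPoly n d (disc n d)) -
      fermatPoly (FermatJet n d N) n d) ∈ jetIdeal n d N := by
  have hF : fermatPoly (FermatJet n d N) n d =
      map (algebraMap ℚ (FermatJet n d N)) (fermatPoly ℚ n d) := by
    simp [fermatPoly]
  rw [coeff_sub, coeff_map, hF, coeff_map, genericPoly_eq]
  by_cases hu : u.degree = d
  · obtain ⟨w, rfl⟩ : ∃ w : Exps n d, Finsupp.equivFunOnFinite.symm w.1 = u :=
      ⟨⟨u, by rw [← hu, Finsupp.degree_eq_sum]⟩, Finsupp.equivFunOnFinite_symm_coe u⟩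
    have h := Ideal.mem_map_of_mem (Ideal.Quotient.mk (fermatIdeal n d ^ N))
      (sub_C_mem_fermatIdeal n d (X w))
    rw [fermatEval, eval_X, map_sub] at h
    rw [coeff_specPoly, baseHom, RingHom.comp_apply, map_X, jetHom_algebraMap]
    exact h
  · rw [(specPoly_isHomogeneous (baseHom n d)).coeff_eq_zero hu,
      fermatPoly_isHomogeneous.coeff_eq_zero hu, map_zero, map_zero, sub_zero]
    exact zero_mem _

end Discriminant

/-! ### The basis over the generic base -/

section Basis
variable (n d : ℕ)

theorem exists_basis_poleForms (hd : 1 ≤ d) :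
    ∃ b : PoleIndex n d →
        closedForms (BaseRing n d (disc n d)) (ComplementRing (genericPoly n d (disc n d))) (n + 1),
      (∀ (i : PoleIndex n d)
          (ω : Forms (BaseRing n d (disc n d)) (ComplementRing (genericPoly n d (disc n d)))),
        IsPoleForm (genericPoly n d (disc n d)) i.1.1 i.1.2 ω ↔ ω = b i) ∧
      ∃ B : Module.Basis (PoleIndex n d) (BaseRing n d (disc n d))
          (DeRhamCohomology (BaseRing n d (disc n d))
            (ComplementRing (genericPoly n d (disc n d))) (n + 1)),
        ∀ i : PoleIndex n d,
          B i = deRhamClass (BaseRing n d (disc n d))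
            (ComplementRing (genericPoly n d (disc n d))) (n + 1) (b i) := by
  have hP := genericPoly_isHomogeneous n d (disc n d)
  refine exists_basis_of_divergences hP hd (fun i : PoleIndex n d => i.1.1) (fun i => i.1.2)
    (fun i => ?_) (fun z hz => ?_) (fun c hc => ?_)
  · have hi : (∑ j, i.1.1 j) + n + 2 = i.1.2 * d := i.2.2
    have h := div_mem_coneDeg hP (j := -(n + 2)) (k := i.1.2) (isHomogeneous_monomial
      (1 : BaseRing n d (disc n d)) (d := Finsupp.equivFunOnFinite.symm i.1.1) rfl) (by
        rw [Finsupp.degree_eq_sum]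
        change ((∑ j, i.1.1 j : ℕ) : ℤ) = _
        have : ((∑ j, i.1.1 j : ℕ) : ℤ) + n + 2 = i.1.2 * d := by exact_mod_cast hi
        linarith)
    rwa [toCone_monomial] at h
  · refine exists_sub_mem_divergences hP hd ?_ hz
    intro v
    rw [genericPoly_eq]
    exact monomial_mem_jacobianSpan_of_isUnit _ hd (isUnit_baseHom_det n d) v
  -- A relation is tested on every infinitesimal neighbourhood of the Fermat point.
  · ext i
    refine eq_zero_of_jetHom n d hd fun N => ?_
    exact map_eq_zero_of_mem_divergences (jetIdeal n d N) hd (jetIdeal_pow n d N)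
      (coeff_map_jetHom_sub_mem n d hd N) hP c hc i

end Basis

end GriffithsDwork
end

noncomputable section
namespace GriffithsDwork
open MvPolynomial AlgDeRham

/-! ### Primitive recursiveness of the list of terms -/

section Computability

variable {α : Type*} [Primcodable α]

theorem primrec_prod_range {f : α → ℕ} {g : α → ℕ → ℕ} (hf : Primrec f) (hg : Primrec₂ g) :
    Primrec fun x => ∏ i ∈ Finset.range (f x), g x i := by
  have h : Primrec fun x => (Nat.rec 1 (fun i p => p * g x i) (f x) : ℕ) :=
    Primrec.nat_rec' hf (Primrec.const 1) (Primrec.nat_mul.comp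
      (Primrec.snd.comp Primrec.snd) (hg.comp Primrec.fst (Primrec.fst.comp Primrec.snd))).to₂
  refine h.of_eq fun x => ?_
  induction f x with
  | zero => rfl
  | succ k ih => rw [Finset.prod_range_succ, ← ih]

theorem primrec_sum_range {f : α → ℕ} {g : α → ℕ → ℕ} (hf : Primrec f) (hg : Primrec₂ g) :
    Primrec fun x => ∑ i ∈ Finset.range (f x), g x i := by
  have h : Primrec fun x => (Nat.rec 0 (fun i p => p + g x i) (f x) : ℕ) :=
    Primrec.nat_rec' hf (Primrec.const 0) (Primrec.nat_add.comp
      (Primrec.snd.comp Primrec.snd) (hg.comp Primrec.fst (Primrec.fst.comp Primrec.snd))).to₂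
  refine h.of_eq fun x => ?_
  induction f x with
  | zero => rfl
  | succ k ih => rw [Finset.sum_range_succ, ← ih]

theorem primrec_pow {f g : α → ℕ} (hf : Primrec f) (hg : Primrec g) :
    Primrec fun x => f x ^ g x :=
  (primrec_prod_range hg (hf.comp Primrec.fst).to₂).of_eq fun x => by simp

theorem primrec_digit {f g h : α → ℕ} (hf : Primrec f) (hg : Primrec g) (hh : Primrec h) :
    Primrec fun x => digit (f x) (g x) (h x) :=
  Primrec.nat_mod.comp (Primrec.nat_div.comp hg (primrec_pow hf hh)) hf

theorem primrec_boxSide {n d : α → ℕ} (hn : Primrec n) (hd : Primrec d) :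
    Primrec fun x => boxSide (n x) (d x) :=
  Primrec.succ.comp (Primrec.nat_mul.comp (Primrec.nat_add.comp hn (Primrec.const 2)) hd)

theorem primrec_boxCard {n d : α → ℕ} (hn : Primrec n) (hd : Primrec d) :
    Primrec fun x => boxCard (n x) (d x) :=
  primrec_pow (primrec_boxSide hn hd) (Primrec.nat_add.comp hn (Primrec.const 2))

theorem primrec_pivot {n d a : α → ℕ} (hn : Primrec n) (hd : Primrec d) (ha : Primrec a) :
    Primrec fun x => pivot (n x) (d x) (a x) := by
  refine Primrec.list_findIdx (Primrec.list_range.comp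
    (Primrec.nat_add.comp hn (Primrec.const 2))) ?_
  exact (PrimrecRel.comp Primrec.nat_le (hd.comp Primrec.fst)
    (Primrec.succ.comp (primrec_digit ((primrec_boxSide hn hd).comp Primrec.fst)
      (ha.comp Primrec.fst) Primrec.snd))).decide.to₂

theorem primrec_quotExp {n d a c l : α → ℕ} (hn : Primrec n) (hd : Primrec d) (ha : Primrec a)
    (hc : Primrec c) (hl : Primrec l) :
    Primrec fun x => quotExp (n x) (d x) (a x) (c x) (l x) := by
  have h1 := primrec_digit (primrec_boxSide hn hd) ha hl
  have h2 := Primrec.nat_add.comp (primrec_digit (primrec_boxSide hn hd) hc hl)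
    (Primrec.ite (PrimrecRel.comp Primrec.eq hl (primrec_pivot hn hd ha)) hd (Primrec.const 0))
  exact Primrec.ite (PrimrecRel.comp Primrec.nat_le h1 h2) (Primrec.nat_sub.comp h2 h1)
    (Primrec.succ.comp hd)

theorem primrec_entryCoef {n d a c : α → ℕ} (hn : Primrec n) (hd : Primrec d) (ha : Primrec a)
    (hc : Primrec c) : Primrec fun x => entryCoef (n x) (d x) (a x) (c x) :=
  Primrec.ite (PrimrecRel.comp Primrec.eq (primrec_pivot hn hd ha)
      (Primrec.nat_add.comp hn (Primrec.const 2)))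
    (Primrec.ite (PrimrecRel.comp Primrec.eq ha hc) (Primrec.const 1) (Primrec.const 0))
    (primrec_quotExp hn hd ha hc (primrec_pivot hn hd ha))

theorem primrec_entryVars {n d a c : α → ℕ} (hn : Primrec n) (hd : Primrec d) (ha : Primrec a)
    (hc : Primrec c) : Primrec fun x => entryVars (n x) (d x) (a x) (c x) :=
  Primrec.ite (PrimrecRel.comp Primrec.eq (primrec_pivot hn hd ha)
      (Primrec.nat_add.comp hn (Primrec.const 2)))
    (Primrec.const [])
    (Primrec.list_cons.comp (Primrec.list_map (Primrec.list_range.comp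
      (Primrec.nat_add.comp hn (Primrec.const 2)))
      (primrec_quotExp (hn.comp Primrec.fst) (hd.comp Primrec.fst) (ha.comp Primrec.fst)
        (hc.comp Primrec.fst) Primrec.snd).to₂) (Primrec.const []))

theorem primrec_inversions {b t k : α → ℕ} (hb : Primrec b) (ht : Primrec t) (hk : Primrec k) :
    Primrec fun x => inversions (b x) (t x) (k x) := by
  refine primrec_sum_range hk (primrec_sum_range (α := α × ℕ) (f := fun p => k p.1)
    (g := fun p i => if p.2 < i ∧ digit (b p.1) (t p.1) i < digit (b p.1) (t p.1) p.2 then 1 else 0)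
    (hk.comp Primrec.fst) ?_)
  have hi : Primrec fun p : (α × ℕ) × ℕ => p.1.2 := Primrec.snd.comp Primrec.fst
  have hx : Primrec fun p : (α × ℕ) × ℕ => p.1.1 := Primrec.fst.comp Primrec.fst
  have h1 := primrec_digit (hb.comp hx) (ht.comp hx) hi
  have h2 := primrec_digit (hb.comp hx) (ht.comp hx) Primrec.snd
  exact (Primrec.ite ((PrimrecRel.comp Primrec.nat_lt hi Primrec.snd).and
    (PrimrecRel.comp Primrec.nat_lt h2 h1)) (Primrec.const 1) (Primrec.const 0)).to₂

theorem primrec_absVandermonde {b t k : α → ℕ} (hb : Primrec b) (ht : Primrec t)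
    (hk : Primrec k) : Primrec fun x => absVandermonde (b x) (t x) (k x) := by
  refine primrec_prod_range hk (primrec_prod_range (α := α × ℕ) (f := fun p => k p.1)
    (g := fun p i => if p.2 < i then (digit (b p.1) (t p.1) i - digit (b p.1) (t p.1) p.2) +
        (digit (b p.1) (t p.1) p.2 - digit (b p.1) (t p.1) i) else 1)
    (hk.comp Primrec.fst) ?_)
  have hi : Primrec fun p : (α × ℕ) × ℕ => p.1.2 := Primrec.snd.comp Primrec.fst
  have hx : Primrec fun p : (α × ℕ) × ℕ => p.1.1 := Primrec.fst.comp Primrec.fst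
  have h1 := primrec_digit (hb.comp hx) (ht.comp hx) hi
  have h2 := primrec_digit (hb.comp hx) (ht.comp hx) Primrec.snd
  exact (Primrec.ite (PrimrecRel.comp Primrec.nat_lt hi Primrec.snd)
    (Primrec.nat_add.comp (Primrec.nat_sub.comp h2 h1) (Primrec.nat_sub.comp h1 h2))
    (Primrec.const 1)).to₂

theorem primrec_natCast_int : Primrec fun k : ℕ => (k : ℤ) :=
  Primrec.encode_iff.1 ((Primrec.nat_mul.comp (Primrec.const 2) Primrec.id).of_eq fun _ => rfl)

theorem primrec_neg_natCast_int : Primrec fun k : ℕ => -(k : ℤ) := by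
  -- The encoding of integers sends `k ≥ 0` to `2k` and `-k < 0` to `2k - 1`. Truncated subtraction
  -- also gives the right value at `k = 0`.
  refine Primrec.encode_iff.1 ((Primrec.nat_sub.comp
    (Primrec.nat_mul.comp (Primrec.const 2) Primrec.id) (Primrec.const 1)).of_eq fun k => ?_)
  cases k with
  | zero => rfl
  | succ k => rfl

theorem primrec_termCoef {n d t : α → ℕ} (hn : Primrec n) (hd : Primrec d) (ht : Primrec t) :
    Primrec fun x => termCoef (n x) (d x) (t x) := by
  have hN := primrec_boxCard hn hd
  have h := Primrec.nat_mul.comp (primrec_absVandermonde hN ht hN) (primrec_prod_range hN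
    (primrec_entryCoef (hn.comp Primrec.fst) (hd.comp Primrec.fst) Primrec.snd
      (primrec_digit (hN.comp Primrec.fst) (ht.comp Primrec.fst) Primrec.snd)).to₂)
  exact Primrec.ite (PrimrecRel.comp Primrec.eq
    (Primrec.nat_mod.comp (primrec_inversions hN ht hN) (Primrec.const 2)) (Primrec.const 1))
    (primrec_neg_natCast_int.comp h) (primrec_natCast_int.comp h)

theorem primrec_discCode : Primrec₂ discCode := by
  have hn : Primrec fun p : ℕ × ℕ => p.1 := Primrec.fst
  have hd : Primrec fun p : ℕ × ℕ => p.2 := Primrec.snd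
  have hN := primrec_boxCard hn hd
  have hvars : Primrec fun q : (ℕ × ℕ) × ℕ => (List.range (boxCard q.1.1 q.1.2)).flatMap fun a =>
      entryVars q.1.1 q.1.2 a (digit (boxCard q.1.1 q.1.2) q.2 a) := by
    refine Primrec.list_flatMap (Primrec.list_range.comp (hN.comp Primrec.fst)) ?_
    have hx : Primrec fun p : ((ℕ × ℕ) × ℕ) × ℕ => p.1.1 := Primrec.fst.comp Primrec.fst
    have ht : Primrec fun p : ((ℕ × ℕ) × ℕ) × ℕ => p.1.2 := Primrec.snd.comp Primrec.fst
    exact (primrec_entryVars (hn.comp hx) (hd.comp hx) Primrec.snd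
      (primrec_digit (hN.comp hx) ht Primrec.snd)).to₂
  exact (Primrec.list_map (Primrec.list_range.comp (primrec_pow hN hN))
    (Primrec.pair (primrec_termCoef (hn.comp Primrec.fst) (hd.comp Primrec.fst) Primrec.snd)
      hvars).to₂).to₂

end Computability

end GriffithsDwork
end

theorem mainTheorem6 :
    ∃ Δ : ∀ n d : ℕ, UnivRing n d,
      (∃ code : ℕ → ℕ → PolyCode, Computable₂ code ∧
        ∀ n d : ℕ, decodePoly n d (code n d) = Δ n d) ∧
      ∀ n d : ℕ, 2 ≤ n → 1 ≤ d →
        Δ n d ≠ 0 ∧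
        ∃ b : PoleIndex n d →
            closedForms (BaseRing n d (Δ n d)) (ComplementRing (genericPoly n d (Δ n d))) (n + 1),
          (∀ (i : PoleIndex n d)
              (ω : Forms (BaseRing n d (Δ n d)) (ComplementRing (genericPoly n d (Δ n d)))),
            IsPoleForm (genericPoly n d (Δ n d)) i.1.1 i.1.2 ω ↔ ω = b i) ∧
          ∃ B : Module.Basis (PoleIndex n d) (BaseRing n d (Δ n d))
              (DeRhamCohomology (BaseRing n d (Δ n d))
                (ComplementRing (genericPoly n d (Δ n d))) (n + 1)),
            ∀ i : PoleIndex n d,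
              B i = deRhamClass (BaseRing n d (Δ n d))
                (ComplementRing (genericPoly n d (Δ n d))) (n + 1) (b i) := by
  refine ⟨disc, ⟨discCode, primrec_discCode.to_comp, fun _ _ => rfl⟩, fun n d _ hd =>
    ⟨disc_ne_zero n d hd, exists_basis_poleForms n d hd⟩⟩
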